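/- Let $m,r\ge 0$, $n=r+m+1$, and let $Z$ be a real $(m+1)\times n$ matrix with columns $Z_1,\dots,Z_n$, all of whose ordered maximal minors are positive. Let $\mathcal A=\mathcal A_{n,1,m}(Z)\subset\mathbb P^m$ be the cyclic polytope with cone $\{ZC : C\in\mathbb R^n_{\ge 0}\}\subset\mathbb R^{m+1}$, and for $J\in\binom{[n]}{m+1}$ let $\Delta_J\subset\mathbb P^m$ be the simplex with vertices $Z_j$, $j\in J$. **Canonical functions.** The canonical function $\Omega(P)$ of a polytope $P\subset \mathbb P^m$ is the homogeneous rational function of degree $-(m+1)$ such that $\mathbf\Omega(P)=\Omega(P)\,\mu$, with $\mu(Y)=\sum_i\epsilon_{i\bar i}\,Y_i\bigwedge_{j\ne i} dY_j$, is the canonical form of $P$: it has only simple poles, exactly along the facets of $P$; its residue along each facet is the canonical form of that facet; the canonical form of a point is $1$; and signs are such that $\Omega(P)$ is positive on the interior of the cone of $P$. **Fiber volume form.** Let $\pi:\mathrm{Gr}(1,n)\dashrightarrow \mathrm{Gr}(1,m+1)$ be induced by $Z$. Let $\omega$ be a basic covariant $r$-form of degree $-(m+1)$ (horizontal for scaling,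 with $\omega$ pulled back under $C\mapsto tC$ being $t^{-(m+1)}\omega$) on the set where $C_1\cdots C_n\neq 0$ and $ZC\ne0$, satisfying $$\frac{1}{C_1\cdots C_n}\sum_i \epsilon_{i\bar i}\,C_i\bigwedge_{j\neq i}dC_j=\omega\wedge\pi^*\mu .$$ For $Y\in\mathbb R^{m+1}$ the fiber volume form $\omega_{n,1,m}(Y)$ is the restriction of $\omega$ to $\{C: ZC=Y\}$. Choose a basis of $\ker Z$, the columns of an $n\times r$ matrix $B$, and use the coordinates $x\mapsto c+Bx$ (with $Zc=Y$) on the fiber, oriented so that $\omega_{n,1,m}$ is positive where all $C_i>0$. The rows $\beta_1,\dots,\beta_n\in\mathbb R^r$ of $B$ are the Gale transform $Z_1^\perp,\dots,Z_n^\perp$; put $C_I=\{\sum_{i\in I}a_i\beta_i: a_i\ge0\}$. **JK residue.** Let $F\,dx_1\wedge\cdots\wedge dx_r$ have simple poles on the hyperplanes $D_i(x)=\langle\beta_i,x\rangle+c_i=0$, where any $r$ of them, indexed by $I$, have linearly independent normals and meet in a point $q_I$ lying on no other. Then $$\mathrm{JK}_\xi(F\,dx):=\sum_{I\in\binom{[n]}{r}}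 b_I\,\mathrm{JK}_\xi(f_I),\qquad b_I=\lim_{x\to q_I}F(x)\prod_{i\in I}D_i(x),$$ where $f_I=\prod_{i\in I}\langle\beta_i,x\rangle^{-1}$ and $\mathrm{JK}_\xi(f_I)=|\det(\beta_i)_{i\in I}|^{-1}$ if $\xi\in C_I$ and $0$ otherwise. **Secondary fan.** Heights $h\in\mathbb R^n$ induce a regular subdivision of the labelled configuration $Z_1,\dots,Z_n$, whose cells are the sets $\{i:\varphi(Z_i)=h_i\}$ for linear $\varphi$ with $\varphi(Z_i)\le h_i$ for all $i$. The (relatively open) cones of the secondary fan in $(\ker Z)^*\cong\mathbb R^r$ are the sets of restrictions $hB$ of all heights $h$ inducing a given regular subdivision. A vector is generic if it lies in the interior of a cone of the fan. **Proposition.** The canonical functions $\Omega(\mathcal A)$ and $\Omega(\Delta_J)$ exist and are unique, and a form $\omega$ as above exists. Let $\sigma$ be a cone of the secondary fan and $\xi$ a vector in the interior of $\sigma$. Then, for every $Y\in\mathbb R^{m+1}$ that lies on none of the linear subspaces spanned by $m$ of the columns of $Z$ (in particular, for every such $Y$ in $\mathcal A$), $$\Omega(\mathcal A)(Y)=\mathrm{JK}_\xi\,\omega_{n,1,m}(Y)\qquad\text{and}\qquad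 \Omega(\mathcal A)(Y)=\sum_{I\in\binom{[n]}{r}:\ \sigma\subseteq C_I}\Omega(\Delta_{\bar I})(Y),\qquad \bar I=[n]\setminus I .$$ Moreover, for every height vector $h$ with $hB=\xi$, the simplices $\{\Delta_{\bar I}:\sigma\subseteq C_I\}$ are exactly the maximal cells of the regular subdivision induced by $h$, and they form a triangulation of $\mathcal A$: they are full-dimensional simplices, they cover $\mathcal A$, and any two of them intersect in their common face. -/

import Mathlib

open Filter Topology

noncomputable section

namespace JKPolytope

/-! ### Cones and totally positive matrices -/

/-- The closed positive span `C_I` of the vectors `v i`, `i ∈ I`. -/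
def posCone {ι κ : Type*} (v : ι → κ → ℝ) (I : Finset ι) : Set (κ → ℝ) :=
  {x | ∃ a : ι → ℝ, (∀ i, 0 ≤ a i) ∧ x = ∑ i ∈ I, a i • v i}

/-- All ordered maximal minors are positive. -/
def IsTotallyPositive {k n : ℕ} (Z : Matrix (Fin k) (Fin n) ℝ) : Prop :=
  ∀ s : Fin k ↪o Fin n, 0 < (Z.submatrix id s).det

/-- The cone in `ℝ^{m+1}` over the amplituhedron `𝒜_{n,1,m}(Z) ⊆ Gr(1,m+1) = ℙ^m`: the image under
`Z` of the cone of nonnegative vectors, i.e. of the representatives of the points of the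
nonnegative Grassmannian `Gr_≥(1,n)` (together with `0`). -/
def amplituhedronCone {m n : ℕ} (Z : Matrix (Fin (m + 1)) (Fin n) ℝ) : Set (Fin (m + 1) → ℝ) :=
  {Y | ∃ C : Fin n → ℝ, (∀ i, 0 ≤ C i) ∧ Z.mulVec C = Y}

/-- The cone over the simplex `Δ_J` whose vertices are the columns `Z_j`, `j ∈ J`. -/
def simplexCone {m n : ℕ} (Z : Matrix (Fin (m + 1)) (Fin n) ℝ) (J : Finset (Fin n)) :
    Set (Fin (m + 1) → ℝ) :=
  posCone Z.col J

/-! ### Canonical functions of projective polytopes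

A projective polytope of dimension `d` is represented by the polyhedral cone `C` of dimension
`d + 1` over it, inside `ℝ^N`. The linear span `W` of `C` carries a volume form, the restriction of
an alternating `(d+1)`-form `ν` on `ℝ^N`. A top-degree form on `ℙ(W)` is `f · ι_E ν`, with `E` the
Euler vector field and `f` homogeneous of degree `-(d+1)`. -/

/-- The linear form `l` is nonnegative on `C` and its zero locus is a facet of `C`, namely a proper
face whose linear span has dimension `k`. -/
def IsFacetForm {N : ℕ} (k : ℕ) (C : Set (Fin N → ℝ)) (l : (Fin N → ℝ) →ₗ[ℝ] ℝ) : Prop :=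
  (∀ x ∈ C, 0 ≤ l x) ∧ (∃ x ∈ C, l x ≠ 0) ∧
    Module.finrank ℝ (Submodule.span ℝ {x ∈ C | l x = 0}) = k

/-- `L` contains exactly one defining linear form for every facet of the `(k+1)`-dimensional
cone `C`, and nothing else. -/
def IsFacetSystem {N : ℕ} (k : ℕ) (C : Set (Fin N → ℝ))
    (L : Finset ((Fin N → ℝ) →ₗ[ℝ] ℝ)) : Prop :=
  (∀ l ∈ L, IsFacetForm k C l) ∧
    ∀ l', IsFacetForm k C l' → ∃! l, l ∈ L ∧ {x ∈ C | l x = 0} = {x ∈ C | l' x = 0}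

/-- On the span of the `(d+1)`-dimensional cone `C`, the function `f` is the homogeneous rational
function `p / ∏_{l ∈ L} l` of degree `-(d+1)`, where `L` is a system of facet forms of `C`: so its
only poles are simple poles along the facets. (At the poles the value is set to `0`.) -/
def HasSimpleFacetPoles {N : ℕ} (d : ℕ) (C : Set (Fin N → ℝ))
    (L : Finset ((Fin N → ℝ) →ₗ[ℝ] ℝ)) (p : MvPolynomial (Fin N) ℝ)
    (f : (Fin N → ℝ) → ℝ) : Prop :=
  Module.finrank ℝ (Submodule.span ℝ C) = d + 1 ∧ IsFacetSystem d C L ∧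
    (∃ k, k + (d + 1) = L.card ∧ p.IsHomogeneous k) ∧
    ∀ Y ∈ Submodule.span ℝ C, f Y = MvPolynomial.eval Y p / ∏ l ∈ L, l Y

open Classical in
/-- `f` is the canonical function, with respect to the volume form `ν`, of the `d`-dimensional
projective polytope with cone `C`. The form `f · ι_E ν` has only simple poles, along the facets.
If `d = 0`, it is `1` at the point, represented by `Y ∈ C`. If `d > 0`, its residue along every
facet `{l = 0}` is the canonical form of the facet: choosing `u` with `l u = 1` one has
`ν = dl ∧ ι_u ν`, so that `f · ν = (dl / l) ∧ (l f · ι_u ν)`, and the restriction of `l f` to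
`{l = 0}` has to be the canonical function of the facet with respect to `ι_u ν`. (Facet forms
being nonnegative on `C`, and `ν` only entering through `|ν|`, the signs are those for which the
canonical functions are positive in the interior.) -/
def IsCanonicalFunction {N : ℕ} : (d : ℕ) → (C : Set (Fin N → ℝ)) →
    (ν : (Fin N → ℝ) [⋀^Fin (d + 1)]→ₗ[ℝ] ℝ) → (f : (Fin N → ℝ) → ℝ) → Prop
  | 0, C, ν, f =>
    (∃ L p, HasSimpleFacetPoles 0 C L p f) ∧ ∀ Y ∈ C, Y ≠ 0 → f Y * |ν ![Y]| = 1
  | d + 1, C, ν, f =>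
    ∃ L p, HasSimpleFacetPoles (d + 1) C L p f ∧
      ∀ l ∈ L, ∀ u ∈ Submodule.span ℝ C, l u = 1 →
        ∃ g, IsCanonicalFunction d {x ∈ C | l x = 0} (ν.curryLeft u) g ∧
          ∀ w ∈ Submodule.span ℝ C, l w = 0 → ∏ l' ∈ L.erase l, l' w ≠ 0 →
            g w = MvPolynomial.eval w p / ∏ l' ∈ L.erase l, l' w

/-- The determinant `dY_0 ∧ ⋯ ∧ dY_m` on `ℝ^{m+1}`. -/
def detForm (m : ℕ) : (Fin (m + 1) → ℝ) [⋀^Fin (m + 1)]→ₗ[ℝ] ℝ :=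
  (Pi.basisFun ℝ (Fin (m + 1))).det

open Classical in
/-- The canonical function of the full-dimensional projective polytope in `ℙ^m` with cone `C`, with
respect to the standard form of `Gr(1,m+1)`. -/
def canonicalFunction {m : ℕ} (C : Set (Fin (m + 1) → ℝ)) : (Fin (m + 1) → ℝ) → ℝ :=
  if h : ∃ f, IsCanonicalFunction m C (detForm m) f then h.choose else 0

/-! ### Fiber volume forms -/

/-- The wedge product of alternating forms (sum over shuffles). -/
def wedge {V : Type*} [AddCommGroup V] [Module ℝ V] {p q : ℕ}
    (α : V [⋀^Fin p]→ₗ[ℝ] ℝ) (β : V [⋀^Fin q]→ₗ[ℝ] ℝ) : V [⋀^Fin (p + q)]→ₗ[ℝ] ℝ :=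
  ((LinearMap.mul' ℝ ℝ).compAlternatingMap (α.domCoprod β)).domDomCongr finSumFinEquiv

/-- The standard volume form `⟨C d^N C⟩ = ∑_i ε_{i \bar i} C_i ⋀_{j ≠ i} dC_j` of `Gr(1,N+1)`, at
the point `C`: the contraction of `dC_0 ∧ ⋯ ∧ dC_N` with the Euler vector field. -/
def stdForm {N : ℕ} (C : Fin (N + 1) → ℝ) : (Fin (N + 1) → ℝ) [⋀^Fin N]→ₗ[ℝ] ℝ :=
  (detForm N).curryLeft C

/-- The canonical form of `Gr_+(1,N+1)`: the standard volume form divided by the product of the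
Plücker coordinates. -/
def grassmannForm {N : ℕ} (C : Fin (N + 1) → ℝ) : (Fin (N + 1) → ℝ) [⋀^Fin N]→ₗ[ℝ] ℝ :=
  (∏ i, C i)⁻¹ • stdForm C

/-- `ω` is an `(n-m-1)`-form on `Gr(1,n)`, `n = r + m + 1`, with `Ω(Gr_+(1,n)) = ω ∧ π^* μ` where
`μ` is the standard form of `Gr(1,m+1)` and `π` is induced by `Z`. It is given as a basic covariant
form of degree `-(m+1)` on the open set where `π` is defined and `Ω(Gr_+(1,n))` has no pole. -/
def IsFiberForm {m r : ℕ} (Z : Matrix (Fin (m + 1)) (Fin (r + m + 1)) ℝ)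
    (ω : (Fin (r + m + 1) → ℝ) → (Fin (r + m + 1) → ℝ) [⋀^Fin r]→ₗ[ℝ] ℝ) : Prop :=
  ∀ C : Fin (r + m + 1) → ℝ, (∀ i, C i ≠ 0) → Z.mulVec C ≠ 0 →
    grassmannForm C =
        wedge (ω C) ((stdForm (Z.mulVec C)).compLinearMap (Matrix.mulVecLin Z)) ∧
      (∀ v, (∃ j, v j = C) → ω C v = 0) ∧
      ∀ t : ℝ, t ≠ 0 → ∀ v, ω (t • C) (fun j => t • v j) = (t ^ (m + 1))⁻¹ * ω C v

/-- The columns of `B` form a basis of `ker Z`; the rows `B i` are then the Gale transform `Z_i^⊥`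
of the columns `Z_i` of `Z`. -/
def IsGaleDual {m n r : ℕ} (Z : Matrix (Fin (m + 1)) (Fin n) ℝ)
    (B : Matrix (Fin n) (Fin r) ℝ) : Prop :=
  LinearIndependent ℝ B.col ∧ Submodule.span ℝ (Set.range B.col) = LinearMap.ker Z.mulVecLin

/-- The coefficient of `dx_1 ∧ ⋯ ∧ dx_r` in the pullback of `ω` under the affine parametrization
`x ↦ c + B x`. -/
def pullbackCoeff {n r : ℕ} (ω : (Fin n → ℝ) → (Fin n → ℝ) [⋀^Fin r]→ₗ[ℝ] ℝ)
    (B : Matrix (Fin n) (Fin r) ℝ) (c : Fin n → ℝ) (x : Fin r → ℝ) : ℝ :=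
  ω (c + B.mulVec x) B.col

/-! ### Jeffrey-Kirwan residues -/

open Classical in
/-- The classical Jeffrey-Kirwan residue at `ξ` of `f_I(x) = 1 / ∏_{i ∈ I} ⟨x, β_i⟩`. -/
def jkBasic {n r : ℕ} (β : Fin n → Fin r → ℝ) (ξ : Fin r → ℝ)
    (I : {I : Finset (Fin n) // I.card = r}) : ℝ :=
  if ξ ∈ posCone β I.1 then
    |(Matrix.of fun a => β (I.1.orderEmbOfFin I.2 a)).det|⁻¹
  else 0

/-- The affine linear function `D_i(x) = ⟨β_i, x⟩ + a_i`. -/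
def affForm {n r : ℕ} (β : Fin n → Fin r → ℝ) (a : Fin n → ℝ) (i : Fin n) (x : Fin r → ℝ) : ℝ :=
  β i ⬝ᵥ x + a i

/-- The form `F dx_1 ∧ ⋯ ∧ dx_r`, with simple poles along the generic affine hyperplane arrangement
`{D_i = 0}`, has (extended) Jeffrey-Kirwan residue `v` at `ξ`. Every `r` of the hyperplanes meet in
exactly one point `q_I`, which lies on no other hyperplane; near it the leading term of `F` is
`b_I / ∏_{i ∈ I} D_i(x)` with `b_I = lim_{x → q_I} F(x) ∏_{i ∈ I} D_i(x)`; translated to the origin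
it becomes `b_I f_I`, and the residue is the sum over `I` of `b_I` times the classical
Jeffrey-Kirwan residue of `f_I`. -/
def HasJKResidue {n r : ℕ} (β : Fin n → Fin r → ℝ) (a : Fin n → ℝ) (F : (Fin r → ℝ) → ℝ)
    (ξ : Fin r → ℝ) (v : ℝ) : Prop :=
  ∃ b : {I : Finset (Fin n) // I.card = r} → ℝ,
    (∀ I, ∃! q, (∀ i ∈ I.1, affForm β a i q = 0) ∧ (∀ j ∉ I.1, affForm β a j q ≠ 0) ∧
      LinearIndependent ℝ (fun i : I.1 => β i) ∧
      Tendsto (fun x => F x * ∏ i ∈ I.1, affForm β a i x)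
        (𝓝[{x | ∀ i, affForm β a i x ≠ 0}] q) (𝓝 (b I))) ∧
    v = ∑ I, b I * jkBasic β ξ I

/-! ### Regular subdivisions and the secondary fan -/

/-- The cells of the regular subdivision of the (labelled) columns of `Z` induced by the heights
`h`: sets of labels at which a linear function lying below the heights touches them. -/
def regularCells {m n : ℕ} (Z : Matrix (Fin (m + 1)) (Fin n) ℝ) (h : Fin n → ℝ) :
    Set (Finset (Fin n)) :=
  {J | ∃ φ : Fin (m + 1) → ℝ, (∀ i, φ ⬝ᵥ Z.col i ≤ h i) ∧ ∀ i, i ∈ J ↔ φ ⬝ᵥ Z.col i = h i}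

/-- The secondary fan, in `(ker Z)^* ≅ ℝ^r`, with coordinates given by the basis `B` of `ker Z`. The
heights `h`, as functionals on `ℝ^n`, restrict to `ker Z` as `h B`. A (relatively open) cone of the
fan consists of the restrictions of all heights that induce the same regular subdivision. -/
def secondaryFan {m n r : ℕ} (Z : Matrix (Fin (m + 1)) (Fin n) ℝ) (B : Matrix (Fin n) (Fin r) ℝ) :
    Set (Set (Fin r → ℝ)) :=
  {σ | ∃ h, σ = {ξ | ∃ h', B.vecMul h' = ξ ∧ regularCells Z h' = regularCells Z h}}

/-- `T` is the set of maximal cells of the regular subdivision induced by `h`, and this is a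
triangulation of `𝒜_{n,1,m}`: the cells are simplices with linearly independent vertices, any two
of them intersect in their common face, and they cover. -/
def IsRegularTriangulation {m n : ℕ} (Z : Matrix (Fin (m + 1)) (Fin n) ℝ) (h : Fin n → ℝ)
    (T : Set (Finset (Fin n))) : Prop :=
  T = {J ∈ regularCells Z h | Submodule.span ℝ (Z.col '' J) = ⊤} ∧
    (∀ J ∈ T, LinearIndependent ℝ (fun j : J => Z.col j)) ∧
    (∀ J ∈ T, ∀ J' ∈ T, simplexCone Z J ∩ simplexCone Z J' = simplexCone Z (J ∩ J')) ∧
    ⋃ J ∈ T, simplexCone Z J = amplituhedronCone Z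

end JKPolytope

end

/-! Everything is governed by the lower simplices of a height vector `h` with `hB = ξ`. For a set
`J` of `m + 1` labels, subtract from `h` the linear form that agrees with it on the columns `Z_j`,
`j ∈ J`. Linear heights vanish on `ker Z`, so `ξ` becomes the combination of the rows `β_i`, `i ∉
J`, whose coefficients are the remaining gaps. These rows are a basis of `ℝ^r`; hence `ξ` lies in
the cone of the complement of `J` exactly when no gap is negative, that is, when `J` is a lower
simplex (`IsGaleDual.vecMul_mem_posCone_iff`). If `ξ` is interior to a cone of the secondary fan,
small changes of one height leave the subdivision alone, so no further label touches a lower simplex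
(`isSimplicialHeight_of_mem_interior`). The lower simplices are then the maximal cells, and linear
programming shows that they triangulate the polytope.

On a fiber, `ω` is `κ / ∏ D_i`, where `κ` compares the volume form with the columns of `B` inserted
to the pullback of `det` along `Z`. At the vertex `q_I` the vector `C` is supported on the
complement `J` of `I`, and its entries there are the coordinates of `Y` in the basis `Z_j`. Thus
`b_I = κ / ∏ coord`. Complementary minors satisfy `|κ| |det Z_J| = |det B_I|`, and `κ > 0` by the
choice of orientation, so `b_I / |det B_I|` is the canonical function of `Δ_J`. The residue is
therefore the sum of these functions over the lower simplices (`hasJKResidue_fiberForm`).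

It remains to see that this sum is `Ω(𝒜)`. Over the common denominator of all hyperplanes spanned by
`m` columns, the simplices containing a given wall `F` have the same residue along it up to sign.
The signs add up to `1` if `F` is a facet and to `0` otherwise (`sum_sign_wall`), so the walls that
are not facets divide the numerator, and the quotient has the residues required of a canonical
function (`exists_numerator`). Uniqueness is an induction on the dimension: the numerator has
smaller degree than there are facets, and two candidates agree on every facet
(`IsCanonicalFunction.eq_smul`). Total positivity enters through general position and through the
existence of one facet, spanned by the first `m` columns. -/

noncomputable section

namespace JKPolytope

/-! ### Uniqueness of canonical functions -/

/-- The polynomial `t ↦ p (Y + t v)`. -/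
def linePolynomial {N : ℕ} (p : MvPolynomial (Fin N) ℝ) (Y v : Fin N → ℝ) : Polynomial ℝ :=
  MvPolynomial.aeval (fun i => Polynomial.C (v i) * Polynomial.X + Polynomial.C (Y i)) p

lemma eval_linePolynomial {N : ℕ} (p : MvPolynomial (Fin N) ℝ) (Y v : Fin N → ℝ) (t : ℝ) :
    (linePolynomial p Y v).eval t = MvPolynomial.eval (Y + t • v) p := by
  rw [linePolynomial, ← Polynomial.coe_evalRingHom, MvPolynomial.map_aeval]
  rw [← MvPolynomial.eval₂_id]
  change MvPolynomial.eval₂ _ _ _ = MvPolynomial.eval₂ _ _ _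
  congr 1
  · ext x; simp
  · funext i; simp; ring

lemma natDegree_linePolynomial_le {N k : ℕ} {p : MvPolynomial (Fin N) ℝ} (hp : p.IsHomogeneous k)
    (Y v : Fin N → ℝ) : (linePolynomial p Y v).natDegree ≤ k := by
  simpa [linePolynomial] using MvPolynomial.aeval_natDegree_le (n := 1) p hp.totalDegree_le _
    fun i => Polynomial.natDegree_linear_le (a := v i) (b := Y i)

/-- A polynomial of degree less than the number of hyperplanes on which it vanishes is zero. -/
lemma eval_eq_zero_of_hyperplanes {N k : ℕ} {p : MvPolynomial (Fin N) ℝ} (hp : p.IsHomogeneous k)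
    (W : Submodule ℝ (Fin N → ℝ)) (L : Finset ((Fin N → ℝ) →ₗ[ℝ] ℝ)) (hk : k < L.card)
    {Y : Fin N → ℝ} (hY : Y ∈ W)
    (hL : ∀ l ∈ L, ∃ x ∈ W, l x ≠ 0)
    (hLL : ∀ l ∈ L, ∀ l' ∈ L, l ≠ l' → ∃ x ∈ W, l Y * l' x ≠ l' Y * l x)
    (h : ∀ l ∈ L, ∀ w ∈ W, l w = 0 → (∀ l' ∈ L, l' ≠ l → l' w ≠ 0) → MvPolynomial.eval w p = 0) :
    MvPolynomial.eval Y p = 0 := by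
  classical
  -- A generic direction: the line through `Y` along `v` crosses every hyperplane, and crosses
  -- different ones at different parameters `-(l Y / l v)`. The restriction of `p` to the line then
  -- has `L.card` roots but degree at most `k`.
  obtain ⟨v, hvW, hv⟩ := Module.Dual.exists_forall_mem_ne_zero_of_forall_exists W
    (fun q : L ⊕ {q : L × L // q.1 ≠ q.2} => Sum.elim (fun l : L => (l : Module.Dual ℝ (Fin N → ℝ)))
      (fun q : {q : L × L // q.1 ≠ q.2} => (q.1.1.1 Y) • (q.1.2.1 : Module.Dual ℝ (Fin N → ℝ)) -
        (q.1.2.1 Y) • (q.1.1.1 : Module.Dual ℝ (Fin N → ℝ))) q) (by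
      rintro (l | ⟨⟨l, l'⟩, hne⟩)
      · exact hL l l.2
      · obtain ⟨x, hx, hx'⟩ := hLL l l.2 l' l'.2 (fun e => hne (Subtype.ext e))
        exact ⟨x, hx, by simpa [sub_eq_zero] using hx'⟩)
  have hv1 : ∀ l ∈ L, l v ≠ 0 := fun l hl => hv (Sum.inl ⟨l, hl⟩)
  have hv2 : ∀ l ∈ L, ∀ l' ∈ L, l ≠ l' → l Y * l' v ≠ l' Y * l v := fun l hl l' hl' hne => by
    have := hv (Sum.inr ⟨(⟨l, hl⟩, ⟨l', hl'⟩), fun e => hne (congrArg Subtype.val e)⟩)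
    simpa [sub_eq_zero] using this
  have hq : linePolynomial p Y v = 0 := by
    refine Polynomial.eq_zero_of_natDegree_lt_card_of_eval_eq_zero _
      (f := fun l : L => -(l.1 Y / l.1 v)) ?_ ?_ ?_
    · intro l l' hll
      by_contra hne
      refine hv2 l l.2 l' l'.2 (fun e => hne (Subtype.ext e)) ?_
      have h1 := hv1 l l.2
      have h2 := hv1 l' l'.2
      have : l.1 Y / l.1 v = l'.1 Y / l'.1 v := by simpa using hll
      field_simp at this
      linarith
    · intro l
      rw [eval_linePolynomial]
      have h1 := hv1 l l.2
      refine h l l.2 _ (W.add_mem hY (W.smul_mem _ hvW)) ?_ ?_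
      · simp; field_simp; ring
      · intro l' hl' hne e
        refine hv2 l l.2 l' hl' (Ne.symm hne) ?_
        simp at e
        field_simp at e
        linarith
    · rw [Fintype.card_coe]
      exact (natDegree_linePolynomial_le hp Y v).trans_lt hk
  have := eval_linePolynomial p Y v 0
  rw [hq] at this
  simpa using this.symm

/-- A dimension count: `l` is not zero on `C`, so its kernel cuts the span down to dimension at most
`k`, which the facet already attains. -/
lemma IsFacetForm.span_eq {N k : ℕ} {C : Set (Fin N → ℝ)} {l : (Fin N → ℝ) →ₗ[ℝ] ℝ}
    (hC : Module.finrank ℝ (Submodule.span ℝ C) = k + 1) (hl : IsFacetForm k C l) :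
    Submodule.span ℝ {x ∈ C | l x = 0} = Submodule.span ℝ C ⊓ LinearMap.ker l := by
  refine Submodule.eq_of_le_of_finrank_le ?_ ?_
  · rw [Submodule.span_le]
    rintro x ⟨hx, hx0⟩
    exact ⟨Submodule.subset_span hx, hx0⟩
  · rw [hl.2.2]
    have hlt : Submodule.span ℝ C ⊓ LinearMap.ker l < Submodule.span ℝ C := by
      refine lt_of_le_of_ne inf_le_left fun e => ?_
      obtain ⟨x, hx, hx0⟩ := hl.2.1
      exact hx0 ((inf_eq_left.mp e) (Submodule.subset_span hx))
    have := Submodule.finrank_lt_finrank_of_lt hlt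
    omega

lemma IsFacetForm.exists_eq_one {N k : ℕ} {C : Set (Fin N → ℝ)} {l : (Fin N → ℝ) →ₗ[ℝ] ℝ}
    (hl : IsFacetForm k C l) : ∃ u ∈ Submodule.span ℝ C, l u = 1 := by
  obtain ⟨x, hx, hx0⟩ := hl.2.1
  exact ⟨(l x)⁻¹ • x, Submodule.smul_mem _ _ (Submodule.subset_span hx), by simp [hx0]⟩

/-- Two facet forms with the same facet are proportional on the span of the cone. -/
lemma IsFacetForm.exists_proportional {N k : ℕ} {C : Set (Fin N → ℝ)}
    {l l' : (Fin N → ℝ) →ₗ[ℝ] ℝ} (hC : Module.finrank ℝ (Submodule.span ℝ C) = k + 1)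
    (hl : IsFacetForm k C l) (hl' : IsFacetForm k C l')
    (h : {x ∈ C | l x = 0} = {x ∈ C | l' x = 0}) :
    ∃ c : ℝ, 0 < c ∧ ∀ x ∈ Submodule.span ℝ C, l' x = c * l x := by
  have e : Submodule.span ℝ C ⊓ LinearMap.ker l = Submodule.span ℝ C ⊓ LinearMap.ker l' := by
    rw [← hl.span_eq hC, ← hl'.span_eq hC, h]
  obtain ⟨x, hx, hx0⟩ := hl.2.1
  have hx0' : l' x ≠ 0 := fun e0 => by
    have : x ∈ {x ∈ C | l x = 0} := h ▸ (⟨hx, e0⟩ : x ∈ {x ∈ C | l' x = 0})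
    exact hx0 this.2
  have h1 : 0 < l x := lt_of_le_of_ne (hl.1 x hx) (Ne.symm hx0)
  have h2 : 0 < l' x := lt_of_le_of_ne (hl'.1 x hx) (Ne.symm hx0')
  refine ⟨l' x / l x, div_pos h2 h1, fun y hy => ?_⟩
  have : y - (l y / l x) • x ∈ Submodule.span ℝ C ⊓ LinearMap.ker l :=
    ⟨Submodule.sub_mem _ hy (Submodule.smul_mem _ _ (Submodule.subset_span hx)), by simp [hx0]⟩
  rw [e] at this
  have := this.2
  simp [sub_eq_zero] at this
  rw [this]; ring

/-- Division by zero gives zero, so canonical functions are comparable even at their poles. -/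
lemma HasSimpleFacetPoles.eq_zero {N d : ℕ} {C : Set (Fin N → ℝ)}
    {L : Finset ((Fin N → ℝ) →ₗ[ℝ] ℝ)} {p : MvPolynomial (Fin N) ℝ} {f : (Fin N → ℝ) → ℝ}
    (h : HasSimpleFacetPoles d C L p f) {Y : Fin N → ℝ} (hY : Y ∈ Submodule.span ℝ C)
    {l : (Fin N → ℝ) →ₗ[ℝ] ℝ} (hl : l ∈ L) (h0 : l Y = 0) : f Y = 0 := by
  rw [h.2.2.2 Y hY, Finset.prod_eq_zero hl h0, div_zero]

lemma eval_smul_of_isHomogeneous {N k : ℕ} {p : MvPolynomial (Fin N) ℝ} (hp : p.IsHomogeneous k)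
    (t : ℝ) (Y : Fin N → ℝ) : MvPolynomial.eval (t • Y) p = t ^ k * MvPolynomial.eval Y p := by
  rw [MvPolynomial.eval_eq, MvPolynomial.eval_eq, Finset.mul_sum]
  refine Finset.sum_congr rfl fun d hd => ?_
  have hk := hp.degree_eq_sum_deg_support hd
  simp only [Pi.smul_apply, smul_eq_mul, mul_pow, Finset.prod_mul_distrib]
  rw [Finset.prod_pow_eq_pow_sum, ← hk]
  ring

/-- Uniqueness, with a factor `c` on the volume form so that the induction closes: two facet systems
may use different positive multiples of a form `l`, and then the vectors `u` with `l u = 1`, and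
with them the volume forms `ι_u ν` on the facet, differ by a factor. By induction the numerators
agree on every facet up to the expected constant, and their degree is too small for a nonzero
difference. -/
theorem IsCanonicalFunction.eq_smul {N : ℕ} : ∀ (d : ℕ) (C : Set (Fin N → ℝ))
    (ν : (Fin N → ℝ) [⋀^Fin (d + 1)]→ₗ[ℝ] ℝ) (c : ℝ), c ≠ 0 → ∀ f f' : (Fin N → ℝ) → ℝ,
    IsCanonicalFunction d C ν f → IsCanonicalFunction d C (c • ν) f' →
    ∀ Y ∈ Submodule.span ℝ C, f Y = |c| * f' Y
  | 0, C, ν, c, hc, f, f', h, h', Y, hY => by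
    obtain ⟨⟨L, p, hp⟩, hf⟩ := h
    obtain ⟨⟨L', p', hp'⟩, hf'⟩ := h'
    obtain ⟨l, hl⟩ : L.Nonempty := by
      obtain ⟨k, hk, -⟩ := hp.2.2.1
      exact Finset.card_pos.mp (by omega)
    obtain ⟨l', hl', -⟩ := (hp'.2.1.2 l (hp.2.1.1 l hl)).exists
    obtain ⟨x, hx, hlx⟩ := (hp.2.1.1 l hl).2.1
    have hx0 : x ≠ 0 := fun e => hlx (by simp [e])
    have hxs := Submodule.subset_span (R := ℝ) hx
    obtain ⟨t, rfl⟩ : ∃ t : ℝ, t • x = Y := by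
      have := finrank_eq_one_iff_of_nonzero' (K := ℝ) (⟨x, hxs⟩ : Submodule.span ℝ C)
        (by simpa using hx0)
      obtain ⟨t, ht⟩ := this.mp hp.1 ⟨Y, hY⟩
      exact ⟨t, congrArg Subtype.val ht⟩
    -- The cone spans a line, on which the function is homogeneous of degree `-1`; its value at the
    -- single point `x` determines it.
    have key : ∀ {L : Finset ((Fin N → ℝ) →ₗ[ℝ] ℝ)} {p f}, HasSimpleFacetPoles 0 C L p f →
        t ≠ 0 → f (t • x) = t⁻¹ * f x := by
      intro L p f h ht
      obtain ⟨k, hk, hpk⟩ := h.2.2.1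
      rw [h.2.2.2 _ hY, h.2.2.2 _ hxs, eval_smul_of_isHomogeneous hpk]
      simp only [map_smul, smul_eq_mul, Finset.prod_mul_distrib, Finset.prod_const, ← hk, zero_add]
      field_simp
      ring
    by_cases ht : t = 0
    · rw [hp.eq_zero hY hl (by simp [ht]), hp'.eq_zero hY hl' (by simp [ht]), mul_zero]
    · rw [key hp ht, key hp' ht]
      have h1 := hf x hx hx0
      have h2 := hf' x hx hx0
      rw [AlternatingMap.smul_apply, smul_eq_mul, abs_mul] at h2
      have h3 : |ν ![x]| ≠ 0 := fun e => by simp [e] at h1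
      have : f x = |c| * f' x := by
        apply mul_right_cancel₀ h3
        rw [h1, ← h2]; ring
      rw [this]; ring
  | d + 1, C, ν, c, hc, f, f', h, h', Y, hY => by
    classical
    obtain ⟨L, p, hp, hres⟩ := h
    obtain ⟨L', p', hp', hres'⟩ := h'
    obtain ⟨k, hk, hpk⟩ := hp.2.2.1
    obtain ⟨k', hk', hpk'⟩ := hp'.2.2.1
    -- `τ` matches the forms of the two systems that cut out the same facet; `s` below records the
    -- positive factors between them on the span of `C`.
    choose! τ hτ hτ' using fun l hl => hp'.2.1.2 l (hp.2.1.1 l hl)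
    have hface : ∀ l ∈ L, {x ∈ C | l x = 0} = {x ∈ C | τ l x = 0} := fun l hl => (hτ l hl).2.symm
    have hτinj : Set.InjOn τ L := by
      intro l hl l' hl' e
      obtain ⟨q, -, hq⟩ := hp.2.1.2 l (hp.2.1.1 l hl)
      have h1 := hq l ⟨hl, rfl⟩
      have h2 := hq l' ⟨hl', by rw [hface l' hl', ← e, ← hface l hl]⟩
      rw [h1, h2]
    have hτim : L.image τ = L' := by
      ext l'
      simp only [Finset.mem_image]
      constructor
      · rintro ⟨l, hl, rfl⟩; exact (hτ l hl).1
      · intro hl'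
        obtain ⟨l, ⟨hl, e⟩, -⟩ := hp.2.1.2 l' (hp'.2.1.1 l' hl')
        exact ⟨l, hl, (hτ' l hl l' ⟨hl', e.symm⟩).symm⟩
    have hcard : L'.card = L.card := by rw [← hτim, Finset.card_image_of_injOn hτinj]
    choose! s hs0 hs using fun l hl => (hp.2.1.1 l hl).exists_proportional hp.1
      (hp'.2.1.1 _ (hτ l hl).1) (hface l hl)
    have hprod : ∀ y ∈ Submodule.span ℝ C, ∏ l ∈ L', l y = (∏ l ∈ L, s l) * ∏ l ∈ L, l y := by
      intro y hy
      rw [← hτim, Finset.prod_image hτinj, ← Finset.prod_mul_distrib]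
      exact Finset.prod_congr rfl fun l hl => hs l hl y hy
    have hprod' : ∀ y ∈ Submodule.span ℝ C, ∀ l ∈ L, ∏ l' ∈ L'.erase (τ l), l' y =
        (∏ l' ∈ L.erase l, s l') * ∏ l' ∈ L.erase l, l' y := by
      intro y hy l hl
      have : L'.erase (τ l) = (L.erase l).image τ := by
        ext q
        simp only [← hτim, Finset.mem_erase, Finset.mem_image]
        constructor
        · rintro ⟨h1, q, hq, rfl⟩
          exact ⟨q, ⟨fun e => h1 (e ▸ rfl), hq⟩, rfl⟩
        · rintro ⟨q, ⟨h1, hq⟩, rfl⟩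
          exact ⟨fun e => h1 (hτinj hq hl e), q, hq, rfl⟩
      rw [this, Finset.prod_image (hτinj.mono (Finset.erase_subset _ _)),
        ← Finset.prod_mul_distrib]
      exact Finset.prod_congr rfl fun l' hl' => hs l' (Finset.mem_of_mem_erase hl') y hy
    have hSpos : 0 < ∏ l ∈ L, s l := Finset.prod_pos hs0
    -- For `τ l` the vector normalised to value `1` is `u / s l`, so the facet volume forms differ
    -- by `c / s l`. This factor `s l` is the one missing from the product over `L.erase l`.
    have hface_eval : ∀ l ∈ L, ∀ w ∈ Submodule.span ℝ C, l w = 0 →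
        (∀ l' ∈ L, l' ≠ l → l' w ≠ 0) →
        (∏ l ∈ L, s l) * MvPolynomial.eval w p = |c| * MvPolynomial.eval w p' := by
      intro l hl w hw hlw hne
      obtain ⟨u, hu, hlu⟩ := (hp.2.1.1 l hl).exists_eq_one
      have hsl := hs0 l hl
      have hL0 : ∏ l' ∈ L.erase l, l' w ≠ 0 := Finset.prod_ne_zero_iff.mpr fun l' hl' =>
        hne l' (Finset.mem_of_mem_erase hl') (Finset.ne_of_mem_erase hl')
      have hS0 : ∏ l' ∈ L.erase l, s l' ≠ 0 := Finset.prod_ne_zero_iff.mpr fun l' hl' =>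
        (hs0 l' (Finset.mem_of_mem_erase hl')).ne'
      obtain ⟨g, hg, hgw⟩ := hres l hl u hu hlu
      obtain ⟨g', hg', hgw'⟩ := hres' (τ l) (hτ l hl).1 ((s l)⁻¹ • u) (Submodule.smul_mem _ _ hu)
        (by rw [hs l hl _ (Submodule.smul_mem _ _ hu)]; simp [hlu, hsl.ne'])
      rw [← hface l hl, map_smul, AlternatingMap.curryLeft_smul, LinearMap.smul_apply,
        smul_smul] at hg'
      have hwf : w ∈ Submodule.span ℝ {x ∈ C | l x = 0} := by
        rw [(hp.2.1.1 l hl).span_eq hp.1]; exact ⟨hw, hlw⟩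
      have e := IsCanonicalFunction.eq_smul d _ _ _ (mul_ne_zero (inv_ne_zero hsl.ne') hc) g g' hg
        hg' w hwf
      rw [hgw w hw hlw hL0, hgw' w hw (by rw [hs l hl w hw, hlw, mul_zero])
        (by rw [hprod' w hw l hl]; exact mul_ne_zero hS0 hL0), hprod' w hw l hl, abs_mul, abs_inv,
        abs_of_pos hsl] at e
      rw [← Finset.mul_prod_erase L s hl]
      field_simp at e
      linarith
    by_cases hY0 : ∃ l ∈ L, l Y = 0
    · obtain ⟨l, hl, h0⟩ := hY0
      rw [hp.eq_zero hY hl h0, hp'.eq_zero hY (hτ l hl).1 (by rw [hs l hl Y hY, h0, mul_zero]),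
        mul_zero]
    push Not at hY0
    have hkk : k' = k := by omega
    subst hkk
    -- Both numerators have degree `k` with `k + (d + 2) = L.card`, hence fewer degrees than
    -- hyperplanes.
    have hzero : MvPolynomial.eval Y
        (MvPolynomial.C (∏ l ∈ L, s l) * p - MvPolynomial.C |c| * p') = 0 := by
      refine eval_eq_zero_of_hyperplanes ((hpk.C_mul _).sub (hpk'.C_mul _)) (Submodule.span ℝ C) L
        (by omega) hY ?_ ?_ ?_
      · intro l hl
        obtain ⟨x, hx, h0⟩ := (hp.2.1.1 l hl).2.1
        exact ⟨x, Submodule.subset_span hx, h0⟩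
      -- If `l` and `l'` were proportional on the span, with nonzero values at `Y`, they would cut
      -- out the same facet; a facet system has only one form for it.
      · intro l hl l' hl' hne
        by_contra! hcon
        refine hne ?_
        obtain ⟨q, -, hq⟩ := hp.2.1.2 l (hp.2.1.1 l hl)
        rw [hq l ⟨hl, rfl⟩, hq l' ⟨hl', ?_⟩]
        ext x
        simp only [Set.mem_ofPred_eq, and_congr_right_iff]
        intro hx
        have := hcon x (Submodule.subset_span hx)
        constructor
        · intro h0
          simpa [h0, hY0 l' hl'] using this
        · intro h0
          simpa [h0, hY0 l hl] using this
      · intro l hl w hw hlw hne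
        simp [hface_eval l hl w hw hlw hne]
    have hLY : ∏ l ∈ L, l Y ≠ 0 := Finset.prod_ne_zero_iff.mpr hY0
    rw [hp.2.2.2 Y hY, hp'.2.2.2 Y hY, hprod Y hY]
    simp [sub_eq_zero] at hzero
    field_simp
    linarith

theorem IsCanonicalFunction.eqOn {N d : ℕ} {C : Set (Fin N → ℝ)}
    {ν : (Fin N → ℝ) [⋀^Fin (d + 1)]→ₗ[ℝ] ℝ} {f f' : (Fin N → ℝ) → ℝ}
    (h : IsCanonicalFunction d C ν f) (h' : IsCanonicalFunction d C ν f') :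
    Set.EqOn f f' (Submodule.span ℝ C) := fun Y hY => by
  simpa using IsCanonicalFunction.eq_smul d C ν 1 one_ne_zero f f' h (by simpa using h') Y hY

/-! ### Simplicial cones -/

lemma mem_posCone_of_mem {ι κ : Type*} (v : ι → κ → ℝ) {I : Finset ι} {i : ι} (hi : i ∈ I) :
    v i ∈ posCone v I := by
  classical
  refine ⟨fun j => if j = i then 1 else 0, fun j => by dsimp only; split_ifs <;> norm_num, ?_⟩
  simp [Finset.sum_ite_eq', hi]

lemma span_posCone {ι κ : Type*} (v : ι → κ → ℝ) (I : Finset ι) :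
    Submodule.span ℝ (posCone v I) = Submodule.span ℝ (v '' I) := by
  apply le_antisymm
  · rw [Submodule.span_le]
    rintro x ⟨a, -, rfl⟩
    exact Submodule.sum_mem _ fun i hi =>
      Submodule.smul_mem _ _ (Submodule.subset_span ⟨i, hi, rfl⟩)
  · apply Submodule.span_mono
    rintro _ ⟨i, hi, rfl⟩
    exact mem_posCone_of_mem v hi

lemma posCone_mono {ι κ : Type*} (v : ι → κ → ℝ) {I J : Finset ι} (h : I ⊆ J) :
    posCone v I ⊆ posCone v J := by
  classical
  rintro x ⟨a, ha, rfl⟩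
  refine ⟨fun i => if i ∈ I then a i else 0, fun i => by dsimp only; split_ifs <;> simp [ha], ?_⟩
  simp only [ite_smul, zero_smul, Finset.sum_ite_mem, Finset.inter_eq_right.mpr h]

lemma posCone_comp {ι ι' κ : Type*} (v : ι → κ → ℝ) (e : ι' ↪ ι) (I : Finset ι') :
    posCone (v ∘ e) I = posCone v (I.map e) := by
  ext x
  constructor
  · rintro ⟨a, ha, rfl⟩
    refine ⟨Function.extend e a 0, fun i => ?_, ?_⟩
    · by_cases h : ∃ j, e j = i
      · obtain ⟨j, rfl⟩ := h
        rw [e.injective.extend_apply]; exact ha j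
      · rw [Function.extend_apply' _ _ _ h]; simp
    · simp [Finset.sum_map, e.injective.extend_apply]
  · rintro ⟨a, ha, rfl⟩
    exact ⟨a ∘ e, fun i => ha _, by simp [Finset.sum_map]⟩

/-- The face of a finitely generated cone cut out by a linear form is generated by the generators
on which the form vanishes. -/
lemma posCone_face {ι κ : Type*} (v : ι → κ → ℝ) (I : Finset ι) (l : (κ → ℝ) →ₗ[ℝ] ℝ)
    (hl : ∀ i ∈ I, 0 ≤ l (v i)) [DecidablePred fun i => l (v i) = 0] :
    {x ∈ posCone v I | l x = 0} = posCone v (I.filter fun i => l (v i) = 0) := by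
  classical
  ext x
  constructor
  · rintro ⟨⟨a, ha, rfl⟩, h0⟩
    refine ⟨a, ha, ?_⟩
    rw [Finset.sum_filter]
    refine Finset.sum_congr rfl fun i hi => ?_
    simp only [map_sum, map_smul, smul_eq_mul] at h0
    rw [Finset.sum_eq_zero_iff_of_nonneg fun i hi => mul_nonneg (ha i) (hl i hi)] at h0
    split_ifs with h
    · rfl
    · rcases mul_eq_zero.mp (h0 i hi) with h' | h'
      · simp [h']
      · exact absurd h' h
  · intro hx
    refine ⟨posCone_mono v (Finset.filter_subset _ _) hx, ?_⟩
    obtain ⟨a, ha, rfl⟩ := hx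
    simp only [map_sum, map_smul, smul_eq_mul]
    exact Finset.sum_eq_zero fun i hi => by rw [(Finset.mem_filter.mp hi).2, mul_zero]

lemma nonneg_of_mem_posCone {ι κ : Type*} {v : ι → κ → ℝ} {I : Finset ι}
    {l : (κ → ℝ) →ₗ[ℝ] ℝ} (hl : ∀ i ∈ I, 0 ≤ l (v i)) {x : κ → ℝ} (hx : x ∈ posCone v I) :
    0 ≤ l x := by
  obtain ⟨a, ha, rfl⟩ := hx
  simp only [map_sum, map_smul, smul_eq_mul]
  exact Finset.sum_nonneg fun i hi => mul_nonneg (ha i) (hl i hi)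

lemma finrank_span_image {ι V : Type*} [AddCommGroup V] [Module ℝ V] {v : ι → V} {I : Finset ι}
    (h : LinearIndepOn ℝ v (I : Set ι)) :
    Module.finrank ℝ (Submodule.span ℝ (v '' I)) = I.card := by
  rw [Set.image_eq_range]
  have := finrank_span_eq_card h
  simpa using this

section dual

variable {ι V : Type*} [DecidableEq ι] [AddCommGroup V] [Module ℝ V]
  {v : ι → V} {c : ι → V →ₗ[ℝ] ℝ}

lemma linearIndependent_of_dual [Fintype ι] (hc : ∀ i j, c i (v j) = if i = j then 1 else 0) :
    LinearIndependent ℝ v := by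
  rw [Fintype.linearIndependent_iff]
  intro g hg i
  simpa [hc] using congrArg (c i) hg

lemma injective_of_dual (hc : ∀ i j, c i (v j) = if i = j then 1 else 0) :
    Function.Injective c := by
  intro i j h
  by_contra hne
  have := hc i j
  rw [h, hc j j] at this
  simp [hne] at this

lemma eq_sum_of_dual [Fintype ι] (hc : ∀ i j, c i (v j) = if i = j then 1 else 0) {x : V}
    (hx : x ∈ Submodule.span ℝ (Set.range v)) : x = ∑ i, c i x • v i := by
  obtain ⟨a, rfl⟩ := (Submodule.mem_span_range_iff_exists_fun ℝ).mp hx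
  simp [hc]

end dual

lemma erase_univ_eq_map_succAbove {n : ℕ} (j : Fin (n + 1)) :
    Finset.univ.erase j = Finset.univ.map (Fin.succAboveEmb j) := by
  ext i
  simp [Fin.exists_succAbove_eq_iff]

/-- Moving the `j`-th vector to the front is a cyclic permutation, which affects only the sign. -/
lemma apply_cons_succAbove {V : Type*} [AddCommGroup V] [Module ℝ V] {d : ℕ}
    (ν : V [⋀^Fin (d + 1)]→ₗ[ℝ] ℝ) (v : Fin (d + 1) → V) (j : Fin (d + 1)) :
    |ν (Matrix.vecCons (v j) (v ∘ j.succAbove))| = |ν v| := by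
  have : (Matrix.vecCons (v j) (v ∘ j.succAbove) : Fin (d + 1) → V) = v ∘ j.cycleRange.symm := by
    funext i
    refine Fin.cases ?_ (fun i => ?_) i
    · simp
    · simp
  rw [this, AlternatingMap.map_perm]
  rcases Int.units_eq_one_or (Equiv.Perm.sign (j.cycleRange.symm)) with h | h <;> simp [h]

/-- The linear form `u ↦ ν (u, w_1, …, w_d)`. -/
def consForm {V : Type*} [AddCommGroup V] [Module ℝ V] {d : ℕ}
    (ν : V [⋀^Fin (d + 1)]→ₗ[ℝ] ℝ) (w : Fin d → V) : V →ₗ[ℝ] ℝ where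
  toFun u := ν.curryLeft u w
  map_add' u u' := by rw [map_add]; rfl
  map_smul' t u := by rw [map_smul]; rfl

lemma consForm_apply {V : Type*} [AddCommGroup V] [Module ℝ V] {d : ℕ}
    (ν : V [⋀^Fin (d + 1)]→ₗ[ℝ] ℝ) (w : Fin d → V) (u : V) :
    consForm ν w u = ν.curryLeft u w := rfl

/-- Expand `u` in the basis `v`: every term except the `j`-th repeats an argument of `ν`. With `c j
u = 1` this says that passing to a facet of a simplex by `ι_u ν` preserves the volume of the
generators. -/
lemma curryLeft_succAbove_of_dual {V : Type*} [AddCommGroup V] [Module ℝ V] {d : ℕ}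
    (ν : V [⋀^Fin (d + 1)]→ₗ[ℝ] ℝ) {v : Fin (d + 1) → V} {c : Fin (d + 1) → V →ₗ[ℝ] ℝ}
    (hc : ∀ i j, c i (v j) = if i = j then 1 else 0) {u : V}
    (hu : u ∈ Submodule.span ℝ (Set.range v)) (j : Fin (d + 1)) :
    |ν.curryLeft u (v ∘ j.succAbove)| = |c j u| * |ν v| := by
  rw [← consForm_apply]
  conv_lhs => rw [eq_sum_of_dual hc hu]
  rw [map_sum, Finset.sum_eq_single j]
  · rw [map_smul, consForm_apply, AlternatingMap.curryLeft_apply_apply, smul_eq_mul,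
      abs_mul, apply_cons_succAbove]
  · intro i _ hi
    obtain ⟨k, rfl⟩ := Fin.exists_succAbove_eq hi
    rw [map_smul, consForm_apply, AlternatingMap.curryLeft_apply_apply,
      ν.map_eq_zero_of_eq (i := 0) (j := k.succ) _ (by simp) (Fin.succ_ne_zero k).symm, smul_zero]
  · simp

lemma span_posCone_univ {ι κ : Type*} [Fintype ι] (v : ι → κ → ℝ) :
    Submodule.span ℝ (posCone v Finset.univ) = Submodule.span ℝ (Set.range v) := by
  rw [span_posCone]; simp

-- A face of a simplicial cone spans a space of dimension equal to the number of generators in it,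
-- so a facet omits exactly one generator and is cut out by the dual coordinate. There are `d + 1`
-- facets, which forces a numerator of degree `0`.
open Classical in
lemma hasSimpleFacetPoles_simplex {N d : ℕ} {v : Fin (d + 1) → Fin N → ℝ}
    {c : Fin (d + 1) → (Fin N → ℝ) →ₗ[ℝ] ℝ} (hc : ∀ i j, c i (v j) = if i = j then 1 else 0)
    (V : ℝ) {f : (Fin N → ℝ) → ℝ}
    (hf : ∀ Y ∈ Submodule.span ℝ (posCone v Finset.univ), f Y = (V * ∏ i, c i Y)⁻¹) :
    HasSimpleFacetPoles d (posCone v Finset.univ) (Finset.univ.image c) (MvPolynomial.C V⁻¹) f := by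
  have hv := linearIndependent_of_dual hc
  have hcinj := injective_of_dual hc
  have hrank : ∀ I : Finset (Fin (d + 1)),
      Module.finrank ℝ (Submodule.span ℝ (posCone v I)) = I.card := fun I => by
    rw [span_posCone, finrank_span_image (hv.linearIndepOn _)]
  have hpos : ∀ i j, 0 ≤ c i (v j) := fun i j => by rw [hc]; split_ifs <;> norm_num
  have hface : ∀ j, {x ∈ posCone v Finset.univ | c j x = 0} =
      posCone v (Finset.univ.erase j) := fun j => by
    rw [posCone_face v _ _ fun i _ => hpos j i]
    congr 1; ext i; simp [hc, eq_comm]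
  have hinj : ∀ i j, posCone v (Finset.univ.erase i) = posCone v (Finset.univ.erase j) → i = j := by
    intro i j h
    by_contra hne
    have h1 : v j ∈ posCone v (Finset.univ.erase i) :=
      mem_posCone_of_mem v (by simp [Ne.symm hne])
    rw [h, ← hface] at h1
    simpa [hc] using h1.2
  refine ⟨by rw [hrank]; simp, ⟨?_, ?_⟩, ⟨0, by simp [Finset.card_image_of_injective _ hcinj], MvPolynomial.isHomogeneous_C _ _⟩, ?_⟩
  · intro l hl
    simp only [Finset.mem_image, Finset.mem_univ, true_and] at hl
    obtain ⟨j, rfl⟩ := hl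
    refine ⟨fun x hx => nonneg_of_mem_posCone (fun i _ => hpos j i) hx,
      ⟨v j, mem_posCone_of_mem v (Finset.mem_univ _), by simp [hc]⟩, ?_⟩
    rw [hface, hrank]; simp
  · intro l hl
    have h1 : ∀ i ∈ Finset.univ, 0 ≤ l (v i) := fun i hi => hl.1 _ (mem_posCone_of_mem v hi)
    have h2 := hl.2.2
    rw [posCone_face v _ _ h1, hrank] at h2
    have h3 : (Finset.univ.filter fun i => l (v i) = 0)ᶜ.card = 1 := by
      rw [Finset.card_compl, h2]; simp
    obtain ⟨j, hj⟩ := Finset.card_eq_one.mp h3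
    have h4 : {x ∈ posCone v Finset.univ | l x = 0} = posCone v (Finset.univ.erase j) := by
      rw [posCone_face v _ _ h1]
      congr 1
      rw [← compl_inj_iff, hj]; ext; simp
    refine ⟨c j, ⟨by simp, by rw [h4, hface]⟩, ?_⟩
    rintro l' ⟨hl', e⟩
    simp only [Finset.mem_image, Finset.mem_univ, true_and] at hl'
    obtain ⟨i, rfl⟩ := hl'
    rw [h4, hface] at e
    rw [hinj i j e]
  · intro Y hY
    rw [hf Y hY]
    simp [Finset.prod_image hcinj.injOn, div_eq_mul_inv, mul_comm]

-- Induction on `d`. The facet `c j = 0` is the simplex on the other generators, with the other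
-- coordinates as dual basis and with the same volume by `curryLeft_succAbove_of_dual`; taking the
-- residue just deletes the factor `c j`.
open Classical in
theorem isCanonicalFunction_simplex {N : ℕ} : ∀ (d : ℕ) (v : Fin (d + 1) → Fin N → ℝ)
    (c : Fin (d + 1) → (Fin N → ℝ) →ₗ[ℝ] ℝ), (∀ i j, c i (v j) = if i = j then 1 else 0) →
    ∀ (ν : (Fin N → ℝ) [⋀^Fin (d + 1)]→ₗ[ℝ] ℝ), ν v ≠ 0 → ∀ f : (Fin N → ℝ) → ℝ,
    (∀ Y ∈ Submodule.span ℝ (posCone v Finset.univ), f Y = (|ν v| * ∏ i, c i Y)⁻¹) →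
    IsCanonicalFunction d (posCone v Finset.univ) ν f
  | 0, v, c, hc, ν, hν, f, hf => by
    refine ⟨⟨_, _, hasSimpleFacetPoles_simplex hc _ hf⟩, fun Y hY hY0 => ?_⟩
    rw [hf Y (Submodule.subset_span hY)]
    obtain ⟨a, ha0, rfl⟩ := hY
    have ha : a 0 ≠ 0 := fun h => hY0 (by simp [h])
    obtain ⟨x, rfl⟩ : ∃ x, v = ![x] := ⟨v 0, by ext i; fin_cases i; rfl⟩
    have h0 := hc 0 0
    simp at h0
    have : ν ![a 0 • x] = a 0 * ν ![x] := by
      have h := ν.toMultilinearMap.map_smul_univ a ![x]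
      have e : (fun i => a i • (![x] : Fin (0 + 1) → Fin N → ℝ) i) = ![a 0 • x] := by
        ext i; fin_cases i; rfl
      rw [e] at h
      simpa using h
    simp [h0, this, abs_mul]
    have h1 : |a 0| = a 0 := abs_of_nonneg (ha0 0)
    have h2 : |ν ![x]| ≠ 0 := abs_ne_zero.mpr hν
    rw [h1]
    field_simp
  | d + 1, v, c, hc, ν, hν, f, hf => by
    classical
    refine ⟨_, _, hasSimpleFacetPoles_simplex hc _ hf, ?_⟩
    intro l hl u hu hlu
    simp only [Finset.mem_image, Finset.mem_univ, true_and] at hl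
    obtain ⟨j, rfl⟩ := hl
    have hface : {x ∈ posCone v Finset.univ | c j x = 0} =
        posCone (v ∘ j.succAbove) Finset.univ := by
      rw [posCone_face v _ _ fun i _ => by rw [hc]; split_ifs <;> norm_num]
      rw [show v ∘ j.succAbove = v ∘ (Fin.succAboveEmb j) from rfl, posCone_comp]
      rw [← erase_univ_eq_map_succAbove]
      congr 1; ext i; simp [hc, eq_comm]
    rw [span_posCone_univ] at hu
    have hν' := curryLeft_succAbove_of_dual ν hc hu j
    rw [hlu, abs_one, one_mul] at hν'
    refine ⟨fun Y => (|ν v| * ∏ i, c (j.succAbove i) Y)⁻¹, ?_, fun w _ _ _ => ?_⟩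
    · rw [hface]
      refine isCanonicalFunction_simplex d (v ∘ j.succAbove) (c ∘ j.succAbove) ?_ _ ?_ _ ?_
      · intro i k; simp [hc, Fin.succAbove_right_injective.eq_iff]
      · rw [← abs_ne_zero, hν', abs_ne_zero]; exact hν
      · intro Y _; rw [hν']; rfl
    · have hcinj := injective_of_dual hc
      have : (Finset.univ.image c).erase (c j) =
          (Finset.univ.map (Fin.succAboveEmb j)).image c := by
        rw [← erase_univ_eq_map_succAbove, Finset.image_erase hcinj]
      rw [this, Finset.prod_image hcinj.injOn, Finset.prod_map]
      simp [div_eq_mul_inv, mul_comm]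

/-! ### Vector configurations in general position -/

section configuration

variable {m n : ℕ}

/-- Any `m + 1` of the vectors `z i ∈ ℝ^{m+1}` are linearly independent. -/
def InGeneralPosition (z : Fin n → Fin (m + 1) → ℝ) : Prop :=
  ∀ J : Finset (Fin n), J.card = m + 1 → LinearIndepOn ℝ z J

lemma IsTotallyPositive.inGeneralPosition {Z : Matrix (Fin (m + 1)) (Fin n) ℝ}
    (hZ : IsTotallyPositive Z) : InGeneralPosition Z.col := by
  intro J hJ
  have h := hZ (J.orderEmbOfFin hJ)
  have h1 : LinearIndependent ℝ (Z.submatrix id (J.orderEmbOfFin hJ)).col := by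
    rw [Matrix.linearIndependent_cols_iff_isUnit, Matrix.isUnit_iff_isUnit_det]
    exact isUnit_iff_ne_zero.mpr h.ne'
  have h2 : LinearIndependent ℝ (fun j : J => Z.col j) := by
    rw [← linearIndependent_equiv (J.orderIsoOfFin hJ).toEquiv]
    exact h1
  exact h2

lemma detForm_ne_zero {v : Fin (m + 1) → Fin (m + 1) → ℝ} (hv : LinearIndependent ℝ v) :
    detForm m v ≠ 0 := by
  have h : LinearIndependent ℝ (Matrix.of v).row := hv
  rw [Matrix.linearIndependent_rows_iff_isUnit, Matrix.isUnit_iff_isUnit_det] at h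
  rw [detForm, Pi.basisFun_det_apply]
  exact h.ne_zero

/-- The volume `|det (z_j)_{j ∈ J}|`. -/
def absDet (z : Fin n → Fin (m + 1) → ℝ) (J : Finset (Fin n)) : ℝ :=
  if h : J.card = m + 1 then |detForm m (z ∘ J.orderEmbOfFin h)| else 0

lemma abs_detForm_comp (z : Fin n → Fin (m + 1) → ℝ) {e : Fin (m + 1) → Fin n}
    (he : Function.Injective e) {J : Finset (Fin n)} (hJ : ∀ i, e i ∈ J) (hc : J.card = m + 1) :
    |detForm m (z ∘ e)| = absDet z J := by
  rw [absDet, dif_pos hc]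
  have hb : Function.Bijective (fun i => (⟨e i, hJ i⟩ : J)) := by
    rw [Fintype.bijective_iff_injective_and_card]
    exact ⟨fun i j h => he (congrArg Subtype.val h), by simp [hc]⟩
  let σ : Equiv.Perm (Fin (m + 1)) :=
    (Equiv.ofBijective _ hb).trans (J.orderIsoOfFin hc).toEquiv.symm
  have : z ∘ e = (z ∘ J.orderEmbOfFin hc) ∘ σ := by
    funext i
    have : J.orderIsoOfFin hc (σ i) = ⟨e i, hJ i⟩ := by simp [σ]
    simp only [Function.comp_apply]
    rw [← Finset.coe_orderIsoOfFin_apply, this]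
  rw [this, AlternatingMap.map_perm]
  rcases Int.units_eq_one_or (Equiv.Perm.sign σ) with h | h <;> simp [h]

lemma linearIndependent_comp {z : Fin n → Fin (m + 1) → ℝ} (hz : InGeneralPosition z)
    {e : Fin (m + 1) → Fin n} (he : Function.Injective e) : LinearIndependent ℝ (z ∘ e) := by
  have h := hz (Finset.univ.map ⟨e, he⟩) (by simp)
  have h' := h.comp (fun i => ⟨e i, by simp⟩)
    (fun i j hij => he (congrArg Subtype.val hij))
  exact h'

open Classical in
/-- The linear form defining the hyperplane spanned by the `z i`, `i ∈ F`, normalised so that it is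
nonnegative on the configuration if the configuration lies on one side of the hyperplane. -/
def wall (z : Fin n → Fin (m + 1) → ℝ) (F : Finset (Fin n)) : (Fin (m + 1) → ℝ) →ₗ[ℝ] ℝ :=
  if h : F.card = m then
    if ∀ i, consForm (detForm m) (z ∘ F.orderEmbOfFin h) (z i) ≤ 0 then
      - consForm (detForm m) (z ∘ F.orderEmbOfFin h)
    else consForm (detForm m) (z ∘ F.orderEmbOfFin h)
  else 0

lemma abs_wall (z : Fin n → Fin (m + 1) → ℝ) {F : Finset (Fin n)} (hF : F.card = m)
    (u : Fin (m + 1) → ℝ) :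
    |wall z F u| = |(detForm m).curryLeft u (z ∘ F.orderEmbOfFin hF)| := by
  rw [wall, dif_pos hF]
  split_ifs
  · rw [LinearMap.neg_apply, abs_neg, consForm_apply]
  · rw [consForm_apply]

lemma wall_eq_zero (z : Fin n → Fin (m + 1) → ℝ) {F : Finset (Fin n)} {i : Fin n} (hi : i ∈ F) :
    wall z F (z i) = 0 := by
  by_cases hF : F.card = m
  · rw [← abs_eq_zero, abs_wall z hF, abs_eq_zero, AlternatingMap.curryLeft_apply_apply]
    obtain ⟨k, rfl⟩ : ∃ k, F.orderEmbOfFin hF k = i := by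
      have : i ∈ Set.range (F.orderEmbOfFin hF) := by simpa using hi
      exact this
    exact AlternatingMap.map_eq_zero_of_eq _ _ (i := 0) (j := k.succ) (by simp)
      (Fin.succ_ne_zero k).symm
  · simp [wall, hF]

lemma abs_wall_eq_absDet (z : Fin n → Fin (m + 1) → ℝ) {F : Finset (Fin n)} (hF : F.card = m)
    {i : Fin n} (hi : i ∉ F) : |wall z F (z i)| = absDet z (insert i F) := by
  rw [abs_wall z hF, AlternatingMap.curryLeft_apply_apply]
  have : (Matrix.vecCons (z i) (z ∘ F.orderEmbOfFin hF) : Fin (m + 1) → Fin (m + 1) → ℝ) =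
      z ∘ (Fin.cons i (F.orderEmbOfFin hF) : Fin (m + 1) → Fin n) := by
    funext k
    refine Fin.cases ?_ (fun k => ?_) k <;> simp
  rw [this]
  refine abs_detForm_comp z ?_ ?_ (by rw [Finset.card_insert_of_notMem hi, hF])
  · rw [Fin.cons_injective_iff]
    exact ⟨by simpa using hi, (F.orderEmbOfFin hF).injective⟩
  · intro k
    refine Fin.cases ?_ (fun k => ?_) k <;> simp

lemma absDet_pos {z : Fin n → Fin (m + 1) → ℝ} (hz : InGeneralPosition z) {J : Finset (Fin n)}
    (hJ : J.card = m + 1) : 0 < absDet z J := by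
  rw [absDet, dif_pos hJ, abs_pos]
  exact detForm_ne_zero (linearIndependent_comp hz (J.orderEmbOfFin hJ).injective)

lemma wall_ne_zero {z : Fin n → Fin (m + 1) → ℝ} (hz : InGeneralPosition z) {F : Finset (Fin n)}
    (hF : F.card = m) {i : Fin n} (hi : i ∉ F) : wall z F (z i) ≠ 0 := by
  rw [← abs_pos, abs_wall_eq_absDet z hF hi]
  exact absDet_pos hz (by rw [Finset.card_insert_of_notMem hi, hF])

lemma wall_eq_zero_iff {z : Fin n → Fin (m + 1) → ℝ} (hz : InGeneralPosition z)
    {F : Finset (Fin n)} (hF : F.card = m) {i : Fin n} : wall z F (z i) = 0 ↔ i ∈ F :=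
  ⟨fun h => by_contra fun hi => wall_ne_zero hz hF hi h, wall_eq_zero z⟩

/-- The configuration lies on one side of the hyperplane spanned by the `z i`, `i ∈ F`. -/
def IsFacet (z : Fin n → Fin (m + 1) → ℝ) (F : Finset (Fin n)) : Prop :=
  ∀ i, 0 ≤ wall z F (z i)

/-- Failure to be a facet gives a negative value. Were there no positive one, the normalisation in
`wall` would have chosen the opposite sign. -/
lemma exists_pos_neg_of_not_isFacet {z : Fin n → Fin (m + 1) → ℝ} {F : Finset (Fin n)}
    (h : ¬ IsFacet z F) : (∃ i, 0 < wall z F (z i)) ∧ ∃ i, wall z F (z i) < 0 := by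
  have hneg : ∃ i, wall z F (z i) < 0 := by simpa [IsFacet] using h
  refine ⟨?_, hneg⟩
  by_contra! hcon
  have hF : F.card = m := by
    by_contra hF
    obtain ⟨i, hi⟩ := hneg
    simp [wall, hF] at hi
  obtain ⟨i, hi⟩ := hneg
  by_cases hs : ∀ i, consForm (detForm m) (z ∘ F.orderEmbOfFin hF) (z i) ≤ 0
  · rw [wall, dif_pos hF, if_pos hs, LinearMap.neg_apply] at hi
    linarith [hs i]
  · refine hs fun j => ?_
    have := hcon j
    rwa [wall, dif_pos hF, if_neg hs] at this

/-- The coordinates with respect to the basis `z j`, `j ∈ J`. -/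
def coord (z : Fin n → Fin (m + 1) → ℝ) (J : Finset (Fin n)) (j : Fin n) :
    (Fin (m + 1) → ℝ) →ₗ[ℝ] ℝ :=
  (wall z (J.erase j) (z j))⁻¹ • wall z (J.erase j)

variable {z : Fin n → Fin (m + 1) → ℝ} {J : Finset (Fin n)}

lemma coord_apply_self (hz : InGeneralPosition z) (hJ : J.card = m + 1) {i j : Fin n} (hi : i ∈ J)
    (hj : j ∈ J) : coord z J i (z j) = if i = j then 1 else 0 := by
  rw [coord, LinearMap.smul_apply, smul_eq_mul]
  have hc : (J.erase i).card = m := by rw [Finset.card_erase_of_mem hi, hJ]; rfl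
  split_ifs with h
  · subst h
    exact inv_mul_cancel₀ (wall_ne_zero hz hc (Finset.notMem_erase i J))
  · rw [wall_eq_zero z (Finset.mem_erase.mpr ⟨Ne.symm h, hj⟩), mul_zero]

lemma span_eq_top (hz : InGeneralPosition z) (hJ : J.card = m + 1) :
    Submodule.span ℝ (z '' J) = ⊤ := by
  apply Submodule.eq_top_of_finrank_eq
  rw [finrank_span_image (hz J hJ), hJ]
  simp

lemma ext_of_eq (hz : InGeneralPosition z) (hJ : J.card = m + 1) {φ ψ : (Fin (m + 1) → ℝ) →ₗ[ℝ] ℝ}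
    (h : ∀ j ∈ J, φ (z j) = ψ (z j)) : φ = ψ := by
  refine LinearMap.ext_on (span_eq_top hz hJ) ?_
  rintro _ ⟨j, hj, rfl⟩
  exact h j hj

lemma eq_sum_coord (hz : InGeneralPosition z) (hJ : J.card = m + 1) (Y : Fin (m + 1) → ℝ) :
    Y = ∑ j ∈ J, coord z J j Y • z j := by
  have hY : Y ∈ Submodule.span ℝ (z '' J) := by rw [span_eq_top hz hJ]; trivial
  rw [← span_posCone] at hY
  refine Submodule.span_induction (p := fun Y _ => Y = ∑ j ∈ J, coord z J j Y • z j) ?_ ?_ ?_ ?_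
    (show Y ∈ Submodule.span ℝ (z '' J) by rw [span_eq_top hz hJ]; trivial)
  · rintro _ ⟨i, hi, rfl⟩
    rw [Finset.sum_congr rfl fun j hj => by rw [coord_apply_self hz hJ hj hi]]
    simp [Finset.sum_ite_eq', show i ∈ J from hi]
  · simp
  · intro x y _ _ hx hy
    conv_lhs => rw [hx, hy]
    simp [add_smul, Finset.sum_add_distrib]
  · intro t x _ hx
    conv_lhs => rw [hx]
    simp [Finset.smul_sum, mul_smul]

lemma coord_sum (hz : InGeneralPosition z) (hJ : J.card = m + 1) (a : Fin n → ℝ) {i : Fin n}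
    (hi : i ∈ J) : coord z J i (∑ j ∈ J, a j • z j) = a i := by
  rw [map_sum, Finset.sum_congr rfl fun j hj => by
    rw [map_smul, coord_apply_self hz hJ hi hj]]
  simp [hi]

lemma mem_posCone_iff_coord (hz : InGeneralPosition z) (hJ : J.card = m + 1)
    {Y : Fin (m + 1) → ℝ} : Y ∈ posCone z J ↔ ∀ j ∈ J, 0 ≤ coord z J j Y := by
  classical
  constructor
  · rintro ⟨a, ha, rfl⟩ j hj
    rw [coord_sum hz hJ a hj]; exact ha j
  · intro h
    refine ⟨fun j => if j ∈ J then coord z J j Y else 0, fun j => ?_, ?_⟩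
    · dsimp only; split_ifs with hj
      · exact h j hj
      · exact le_rfl
    · conv_lhs => rw [eq_sum_coord hz hJ Y]
      exact Finset.sum_congr rfl fun j hj => by simp only [if_pos hj]

/-- The linear form with values `h j` at `z j`, `j ∈ J`. -/
def interp (z : Fin n → Fin (m + 1) → ℝ) (J : Finset (Fin n)) (h : Fin n → ℝ) :
    (Fin (m + 1) → ℝ) →ₗ[ℝ] ℝ :=
  ∑ j ∈ J, h j • coord z J j

lemma interp_apply (hz : InGeneralPosition z) (hJ : J.card = m + 1) (h : Fin n → ℝ) {j : Fin n}
    (hj : j ∈ J) : interp z J h (z j) = h j := by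
  rw [interp, LinearMap.sum_apply, Finset.sum_congr rfl fun i hi => by
    rw [LinearMap.smul_apply, coord_apply_self hz hJ hi hj]]
  simp [hj]

open Classical in
/-- The simplices `J` for which the linear form interpolating the heights on `J` lies below the
heights. -/
def lowerSimplices (z : Fin n → Fin (m + 1) → ℝ) (h : Fin n → ℝ) : Finset (Finset (Fin n)) :=
  Finset.univ.filter fun J => J.card = m + 1 ∧ ∀ i, interp z J h (z i) ≤ h i

lemma mem_lowerSimplices {h : Fin n → ℝ} :
    J ∈ lowerSimplices z h ↔ J.card = m + 1 ∧ ∀ i, interp z J h (z i) ≤ h i := by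
  simp [lowerSimplices]

/-- The lower simplices touch the heights only at their vertices. -/
def IsSimplicialHeight (z : Fin n → Fin (m + 1) → ℝ) (h : Fin n → ℝ) : Prop :=
  ∀ J ∈ lowerSimplices z h, ∀ i ∉ J, interp z J h (z i) < h i

/-- That a label `i ∉ J` touches the interpolation on `J` is a linear condition on `h`, and a
nontrivial one because `h i` enters with coefficient `1`. Heights off finitely many hyperplanes
avoid all such conditions. This supplies a triangulation before any cone of the fan is chosen. -/
lemma exists_isSimplicialHeight (z : Fin n → Fin (m + 1) → ℝ) : ∃ h, IsSimplicialHeight z h := by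
  classical
  obtain ⟨h, hh⟩ := Module.Dual.exists_forall_ne_zero_of_forall_exists
    (fun q : {q : Finset (Fin n) × Fin n // q.1.card = m + 1 ∧ q.2 ∉ q.1} =>
      ((LinearMap.proj q.1.2 : (Fin n → ℝ) →ₗ[ℝ] ℝ) -
        ∑ j ∈ q.1.1, coord z q.1.1 j (z q.1.2) • (LinearMap.proj j : (Fin n → ℝ) →ₗ[ℝ] ℝ) :
        Module.Dual ℝ (Fin n → ℝ))) (by
      rintro ⟨⟨J, i⟩, hJ, hi⟩
      refine ⟨Pi.single i 1, ?_⟩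
      simp only [LinearMap.sub_apply, LinearMap.sum_apply, LinearMap.smul_apply,
        LinearMap.proj_apply, Pi.single_eq_same]
      rw [Finset.sum_eq_zero fun j hj => by
        rw [Pi.single_eq_of_ne (fun e : j = i => hi (by subst e; exact hj)), smul_zero]]
      norm_num)
  refine ⟨h, fun J hJ i hi => ?_⟩
  rw [mem_lowerSimplices] at hJ
  refine lt_of_le_of_ne (hJ.2 i) fun e => hh ⟨(J, i), hJ.1, hi⟩ ?_
  simp only [LinearMap.sub_apply, LinearMap.sum_apply, LinearMap.smul_apply,
    LinearMap.proj_apply]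
  rw [← e, interp]
  simp [LinearMap.sum_apply, mul_comm]

end configuration

/-! ### Linear factors of polynomials -/

section linearFactors

variable {N : ℕ}

/-- A linear form as a polynomial. -/
def linPoly (l : (Fin N → ℝ) →ₗ[ℝ] ℝ) : MvPolynomial (Fin N) ℝ :=
  ∑ i, MvPolynomial.C (l (Pi.single i 1)) * MvPolynomial.X i

lemma eval_linPoly (l : (Fin N → ℝ) →ₗ[ℝ] ℝ) (Y : Fin N → ℝ) :
    MvPolynomial.eval Y (linPoly l) = l Y := by
  conv_rhs => rw [LinearMap.pi_apply_eq_sum_univ l Y]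
  simp only [linPoly, map_sum, map_mul, MvPolynomial.eval_C, MvPolynomial.eval_X, smul_eq_mul]
  exact Finset.sum_congr rfl fun i _ => by
    rw [mul_comm]; congr 2; funext j; simp [Pi.single_apply, eq_comm]

lemma isHomogeneous_linPoly (l : (Fin N → ℝ) →ₗ[ℝ] ℝ) : (linPoly l).IsHomogeneous 1 :=
  MvPolynomial.IsHomogeneous.sum _ _ _ fun i _ => MvPolynomial.isHomogeneous_C_mul_X _ i

/-- A polynomial vanishing at the points of a hyperplane outside of other hyperplanes is divisible
by the linear form. -/
lemma linPoly_dvd {l : (Fin N → ℝ) →ₗ[ℝ] ℝ} (hl : l ≠ 0) {ι : Type*} (S : Finset ι)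
    (s : ι → (Fin N → ℝ) →ₗ[ℝ] ℝ) (hS : ∀ i ∈ S, ∃ w, l w = 0 ∧ s i w ≠ 0)
    {P : MvPolynomial (Fin N) ℝ}
    (hP : ∀ w, l w = 0 → (∀ i ∈ S, s i w ≠ 0) → MvPolynomial.eval w P = 0) : linPoly l ∣ P := by
  obtain ⟨i, hi⟩ : ∃ i, l (Pi.single i 1) ≠ 0 := by
    by_contra! h
    refine hl (LinearMap.pi_ext' fun i => LinearMap.ext_ring ?_)
    simpa using h i
  set e : Fin N → ℝ := Pi.single i 1 with he
  -- `θ` is composition with the projection to `ker l` along `e`. It is the identity modulo `linPoly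
  -- l`, so `θ P = 0` gives divisibility.
  let θ : MvPolynomial (Fin N) ℝ →ₐ[ℝ] MvPolynomial (Fin N) ℝ :=
    MvPolynomial.aeval fun j => MvPolynomial.X j - MvPolynomial.C (e j / l e) * linPoly l
  have hθ : ∀ (Q : MvPolynomial (Fin N) ℝ) (y : Fin N → ℝ),
      MvPolynomial.eval y (θ Q) = MvPolynomial.eval (y - (l y / l e) • e) Q := by
    intro Q y
    rw [MvPolynomial.map_aeval, ← MvPolynomial.eval₂_id]
    change MvPolynomial.eval₂ _ _ _ = MvPolynomial.eval₂ _ _ _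
    congr 1
    · ext x; simp
    · funext j; simp [eval_linPoly]; ring
  have hker : ∀ y, l (y - (l y / l e) • e) = 0 := fun y => by simp [hi]
  -- The extra factors vanish where nothing is known about `P`; being nonzero, they can be cancelled
  -- in the polynomial ring.
  have hzero : θ P * ∏ j ∈ S, θ (linPoly (s j)) = 0 := by
    refine MvPolynomial.funext fun y => ?_
    rw [map_mul, map_prod, map_zero, hθ]
    by_cases h : ∀ j ∈ S, s j (y - (l y / l e) • e) ≠ 0
    · rw [hP _ (hker y) h, zero_mul]
    · push Not at h
      obtain ⟨j, hj, hj0⟩ := h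
      rw [Finset.prod_eq_zero hj (by rw [hθ, eval_linPoly, hj0]), mul_zero]
  have hne : ∏ j ∈ S, θ (linPoly (s j)) ≠ 0 := by
    refine Finset.prod_ne_zero_iff.mpr fun j hj h0 => ?_
    obtain ⟨w, hw, hw'⟩ := hS j hj
    have := hθ (linPoly (s j)) w
    rw [h0, hw, zero_div, zero_smul, sub_zero, eval_linPoly, map_zero] at this
    exact hw' this.symm
  have hP0 : θ P = 0 := (mul_eq_zero.mp hzero).resolve_right hne
  have hmk : (Ideal.Quotient.mkₐ ℝ (Ideal.span {linPoly l})).comp θ =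
      Ideal.Quotient.mkₐ ℝ (Ideal.span {linPoly l}) := by
    refine MvPolynomial.algHom_ext fun j => ?_
    simp only [AlgHom.comp_apply, θ, MvPolynomial.aeval_X]
    rw [Ideal.Quotient.mkₐ_eq_mk, Ideal.Quotient.mk_eq_mk_iff_sub_mem]
    rw [Ideal.mem_span_singleton]
    exact ⟨- MvPolynomial.C (e j / l e), by ring⟩
  have h1 := congrArg (fun φ => φ P) hmk
  simp only [AlgHom.comp_apply, hP0, map_zero] at h1
  rw [← Ideal.mem_span_singleton]
  exact Ideal.Quotient.eq_zero_iff_mem.mp h1.symm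

/-- By induction, with `P` divided by the forms in `S`: on `s i = 0` and off the other hyperplanes
`P` vanishes while the divisor does not, so `linPoly_dvd` applies to the quotient. No unique
factorisation is needed. -/
lemma prod_linPoly_dvd {ι : Type*} (S : Finset ι) (s : ι → (Fin N → ℝ) →ₗ[ℝ] ℝ)
    (hs0 : ∀ i ∈ S, s i ≠ 0) (hs : ∀ i ∈ S, ∀ j ∈ S, j ≠ i → ∃ w, s i w = 0 ∧ s j w ≠ 0)
    {P : MvPolynomial (Fin N) ℝ} (hP : ∀ i ∈ S, linPoly (s i) ∣ P) :
    ∏ i ∈ S, linPoly (s i) ∣ P := by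
  classical
  induction S using Finset.induction_on with
  | empty => simp
  | insert i S hi ih =>
    obtain ⟨Q, hQ⟩ := ih (fun j hj => hs0 j (Finset.mem_insert_of_mem hj))
      (fun j hj k hk => hs j (Finset.mem_insert_of_mem hj) k (Finset.mem_insert_of_mem hk))
      (fun j hj => hP j (Finset.mem_insert_of_mem hj))
    have : linPoly (s i) ∣ Q := by
      refine linPoly_dvd (hs0 i (Finset.mem_insert_self i S)) S s (fun j hj =>
        hs i (Finset.mem_insert_self i S) j (Finset.mem_insert_of_mem hj)
          (fun e => hi (e ▸ hj))) fun w hw hne => ?_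
      obtain ⟨R, hR⟩ := hP i (Finset.mem_insert_self i S)
      have h0 : MvPolynomial.eval w P = 0 := by rw [hR, map_mul, eval_linPoly, hw, zero_mul]
      rw [hQ, map_mul, map_prod] at h0
      refine (mul_eq_zero.mp h0).resolve_left (Finset.prod_ne_zero_iff.mpr fun j hj => ?_)
      rw [eval_linPoly]; exact hne j hj
    obtain ⟨R, rfl⟩ := this
    rw [Finset.prod_insert hi]
    exact ⟨R, by rw [hQ]; ring⟩

/-- The component of `a * b` in degree `j + i` is `a` times the component of `b` in degree `i`;
cancelling `a` shows that `b` equals that component. -/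
lemma mem_of_mul_mem_graded {A σ : Type*} [CommRing A] [IsDomain A] [SetLike σ A]
    [AddSubmonoidClass σ A] (𝒜 : ℕ → σ) [GradedRing 𝒜] {i j : ℕ} {a b : A} (ha : a ∈ 𝒜 j)
    (ha0 : a ≠ 0) (hab : a * b ∈ 𝒜 (j + i)) : b ∈ 𝒜 i := by
  have h := DirectSum.coe_decompose_mul_add_of_left_mem 𝒜 (b := b) (j := i) ha
  rw [DirectSum.decompose_of_mem_same _ hab] at h
  rw [mul_left_cancel₀ ha0 h]
  exact SetLike.coe_mem _

lemma exists_isHomogeneous_of_mul {σ : Type*} {j k : ℕ} {P Q R : MvPolynomial σ ℝ} (hP0 : P ≠ 0)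
    (hP : P.IsHomogeneous k) (hR : R.IsHomogeneous j) (h : P = R * Q) :
    ∃ i, k = j + i ∧ Q.IsHomogeneous i := by
  have hR0 : R ≠ 0 := fun e => hP0 (by rw [h, e, zero_mul])
  have hQ0 : Q ≠ 0 := fun e => hP0 (by rw [h, e, mul_zero])
  have hdeg := MvPolynomial.totalDegree_mul_of_isDomain hR0 hQ0
  rw [← h, hP.totalDegree hP0, hR.totalDegree hR0] at hdeg
  refine ⟨Q.totalDegree, hdeg, ?_⟩
  let _ : GradedAlgebra (MvPolynomial.homogeneousSubmodule σ ℝ) := MvPolynomial.gradedAlgebra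
  rw [← MvPolynomial.mem_homogeneousSubmodule] at hP hR ⊢
  rw [h, hdeg] at hP
  exact mem_of_mul_mem_graded _ hR hR0 hP

end linearFactors

/-! ### Simplices adjacent to a wall -/

/-- In the one-parameter family of linear forms with fixed values on a wall, the feasible interval
has no end point or one end point on either side. -/
lemma sum_sign_eq_zero {ι : Type*} (S T : Finset ι) (w τ : ι → ℝ) (hw : ∀ i ∈ S, w i ≠ 0)
    (hTS : ∀ j, j ∈ T ↔ j ∈ S ∧ ∀ i ∈ S, 0 ≤ w i * (τ i - τ j))
    (hT : ∀ j ∈ T, ∀ i ∈ S, i ≠ j → 0 < w i * (τ i - τ j))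
    (hpos : ∃ i ∈ S, 0 < w i) (hneg : ∃ i ∈ S, w i < 0) :
    ∑ j ∈ T, w j / |w j| = 0 := by
  classical
  have hsub : T ⊆ S := fun j hj => ((hTS j).mp hj).1
  -- Two attained bounds on the same side would each have to be strictly tighter than the other.
  have huniq : ∀ j ∈ T, ∀ j' ∈ T, 0 < w j * w j' → j = j' := by
    intro j hj j' hj' h
    by_contra hne
    have h1 := hT j hj j' (hsub hj') (Ne.symm hne)
    have h2 := hT j' hj' j (hsub hj) hne
    have := mul_pos h1 h2
    have : 0 < -(w j * w j') * (τ j' - τ j) ^ 2 := by nlinarith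
    nlinarith [sq_nonneg (τ j' - τ j), mul_nonneg h.le (sq_nonneg (τ j' - τ j))]
  -- The condition `0 ≤ w i * (τ i - t)` bounds `t` from above if `w i > 0` and from below if `w i <
  -- 0`, and `T` consists of the bounds that are feasible. One feasible bound shows that the
  -- interval is nonempty; then the tightest bound on the other side is feasible as well. The sign
  -- `s = ±1` exchanges the sides.
  have hswap : ∀ s : ℝ, s ≠ 0 → (∃ i ∈ S, s * w i < 0) → (∃ j ∈ T, 0 < s * w j) →
      ∃ j ∈ T, s * w j < 0 := by
    rintro s hs ⟨i₀, hi₀, hi₀'⟩ ⟨j, hj, hjs⟩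
    obtain ⟨b, hb, hbmin⟩ := Finset.exists_max_image (S.filter fun i => s * w i < 0)
      (fun i => s * τ i) ⟨i₀, by simp [hi₀, hi₀']⟩
    rw [Finset.mem_filter] at hb
    refine ⟨b, (hTS b).mpr ⟨hb.1, fun i hi => ?_⟩, hb.2⟩
    have hs2 : 0 < s * s := mul_self_pos.mpr hs
    have key : 0 ≤ (s * w i) * (s * τ i - s * τ b) → 0 ≤ w i * (τ i - τ b) := by
      intro h
      have : (s * w i) * (s * τ i - s * τ b) = (s * s) * (w i * (τ i - τ b)) := by ring
      rw [this] at h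
      exact nonneg_of_mul_nonneg_right h hs2
    have conv : ∀ i ∈ S, 0 ≤ (s * w i) * (s * τ i - s * τ j) := fun i hi => by
      have : (s * w i) * (s * τ i - s * τ j) = (s * s) * (w i * (τ i - τ j)) := by ring
      rw [this]
      exact mul_nonneg hs2.le (((hTS j).mp hj).2 i hi)
    apply key
    rcases lt_or_gt_of_ne (mul_ne_zero hs (hw i hi)) with h | h
    · exact mul_nonneg_of_nonpos_of_nonpos h.le
        (sub_nonpos.mpr (hbmin i (Finset.mem_filter.mpr ⟨hi, h⟩)))
    · refine mul_nonneg h.le ?_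
      have h1 := nonneg_of_mul_nonneg_right (conv i hi) h
      have h2 : s * τ b - s * τ j ≤ 0 := by
        by_contra hcon
        exact absurd (conv b hb.1) (not_le.mpr (mul_neg_of_neg_of_pos hb.2 (not_le.mp hcon)))
      linarith
  by_cases hTe : T = ∅
  · simp [hTe]
  obtain ⟨j, hj⟩ := Finset.nonempty_iff_ne_empty.mpr hTe
  obtain ⟨p, hp, hp', q, hq, hq'⟩ : ∃ p ∈ T, 0 < w p ∧ ∃ q ∈ T, w q < 0 := by
    rcases lt_or_gt_of_ne (hw j (hsub hj)) with h | h
    · obtain ⟨p, hp, hp'⟩ := hswap (-1) (by norm_num)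
        (by obtain ⟨i, hi, hi'⟩ := hpos; exact ⟨i, hi, by linarith⟩) ⟨j, hj, by linarith⟩
      exact ⟨p, hp, by linarith, j, hj, h⟩
    · obtain ⟨q, hq, hq'⟩ := hswap 1 (by norm_num)
        (by obtain ⟨i, hi, hi'⟩ := hneg; exact ⟨i, hi, by linarith⟩) ⟨j, hj, by linarith⟩
      exact ⟨j, hj, h, q, hq, by linarith⟩
  have hpq : p ≠ q := fun e => by rw [e] at hp'; linarith
  have hTpq : T = {p, q} := by
    ext k
    simp only [Finset.mem_insert, Finset.mem_singleton]
    constructor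
    · intro hk
      rcases lt_or_gt_of_ne (hw k (hsub hk)) with h | h
      · exact Or.inr (huniq k hk q hq (mul_pos_of_neg_of_neg h hq'))
      · exact Or.inl (huniq k hk p hp (mul_pos h hp'))
    · rintro (rfl | rfl) <;> assumption
  rw [hTpq, Finset.sum_pair hpq, abs_of_pos hp', abs_of_neg hq', div_self hp'.ne', div_neg,
    div_self hq'.ne]
  norm_num

/-- All constraints bound the parameter from above, so only the least bound is feasible, and it is
unique by strictness. -/
lemma sum_sign_eq_one {ι : Type*} (S T : Finset ι) (w τ : ι → ℝ) (hw : ∀ i ∈ S, 0 < w i)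
    (hTS : ∀ j, j ∈ T ↔ j ∈ S ∧ ∀ i ∈ S, 0 ≤ w i * (τ i - τ j))
    (hT : ∀ j ∈ T, ∀ i ∈ S, i ≠ j → 0 < w i * (τ i - τ j)) (hS : S.Nonempty) :
    ∑ j ∈ T, w j / |w j| = 1 := by
  obtain ⟨b, hb, hbmin⟩ := Finset.exists_min_image S τ hS
  have hbT : b ∈ T := (hTS b).mpr ⟨hb, fun i hi =>
    mul_nonneg (hw i hi).le (sub_nonneg.mpr (hbmin i hi))⟩
  have : T = {b} := by
    ext k
    simp only [Finset.mem_singleton]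
    constructor
    · intro hk
      by_contra hne
      have hkS := ((hTS k).mp hk).1
      have h1 := pos_of_mul_pos_right (hT k hk b hb (Ne.symm hne)) (hw b hb).le
      linarith [hbmin k hkS]
    · rintro rfl; exact hbT
  rw [this, Finset.sum_singleton, abs_of_pos (hw b hb), div_self (hw b hb).ne']

section triangulationSum

variable {m n : ℕ} {z : Fin n → Fin (m + 1) → ℝ} {h : Fin n → ℝ}

/-- The canonical function of the simplex with vertices `z j`, `j ∈ J`. -/
def simplexFunction (z : Fin n → Fin (m + 1) → ℝ) (J : Finset (Fin n)) (Y : Fin (m + 1) → ℝ) : ℝ :=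
  (absDet z J * ∏ j ∈ J, coord z J j Y)⁻¹

lemma prod_powersetCard_eq_prod_erase {J : Finset (Fin n)} (hJ : J.card = m + 1)
    (g : Finset (Fin n) → ℝ) : ∏ F ∈ J.powersetCard m, g F = ∏ j ∈ J, g (J.erase j) := by
  symm
  refine Finset.prod_bij (fun j _ => J.erase j) ?_ ?_ ?_ (fun _ _ => rfl)
  · intro j hj
    rw [Finset.mem_powersetCard]
    exact ⟨Finset.erase_subset _ _, by rw [Finset.card_erase_of_mem hj, hJ]; rfl⟩
  · intro i hi j hj e
    exact (Finset.erase_inj _ hi).mp e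
  · intro F hF
    rw [Finset.mem_powersetCard] at hF
    have hc : (J \ F).card = 1 := by rw [Finset.card_sdiff_of_subset hF.1, hJ, hF.2]; omega
    obtain ⟨j, hj⟩ := Finset.card_eq_one.mp hc
    have hjJ : j ∈ J \ F := by rw [hj]; simp
    refine ⟨j, (Finset.mem_sdiff.mp hjJ).1, ?_⟩
    rw [Finset.erase_eq, ← hj, Finset.sdiff_sdiff_eq_self hF.1]

open Classical in
lemma filter_subset_powersetCard (J : Finset (Fin n)) :
    (Finset.univ.powersetCard m).filter (fun F => F ⊆ J) = J.powersetCard m := by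
  ext F
  simp [Finset.mem_powersetCard, and_comm]

/-- The numerator of the function `K / ∏_{F ⊆ J} wall z F` of a simplex `J`. -/
def simplexConst (z : Fin n → Fin (m + 1) → ℝ) (J : Finset (Fin n)) : ℝ :=
  (∏ j ∈ J, wall z (J.erase j) (z j)) / absDet z J

open Classical in
/-- The numerator of the sum of the canonical functions of the lower simplices over the product of
all walls. -/
def wallNumerator (z : Fin n → Fin (m + 1) → ℝ) (h : Fin n → ℝ) : MvPolynomial (Fin (m + 1)) ℝ :=
  ∑ J ∈ lowerSimplices z h, MvPolynomial.C (simplexConst z J) *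
    ∏ F ∈ (Finset.univ.powersetCard m).filter (fun F => ¬ F ⊆ J), linPoly (wall z F)

open Classical in
lemma eval_wallNumerator (Y : Fin (m + 1) → ℝ) :
    MvPolynomial.eval Y (wallNumerator z h) = ∑ J ∈ lowerSimplices z h, simplexConst z J *
      ∏ F ∈ (Finset.univ.powersetCard m).filter (fun F => ¬ F ⊆ J), wall z F Y := by
  simp [wallNumerator, eval_linPoly]

/-- A simplex with `m + 1` vertices contains `m + 1` walls; each summand is a constant times the
product of the others. -/
lemma isHomogeneous_wallNumerator :
    (wallNumerator z h).IsHomogeneous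
      ((Finset.univ.powersetCard m : Finset (Finset (Fin n))).card - (m + 1)) := by
  classical
  refine MvPolynomial.IsHomogeneous.sum _ _ _ fun J hJ => ?_
  rw [mem_lowerSimplices] at hJ
  have hp := MvPolynomial.IsHomogeneous.prod
    ((Finset.univ.powersetCard m).filter (fun F => ¬ F ⊆ J)) (fun F => linPoly (wall z F))
    (fun _ => 1) (fun F _ => isHomogeneous_linPoly (wall z F))
  have hc : ((Finset.univ.powersetCard m).filter (fun F => ¬ F ⊆ J)).card =
      (Finset.univ.powersetCard m : Finset (Finset (Fin n))).card - (m + 1) := by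
    have := Finset.card_filter_add_card_filter_not (s := Finset.univ.powersetCard m)
      (fun F => F ⊆ J)
    rw [filter_subset_powersetCard, Finset.card_powersetCard, hJ.1,
      Nat.choose_succ_self_right] at this
    omega
  rw [Finset.sum_const, smul_eq_mul, mul_one, hc] at hp
  exact hp.C_mul _

lemma eval_wallNumerator_eq {Y : Fin (m + 1) → ℝ}
    (hY : ∀ F ∈ Finset.univ.powersetCard m, wall z F Y ≠ 0) :
    MvPolynomial.eval Y (wallNumerator z h) =
      (∏ F ∈ Finset.univ.powersetCard m, wall z F Y) *
        ∑ J ∈ lowerSimplices z h, simplexFunction z J Y := by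
  classical
  rw [eval_wallNumerator, Finset.mul_sum]
  refine Finset.sum_congr rfl fun J hJ => ?_
  rw [mem_lowerSimplices] at hJ
  rw [← Finset.prod_filter_mul_prod_filter_not (Finset.univ.powersetCard m) (fun F => F ⊆ J),
    filter_subset_powersetCard,
    prod_powersetCard_eq_prod_erase hJ.1, simplexConst, simplexFunction]
  simp only [coord, LinearMap.smul_apply, smul_eq_mul, Finset.prod_mul_distrib, Finset.prod_inv_distrib]
  have h1 : ∏ j ∈ J, wall z (J.erase j) Y ≠ 0 := Finset.prod_ne_zero_iff.mpr fun j hj =>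
    hY _ (Finset.mem_powersetCard.mpr ⟨Finset.subset_univ _, by
      rw [Finset.card_erase_of_mem hj, hJ.1]; rfl⟩)
  field_simp

/-- The simplices of the triangulation on either side of a wall. -/
lemma sum_sign_wall (hz : InGeneralPosition z) (hh : IsSimplicialHeight z h) {F : Finset (Fin n)}
    (hF : F.card = m) {j₀ : Fin n} (hj₀ : j₀ ∉ F) [Decidable (IsFacet z F)]
    [DecidablePred fun j => insert j F ∈ lowerSimplices z h] :
    ∑ j ∈ Fᶜ.filter (fun j => insert j F ∈ lowerSimplices z h),
      wall z F (z j) / |wall z F (z j)| = if IsFacet z F then 1 else 0 := by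
  have hcard : ∀ j ∉ F, (insert j F).card = m + 1 := fun j hj => by
    rw [Finset.card_insert_of_notMem hj, hF]
  -- The linear forms with the values `h` on `F` are the pencil `φ + t • wall z F`, and `τ i` is the
  -- parameter at which the form passes through the height at `i`. Lower simplices containing `F`
  -- are the end points of the feasible interval.
  set φ := interp z (insert j₀ F) h with hφ
  set τ : Fin n → ℝ := fun i => (h i - φ (z i)) / wall z F (z i) with hτ
  have hint : ∀ j ∉ F, interp z (insert j F) h = φ + τ j • wall z F := by
    intro j hj
    refine ext_of_eq hz (hcard j hj) fun i hi => ?_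
    rw [interp_apply hz (hcard j hj) h hi, LinearMap.add_apply, LinearMap.smul_apply, smul_eq_mul]
    rcases Finset.mem_insert.mp hi with rfl | hiF
    · rw [hτ]; dsimp only
      rw [div_mul_cancel₀ _ (wall_ne_zero hz hF hj)]; ring
    · rw [wall_eq_zero z hiF, hφ, interp_apply hz (hcard j₀ hj₀) h (Finset.mem_insert_of_mem hiF)]
      ring
  have hdiff : ∀ j ∉ F, ∀ i ∉ F, wall z F (z i) * (τ i - τ j) =
      h i - interp z (insert j F) h (z i) := by
    intro j hj i hi
    rw [hint j hj, LinearMap.add_apply, LinearMap.smul_apply, smul_eq_mul, mul_sub]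
    have : wall z F (z i) * τ i = h i - φ (z i) := by
      rw [hτ]; dsimp only
      rw [mul_div_cancel₀ _ (wall_ne_zero hz hF hi)]
    rw [this]; ring
  have hw : ∀ i ∈ Fᶜ, wall z F (z i) ≠ 0 := fun i hi =>
    wall_ne_zero hz hF (Finset.mem_compl.mp hi)
  have hTS : ∀ j, j ∈ Fᶜ.filter (fun j => insert j F ∈ lowerSimplices z h) ↔
      j ∈ Fᶜ ∧ ∀ i ∈ Fᶜ, 0 ≤ wall z F (z i) * (τ i - τ j) := by
    intro j
    rw [Finset.mem_filter]
    refine and_congr_right fun hj => ?_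
    have hj' := Finset.mem_compl.mp hj
    rw [mem_lowerSimplices]
    constructor
    · rintro ⟨-, hle⟩ i hi
      rw [hdiff j hj' i (Finset.mem_compl.mp hi)]
      linarith [hle i]
    · intro hle
      refine ⟨hcard j hj', fun i => ?_⟩
      by_cases hi : i ∈ F
      · rw [interp_apply hz (hcard j hj') h (Finset.mem_insert_of_mem hi)]
      · have := hle i (Finset.mem_compl.mpr hi)
        rw [hdiff j hj' i hi] at this
        linarith
  have hT : ∀ j ∈ Fᶜ.filter (fun j => insert j F ∈ lowerSimplices z h), ∀ i ∈ Fᶜ, i ≠ j →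
      0 < wall z F (z i) * (τ i - τ j) := by
    intro j hj i hi hne
    rw [Finset.mem_filter] at hj
    rw [hdiff j (Finset.mem_compl.mp hj.1) i (Finset.mem_compl.mp hi)]
    have := hh _ hj.2 i (by simp [hne, Finset.mem_compl.mp hi])
    linarith
  split_ifs with hfac
  · exact sum_sign_eq_one Fᶜ _ (fun i => wall z F (z i)) τ
      (fun i hi => lt_of_le_of_ne (hfac i) (hw i hi).symm) hTS hT ⟨j₀, by simpa using hj₀⟩
  · obtain ⟨⟨p, hp⟩, q, hq⟩ := exists_pos_neg_of_not_isFacet hfac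
    refine sum_sign_eq_zero Fᶜ _ (fun i => wall z F (z i)) τ hw hTS hT
      ⟨p, ?_, hp⟩ ⟨q, ?_, hq⟩
    · rw [Finset.mem_compl, ← wall_eq_zero_iff hz hF]; exact hp.ne'
    · rw [Finset.mem_compl, ← wall_eq_zero_iff hz hF]; exact hq.ne

/-- A vector of the hyperplane is a combination of the `z i`, `i ∈ F`, alone, whatever vector
completes them to a basis. This is why the residues of all simplices along a common wall agree up to
sign. -/
lemma coord_insert_eq (hz : InGeneralPosition z) {F : Finset (Fin n)} (hF : F.card = m)
    {j j₀ : Fin n} (hj : j ∉ F) (hj₀ : j₀ ∉ F) {w : Fin (m + 1) → ℝ} (hw : wall z F w = 0)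
    {i : Fin n} (hi : i ∈ F) : coord z (insert j F) i w = coord z (insert j₀ F) i w := by
  have hcard : ∀ j ∉ F, (insert j F).card = m + 1 := fun j hj => by
    rw [Finset.card_insert_of_notMem hj, hF]
  conv_rhs => rw [eq_sum_coord hz (hcard j hj) w]
  rw [Finset.sum_insert hj]
  have : coord z (insert j F) j w = 0 := by
    rw [coord, Finset.erase_insert hj, LinearMap.smul_apply, hw, smul_zero]
  rw [this, zero_smul, zero_add, map_sum]
  rw [Finset.sum_congr rfl fun k hk => by
    rw [map_smul, coord_apply_self hz (hcard j₀ hj₀) (Finset.mem_insert_of_mem hi)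
      (Finset.mem_insert_of_mem hk)]]
  simp [hi]

-- On `wall z F = 0` only the simplices `insert j F` survive. Their terms differ by the sign of
-- `wall z F (z j)`, which remains because `simplexConst` divides a signed product by an absolute
-- determinant; `sum_sign_wall` adds the signs. The denominators are cleared so that the identity
-- holds on the whole hyperplane.
open Classical in
lemma eval_wallNumerator_residue (hz : InGeneralPosition z) (hh : IsSimplicialHeight z h)
    {F : Finset (Fin n)} (hF : F.card = m) {j₀ : Fin n} (hj₀ : j₀ ∉ F) {w : Fin (m + 1) → ℝ}
    (hw : wall z F w = 0) :
    MvPolynomial.eval w (wallNumerator z h) * ∏ i ∈ F, coord z (insert j₀ F) i w =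
      (if IsFacet z F then 1 else 0) * ∏ F' ∈ (Finset.univ.powersetCard m).erase F, wall z F' w := by
  have hFW : F ∈ (Finset.univ : Finset (Fin n)).powersetCard m :=
    Finset.mem_powersetCard.mpr ⟨Finset.subset_univ _, hF⟩
  rw [← sum_sign_wall hz hh hF hj₀, eval_wallNumerator, Finset.sum_mul, Finset.sum_mul]
  have himg : (lowerSimplices z h).filter (fun J => F ⊆ J) =
      (Fᶜ.filter (fun j => insert j F ∈ lowerSimplices z h)).image (fun j => insert j F) := by
    ext J
    simp only [Finset.mem_filter, Finset.mem_image, Finset.mem_compl]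
    constructor
    · rintro ⟨hJ, hFJ⟩
      have hc : (J \ F).card = 1 := by
        rw [Finset.card_sdiff_of_subset hFJ, (mem_lowerSimplices.mp hJ).1, hF]; omega
      obtain ⟨j, hj⟩ := Finset.card_eq_one.mp hc
      have hjJ : j ∈ J \ F := by rw [hj]; simp
      have e : insert j F = J := by
        rw [Finset.insert_eq, ← hj, Finset.sdiff_union_of_subset hFJ]
      exact ⟨j, ⟨(Finset.mem_sdiff.mp hjJ).2, e ▸ hJ⟩, e⟩
    · rintro ⟨j, ⟨-, hj⟩, rfl⟩
      exact ⟨hj, Finset.subset_insert _ _⟩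
  rw [← Finset.sum_subset (Finset.filter_subset (fun J => F ⊆ J) (lowerSimplices z h)), himg,
    Finset.sum_image]
  · refine Finset.sum_congr rfl fun j hj => ?_
    rw [Finset.mem_filter, Finset.mem_compl] at hj
    have hJ : (insert j F).card = m + 1 := by rw [Finset.card_insert_of_notMem hj.1, hF]
    have h1 : ∏ i ∈ F, coord z (insert j₀ F) i w = ∏ i ∈ F, coord z (insert j F) i w :=
      Finset.prod_congr rfl fun i hi => (coord_insert_eq hz hF hj.1 hj₀ hw hi).symm
    have h2 : ∏ F' ∈ (Finset.univ.powersetCard m).erase F, wall z F' w =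
        (∏ i ∈ F, wall z ((insert j F).erase i) w) *
        ∏ F' ∈ (Finset.univ.powersetCard m).filter (fun F' => ¬ F' ⊆ insert j F), wall z F' w := by
      have e1 : ((Finset.univ.powersetCard m).erase F).filter (fun F' => F' ⊆ insert j F) =
          F.image (fun i => (insert j F).erase i) := by
        ext G
        simp only [Finset.mem_filter, Finset.mem_erase, Finset.mem_powersetCard, Finset.mem_image,
          Finset.subset_univ, true_and]
        constructor
        · rintro ⟨⟨hne, hG⟩, hsub⟩
          have hc : (insert j F \ G).card = 1 := by
            rw [Finset.card_sdiff_of_subset hsub, hJ, hG]; omega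
          obtain ⟨i, hi⟩ := Finset.card_eq_one.mp hc
          have e : (insert j F).erase i = G := by
            rw [Finset.erase_eq, ← hi, Finset.sdiff_sdiff_eq_self hsub]
          have hiJ : i ∈ insert j F \ G := by rw [hi]; simp
          rcases Finset.mem_insert.mp (Finset.mem_sdiff.mp hiJ).1 with rfl | hiF
          · exact absurd (by rw [← e, Finset.erase_insert hj.1]) hne
          · exact ⟨i, hiF, e⟩
        · rintro ⟨i, hi, rfl⟩
          refine ⟨⟨fun e => ?_, ?_⟩, Finset.erase_subset _ _⟩
          · rw [← e] at hi; simp at hi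
          · rw [Finset.card_erase_of_mem (Finset.mem_insert_of_mem hi), hJ]; rfl
      have e2 : ((Finset.univ.powersetCard m).erase F).filter (fun F' => ¬ F' ⊆ insert j F) =
          (Finset.univ.powersetCard m).filter (fun F' => ¬ F' ⊆ insert j F) := by
        ext G
        simp only [Finset.mem_filter, Finset.mem_erase]
        constructor
        · rintro ⟨⟨-, h1⟩, h2⟩; exact ⟨h1, h2⟩
        · rintro ⟨h1, h2⟩
          exact ⟨⟨fun e => h2 (e ▸ Finset.subset_insert _ _), h1⟩, h2⟩
      rw [← Finset.prod_filter_mul_prod_filter_not _ (fun F' => F' ⊆ insert j F), e1, e2,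
        Finset.prod_image]
      intro i hi k _ e
      exact (Finset.erase_inj _ (Finset.mem_insert_of_mem hi)).mp e
    have h3 : ∏ i ∈ F, wall z ((insert j F).erase i) (z i) ≠ 0 :=
      Finset.prod_ne_zero_iff.mpr fun i hi => wall_ne_zero hz (by
        rw [Finset.card_erase_of_mem (Finset.mem_insert_of_mem hi), hJ]; rfl)
        (Finset.notMem_erase i _)
    rw [h1, h2, abs_wall_eq_absDet z hF hj.1, simplexConst, Finset.prod_insert hj.1,
      Finset.erase_insert hj.1]
    simp only [coord, LinearMap.smul_apply, smul_eq_mul, Finset.prod_mul_distrib,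
      Finset.prod_inv_distrib]
    field_simp
  · intro i hi k hk e
    simp only [Finset.coe_filter, Finset.mem_compl, Set.mem_ofPred_eq] at hi
    exact (Finset.insert_inj hi.1).mp e
  · intro J hJ hJ'
    have hFJ : ¬ F ⊆ J := fun hs => hJ' (Finset.mem_filter.mpr ⟨hJ, hs⟩)
    rw [Finset.prod_eq_zero (i := F) (Finset.mem_filter.mpr ⟨hFW, hFJ⟩) hw, mul_zero, zero_mul]

end triangulationSum

/-! ### Facets of the polytope and the numerator of its canonical function -/

section polytope

variable {m n : ℕ} {z : Fin n → Fin (m + 1) → ℝ} {h : Fin n → ℝ}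

open Classical in
/-- The vertex sets of the facets. -/
def facets (z : Fin n → Fin (m + 1) → ℝ) : Finset (Finset (Fin n)) :=
  (Finset.univ.powersetCard m).filter fun F => IsFacet z F

lemma mem_facets {F : Finset (Fin n)} : F ∈ facets z ↔ F.card = m ∧ IsFacet z F := by
  simp [facets, Finset.mem_powersetCard]

lemma exists_wall_eq_zero_ne_zero (hz : InGeneralPosition z) {F F' : Finset (Fin n)}
    (hF : F.card = m) (hF' : F'.card = m) (hne : F' ≠ F) :
    ∃ w, wall z F w = 0 ∧ wall z F' w ≠ 0 := by
  obtain ⟨i, hi, hi'⟩ : ∃ i ∈ F, i ∉ F' := by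
    by_contra! hcon
    exact hne (Finset.eq_of_subset_of_card_le hcon (by rw [hF, hF'])).symm
  exact ⟨z i, wall_eq_zero z hi, wall_ne_zero hz hF' hi'⟩

lemma wall_form_ne_zero (hz : InGeneralPosition z) (hmn : m < n) {F : Finset (Fin n)}
    (hF : F.card = m) : wall z F ≠ 0 := by
  obtain ⟨i, -, hi⟩ := Finset.exists_mem_notMem_of_card_lt_card
    (s := F) (t := Finset.univ) (by simpa [hF] using hmn)
  intro e
  exact wall_ne_zero hz hF hi (by rw [e]; rfl)

/-- The numerator of the canonical function over the product of the facet forms. -/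
lemma exists_numerator (hz : InGeneralPosition z) (hmn : m < n) (hh : IsSimplicialHeight z h)
    (hfac : (facets z).Nonempty) :
    ∃ (p : MvPolynomial (Fin (m + 1)) ℝ) (k : ℕ), k + (m + 1) = (facets z).card ∧
      p.IsHomogeneous k ∧
      (∀ Y, (∀ F : Finset (Fin n), F.card = m → wall z F Y ≠ 0) →
        MvPolynomial.eval Y p / ∏ F ∈ facets z, wall z F Y =
          ∑ J ∈ lowerSimplices z h, simplexFunction z J Y) ∧
      ∀ F ∈ facets z, ∀ j₀ ∉ F, ∀ w, wall z F w = 0 →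
        MvPolynomial.eval w p * ∏ i ∈ F, coord z (insert j₀ F) i w =
          ∏ F' ∈ (facets z).erase F, wall z F' w := by
  classical
  set W : Finset (Finset (Fin n)) := Finset.univ.powersetCard m with hWdef
  have hW : ∀ F, F ∈ W ↔ F.card = m := fun F => by simp [hWdef, Finset.mem_powersetCard]
  set A := W.filter fun F => ¬ IsFacet z F with hA
  have hAW : ∀ F ∈ A, F.card = m := fun F hF => (hW F).mp (Finset.mem_filter.mp hF).1
  have hfW : ∀ F ∈ facets z, F.card = m := fun F hF => (mem_facets.mp hF).1
  have hsplit : ∀ g : Finset (Fin n) → ℝ, (∏ F ∈ facets z, g F) * ∏ F ∈ A, g F = ∏ F ∈ W, g F :=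
    fun g => Finset.prod_filter_mul_prod_filter_not W (fun F => IsFacet z F) g
  have hcoord : ∀ (F : Finset (Fin n)), F.card = m → ∀ j₀ ∉ F, ∀ i ∈ F,
      ∃ w, wall z F w = 0 ∧ coord z (insert j₀ F) i w ≠ 0 := fun F hF j₀ hj₀ i hi =>
    ⟨z i, wall_eq_zero z hi, by
      rw [coord_apply_self hz (by rw [Finset.card_insert_of_notMem hj₀, hF])
        (Finset.mem_insert_of_mem hi) (Finset.mem_insert_of_mem hi)]; simp⟩
  have hout : ∀ F : Finset (Fin n), F.card = m → ∃ j₀, j₀ ∉ F := fun F hF => by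
    obtain ⟨i, -, hi⟩ := Finset.exists_mem_notMem_of_card_lt_card
      (s := F) (t := Finset.univ) (by simpa [hF] using hmn)
    exact ⟨i, hi⟩
  set P := wallNumerator z h with hPdef
  -- Along a wall that is not a facet the signs cancel, so `P` vanishes there wherever the
  -- coordinates on `F` do not, and `linPoly_dvd` tolerates those exceptions.
  have hdvd : ∏ F ∈ A, linPoly (wall z F) ∣ P := by
    refine prod_linPoly_dvd A _ (fun F hF => wall_form_ne_zero hz hmn (hAW F hF))
      (fun F hF F' hF' hne => exists_wall_eq_zero_ne_zero hz (hAW F hF) (hAW F' hF') hne) ?_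
    intro F hF
    obtain ⟨j₀, hj₀⟩ := hout F (hAW F hF)
    refine linPoly_dvd (wall_form_ne_zero hz hmn (hAW F hF)) F
      (fun i => coord z (insert j₀ F) i) (hcoord F (hAW F hF) j₀ hj₀) fun w hw hne => ?_
    have hres := eval_wallNumerator_residue hz hh (hAW F hF) hj₀ hw
    rw [if_neg (Finset.mem_filter.mp hF).2, zero_mul] at hres
    exact (mul_eq_zero.mp hres).resolve_right (Finset.prod_ne_zero_iff.mpr hne)
  obtain ⟨p, hp⟩ := hdvd
  have hPeval : ∀ Y, MvPolynomial.eval Y P = (∏ F ∈ A, wall z F Y) * MvPolynomial.eval Y p := by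
    intro Y
    rw [hp, map_mul, map_prod]
    simp only [eval_linPoly]
  -- The residue identity for `P` can be divided by the walls in `A` only where they do not vanish;
  -- divisibility by `linPoly (wall z F)` extends the result to the whole hyperplane.
  have hresp : ∀ F ∈ facets z, ∀ j₀ ∉ F, ∀ w, wall z F w = 0 →
        MvPolynomial.eval w p * ∏ i ∈ F, coord z (insert j₀ F) i w =
          ∏ F' ∈ (facets z).erase F, wall z F' w := by
    intro F hF j₀ hj₀ w hw
    have hd : linPoly (wall z F) ∣ p * ∏ i ∈ F, linPoly (coord z (insert j₀ F) i) -
        ∏ F' ∈ (facets z).erase F, linPoly (wall z F') := by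
      refine linPoly_dvd (wall_form_ne_zero hz hmn (hfW F hF)) A (wall z) ?_ ?_
      · intro F' hF'
        refine exists_wall_eq_zero_ne_zero hz (hfW F hF) (hAW F' hF') ?_
        rintro rfl
        exact (Finset.mem_filter.mp hF').2 (mem_facets.mp hF).2
      · intro w hw hne
        have hA0 : ∏ F' ∈ A, wall z F' w ≠ 0 := Finset.prod_ne_zero_iff.mpr hne
        have hres := eval_wallNumerator_residue hz hh (hfW F hF) hj₀ hw
        rw [if_pos (mem_facets.mp hF).2, one_mul, ← hPdef, hPeval] at hres
        have e : (∏ F' ∈ (facets z).erase F, wall z F' w) * ∏ F' ∈ A, wall z F' w =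
            ∏ F' ∈ W.erase F, wall z F' w := by
          have h1 : (W.erase F).filter (fun F => IsFacet z F) = (facets z).erase F :=
            Finset.filter_erase _ _ _
          have h2 : (W.erase F).filter (fun F => ¬ IsFacet z F) = A := by
            rw [Finset.filter_erase, Finset.erase_eq_of_notMem]
            exact fun hFA => (Finset.mem_filter.mp hFA).2 (mem_facets.mp hF).2
          rw [← h1, ← h2]
          exact Finset.prod_filter_mul_prod_filter_not _ _ _
        rw [← e] at hres
        simp only [map_sub, map_mul, map_prod, eval_linPoly]
        refine mul_right_cancel₀ hA0 ?_
        linear_combination hres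
    obtain ⟨R, hR⟩ := hd
    have := congrArg (MvPolynomial.eval w) hR
    simp only [map_sub, map_mul, map_prod, eval_linPoly, hw, zero_mul, sub_eq_zero] at this
    exact this
  -- The degree of the quotient can only be read off if `P ≠ 0`. At a point of one facet hyperplane
  -- that lies on no other wall, the residue is not zero.
  have hP0 : P ≠ 0 := by
    obtain ⟨F, hF⟩ := hfac
    obtain ⟨j₀, hj₀⟩ := hout F (hfW F hF)
    obtain ⟨w, hw, hne⟩ := Module.Dual.exists_forall_mem_ne_zero_of_forall_exists
      (LinearMap.ker (wall z F)) (fun F' : W.erase F => (wall z F' : Module.Dual ℝ _))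
      (fun F' => exists_wall_eq_zero_ne_zero hz (hfW F hF)
        ((hW _).mp (Finset.mem_of_mem_erase F'.2)) (Finset.ne_of_mem_erase F'.2))
    intro e
    have hres := eval_wallNumerator_residue hz hh (hfW F hF) hj₀ hw
    rw [if_pos (mem_facets.mp hF).2, one_mul, ← hPdef, e, map_zero, zero_mul] at hres
    exact Finset.prod_ne_zero_iff.mpr (fun F' hF' => hne ⟨F', hF'⟩) hres.symm
  have hcardsum : (facets z).card + A.card = W.card :=
    Finset.card_filter_add_card_filter_not (s := W) (fun F => IsFacet z F)
  -- The natural subtraction in the degree of `P` is therefore not truncated.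
  have hmW : m + 1 ≤ W.card := by
    rw [hWdef, Finset.card_powersetCard, Finset.card_univ, Fintype.card_fin]
    calc m + 1 = (m + 1).choose m := (Nat.choose_succ_self_right m).symm
      _ ≤ n.choose m := Nat.choose_le_choose m hmn
  have hAhom := MvPolynomial.IsHomogeneous.prod A (fun F => linPoly (wall z F)) (fun _ => 1)
    (fun F _ => isHomogeneous_linPoly (wall z F))
  rw [Finset.sum_const, smul_eq_mul, mul_one] at hAhom
  obtain ⟨k, hk, hpk⟩ := exists_isHomogeneous_of_mul hP0 isHomogeneous_wallNumerator hAhom hp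
  rw [← hWdef] at hk
  refine ⟨p, k, by omega, hpk, fun Y hY => ?_, hresp⟩
  have hY' : ∀ F ∈ W, wall z F Y ≠ 0 := fun F hF => hY F ((hW F).mp hF)
  have h1 := eval_wallNumerator_eq (h := h) hY'
  rw [← hPdef, hPeval, ← hsplit] at h1
  have hA0 : ∏ F ∈ A, wall z F Y ≠ 0 := Finset.prod_ne_zero_iff.mpr fun F hF =>
    hY F (hAW F hF)
  have hf0 : ∏ F ∈ facets z, wall z F Y ≠ 0 := Finset.prod_ne_zero_iff.mpr fun F hF =>
    hY F (hfW F hF)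
  rw [div_eq_iff hf0]
  refine mul_left_cancel₀ hA0 ?_
  linear_combination h1

/-- In general position up to `m + 1` vectors are independent and more span everything, so a face of
dimension `m` has exactly `m` generators: the facets are simplices. -/
lemma finrank_span_posCone (hz : InGeneralPosition z) (hmn : m < n) (S : Finset (Fin n))
    (hS : Module.finrank ℝ (Submodule.span ℝ (posCone z S)) = m) : S.card = m := by
  rw [span_posCone] at hS
  by_cases hle : S.card ≤ m + 1
  · obtain ⟨J, hSJ, -, hJ⟩ := Finset.exists_subsuperset_card_eq (n := m + 1)
      (Finset.subset_univ S) hle (by simpa using hmn)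
    rwa [finrank_span_image ((hz J hJ).mono (by exact_mod_cast hSJ))] at hS
  · exfalso
    obtain ⟨J, hJS, hJ⟩ := Finset.exists_subset_card_eq (n := m + 1) (s := S) (by omega)
    have h1 : Submodule.span ℝ (z '' S) = ⊤ := by
      rw [eq_top_iff, ← span_eq_top hz hJ]
      exact Submodule.span_mono (Set.image_mono (by exact_mod_cast hJS))
    rw [h1, finrank_top] at hS
    simp at hS

lemma posCone_facet (hz : InGeneralPosition z) {F : Finset (Fin n)} (hF : F ∈ facets z) :
    {x ∈ posCone z Finset.univ | wall z F x = 0} = posCone z F := by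
  classical
  rw [mem_facets] at hF
  rw [posCone_face z _ _ fun i _ => hF.2 i]
  congr 1
  ext i
  simp [wall_eq_zero_iff hz hF.1]

-- A facet form vanishes on exactly `m` of the vectors and is thus a nonzero multiple of their wall.
-- A wall with values of both signs would make the form change sign on `C`, so the wall is one of a
-- facet.
open Classical in
lemma isFacetSystem_facets (hz : InGeneralPosition z) (hmn : m < n) :
    IsFacetSystem m (posCone z Finset.univ) ((facets z).image (wall z)) := by
  have hinj : ∀ F F', F ∈ facets z → F' ∈ facets z →
      posCone z F = posCone z F' → F = F' := by
    intro F F' hF hF' e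
    have key : ∀ F F', F ∈ facets z → F' ∈ facets z → posCone z F = posCone z F' → F ⊆ F' := by
      intro F F' hF hF' e i hi
      have : z i ∈ posCone z F' := e ▸ mem_posCone_of_mem z hi
      rw [← posCone_facet hz hF'] at this
      exact (wall_eq_zero_iff hz (mem_facets.mp hF').1).mp this.2
    exact Finset.Subset.antisymm (key F F' hF hF' e) (key F' F hF' hF e.symm)
  refine ⟨?_, ?_⟩
  · intro l hl
    obtain ⟨F, hF, rfl⟩ := Finset.mem_image.mp hl
    have hF' := mem_facets.mp hF
    obtain ⟨i, -, hi⟩ := Finset.exists_mem_notMem_of_card_lt_card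
      (s := F) (t := Finset.univ) (by simpa [hF'.1] using hmn)
    refine ⟨fun x hx => nonneg_of_mem_posCone (fun i _ => hF'.2 i) hx,
      ⟨z i, mem_posCone_of_mem z (Finset.mem_univ _), wall_ne_zero hz hF'.1 hi⟩, ?_⟩
    rw [posCone_facet hz hF, span_posCone]
    obtain ⟨J, hFJ, hJ⟩ : ∃ J : Finset (Fin n), F ⊆ J ∧ J.card = m + 1 :=
      ⟨insert i F, Finset.subset_insert _ _, by rw [Finset.card_insert_of_notMem hi, hF'.1]⟩
    rw [finrank_span_image ((hz J hJ).mono (by exact_mod_cast hFJ)), hF'.1]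
  · intro l hl
    have h1 : ∀ i ∈ Finset.univ, 0 ≤ l (z i) := fun i hi => hl.1 _ (mem_posCone_of_mem z hi)
    have h2 := hl.2.2
    rw [posCone_face z _ _ h1] at h2
    have h3 := finrank_span_posCone hz hmn _ h2
    set F := Finset.univ.filter fun i => l (z i) = 0 with hFdef
    obtain ⟨j, -, hj⟩ := Finset.exists_mem_notMem_of_card_lt_card
      (s := F) (t := Finset.univ) (by simpa [h3] using hmn)
    have hprop : l = (l (z j) / wall z F (z j)) • wall z F := by
      refine ext_of_eq hz (J := insert j F) (by rw [Finset.card_insert_of_notMem hj, h3])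
        fun i hi => ?_
      rw [LinearMap.smul_apply, smul_eq_mul]
      rcases Finset.mem_insert.mp hi with rfl | hi
      · rw [div_mul_cancel₀ _ (wall_ne_zero hz h3 hj)]
      · rw [wall_eq_zero z hi, mul_zero]
        exact (Finset.mem_filter.mp hi).2
    have hF : F ∈ facets z := by
      rw [mem_facets]
      refine ⟨h3, ?_⟩
      by_contra hcon
      obtain ⟨⟨a, ha⟩, b, hb⟩ := exists_pos_neg_of_not_isFacet hcon
      have hc : l (z j) / wall z F (z j) ≠ 0 := by
        refine div_ne_zero (fun e => hj ?_) (wall_ne_zero hz h3 hj)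
        simp [hFdef, e]
      have ha' := h1 a (Finset.mem_univ _)
      have hb' := h1 b (Finset.mem_univ _)
      rw [hprop, LinearMap.smul_apply, smul_eq_mul] at ha' hb'
      exact hc (le_antisymm (by nlinarith) (by nlinarith))
    have hface : {x ∈ posCone z Finset.univ | l x = 0} = posCone z F := posCone_face z _ _ h1
    refine ⟨wall z F, ⟨Finset.mem_image_of_mem _ hF, by rw [hface, posCone_facet hz hF]⟩, ?_⟩
    rintro l' ⟨hl', e⟩
    obtain ⟨F', hF', rfl⟩ := Finset.mem_image.mp hl'
    rw [hface, posCone_facet hz hF'] at e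
    rw [hinj F' F hF' hF e]

lemma wall_injOn (hz : InGeneralPosition z) : Set.InjOn (wall z) (facets z) := by
  intro F hF F' hF' e
  ext i
  rw [← wall_eq_zero_iff hz (mem_facets.mp hF).1, ← wall_eq_zero_iff hz (mem_facets.mp hF').1, e]

lemma span_posCone_univ_eq_top (hz : InGeneralPosition z) (hmn : m < n) :
    Submodule.span ℝ (posCone z Finset.univ) = ⊤ := by
  obtain ⟨J, -, hJ⟩ := Finset.exists_subset_card_eq (n := m + 1)
    (s := (Finset.univ : Finset (Fin n))) (by simpa using hmn)
  rw [span_posCone, eq_top_iff, ← span_eq_top hz hJ]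
  exact Submodule.span_mono (Set.image_mono (by simp))

end polytope

/-! ### Existence of canonical functions -/

section canonical

/-- The map `Fin (m + 1) → Fin n` enumerating a set of `m + 1` labels. -/
lemma posCone_enum {k n : ℕ} {κ : Type*} (z : Fin n → κ → ℝ) {J : Finset (Fin n)}
    (hJ : J.card = k) :
    posCone (z ∘ J.orderEmbOfFin hJ) Finset.univ = posCone z J := by
  have := posCone_comp z (J.orderEmbOfFin hJ).toEmbedding Finset.univ
  rw [Finset.map_orderEmbOfFin_univ] at this
  exact this

lemma isCanonicalFunction_simplexFunction {m n : ℕ} {z : Fin n → Fin (m + 1) → ℝ}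
    (hz : InGeneralPosition z) {J : Finset (Fin n)} (hJ : J.card = m + 1) :
    IsCanonicalFunction m (posCone z J) (detForm m) (simplexFunction z J) := by
  rw [← posCone_enum z hJ]
  have hdet := abs_detForm_comp z (J.orderEmbOfFin hJ).injective
    (fun i => J.orderEmbOfFin_mem hJ i) hJ
  refine isCanonicalFunction_simplex m _ (fun i => coord z J (J.orderEmbOfFin hJ i)) ?_ _ ?_ _ ?_
  · intro i j
    rw [Function.comp_apply, coord_apply_self hz hJ (J.orderEmbOfFin_mem hJ i)
      (J.orderEmbOfFin_mem hJ j)]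
    simp
  · rw [← abs_pos, hdet]; exact absDet_pos hz hJ
  · intro Y _
    rw [hdet, simplexFunction, ← Finset.prod_coe_sort J,
      ← (J.orderIsoOfFin hJ).toEquiv.prod_comp]
    rfl

lemma existsUnique_of_span_eq_top {N d : ℕ} {C : Set (Fin N → ℝ)}
    {ν : (Fin N → ℝ) [⋀^Fin (d + 1)]→ₗ[ℝ] ℝ} (hC : Submodule.span ℝ C = ⊤)
    {f : (Fin N → ℝ) → ℝ} (hf : IsCanonicalFunction d C ν f) :
    ∃! f, IsCanonicalFunction d C ν f :=
  ⟨f, hf, fun g hg => funext fun Y => hg.eqOn hf (by rw [hC]; trivial)⟩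

lemma canonicalFunction_eq {m : ℕ} {C : Set (Fin (m + 1) → ℝ)} (hC : Submodule.span ℝ C = ⊤)
    {f : (Fin (m + 1) → ℝ) → ℝ} (hf : IsCanonicalFunction m C (detForm m) f) :
    canonicalFunction C = f := by
  have h : ∃ f, IsCanonicalFunction m C (detForm m) f := ⟨f, hf⟩
  rw [canonicalFunction, dif_pos h]
  exact funext fun Y => h.choose_spec.eqOn hf (by rw [hC]; trivial)

/-- The canonical function of a polytope with vertices in general position, in dimension at least
`1`, is the sum of the canonical functions of the simplices of a regular triangulation. -/
lemma exists_isCanonicalFunction_polytope {m n : ℕ} {z : Fin n → Fin (m + 2) → ℝ}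
    (hz : InGeneralPosition z) (hmn : m + 1 < n) (hfac : (facets z).Nonempty) {h : Fin n → ℝ}
    (hh : IsSimplicialHeight z h) :
    ∃ f, IsCanonicalFunction (m + 1) (posCone z Finset.univ) (detForm (m + 1)) f ∧
      ∀ Y, (∀ F : Finset (Fin n), F.card = m + 1 → wall z F Y ≠ 0) →
        f Y = ∑ J ∈ lowerSimplices z h, simplexFunction z J Y := by
  classical
  obtain ⟨p, k, hk, hpk, hsum, hres⟩ := exists_numerator hz hmn hh hfac
  have hinj := wall_injOn hz
  refine ⟨fun Y => MvPolynomial.eval Y p / ∏ F ∈ facets z, wall z F Y, ⟨(facets z).image (wall z),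
    p, ⟨?_, isFacetSystem_facets hz hmn, ⟨k, ?_, hpk⟩, ?_⟩, ?_⟩, hsum⟩
  · rw [span_posCone_univ_eq_top hz hmn, finrank_top]; simp
  · rw [Finset.card_image_of_injOn hinj, hk]
  · intro Y _
    rw [Finset.prod_image hinj]
  · intro l hl u _ hlu
    obtain ⟨F, hF, rfl⟩ := Finset.mem_image.mp hl
    have hF' := mem_facets.mp hF
    obtain ⟨j₀, -, hj₀⟩ := Finset.exists_mem_notMem_of_card_lt_card
      (s := F) (t := Finset.univ) (by simpa [hF'.1] using hmn)
    have hJ : (insert j₀ F).card = m + 1 + 1 := by rw [Finset.card_insert_of_notMem hj₀, hF'.1]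
    -- The normalisation `wall z F u = 1` makes the volume of the generators of the simplicial facet
    -- equal to `1`, so its canonical function is the inverse product of the coordinates on `F`.
    have hdet : |(detForm (m + 1)).curryLeft u (z ∘ F.orderEmbOfFin hF'.1)| = 1 := by
      rw [← abs_wall z hF'.1, hlu, abs_one]
    refine ⟨fun w => (∏ i, coord z (insert j₀ F) (F.orderEmbOfFin hF'.1 i) w)⁻¹, ?_, ?_⟩
    · rw [posCone_facet hz hF, ← posCone_enum z hF'.1]
      refine isCanonicalFunction_simplex m _
        (fun i => coord z (insert j₀ F) (F.orderEmbOfFin hF'.1 i)) ?_ _ ?_ _ ?_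
      · intro i j
        rw [Function.comp_apply, coord_apply_self hz hJ
          (Finset.mem_insert_of_mem (F.orderEmbOfFin_mem hF'.1 i))
          (Finset.mem_insert_of_mem (F.orderEmbOfFin_mem hF'.1 j))]
        simp
      · rw [← abs_ne_zero, hdet]; norm_num
      · intro Y _
        rw [hdet, one_mul]
    · intro w _ hw hne
      have herase : ((facets z).image (wall z)).erase (wall z F) =
          ((facets z).erase F).image (wall z) := by
        ext l
        simp only [Finset.mem_erase, Finset.mem_image]
        constructor
        · rintro ⟨h1, G, hG, rfl⟩
          exact ⟨G, ⟨fun e => h1 (e ▸ rfl), hG⟩, rfl⟩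
        · rintro ⟨G, ⟨h1, hG⟩, rfl⟩
          exact ⟨fun e => h1 (hinj hG hF e), G, hG, rfl⟩
      have hprod : ∏ l' ∈ ((facets z).image (wall z)).erase (wall z F), l' w =
          ∏ F' ∈ (facets z).erase F, wall z F' w := by
        rw [herase, Finset.prod_image (hinj.mono (Finset.erase_subset _ _))]
      rw [hprod] at hne ⊢
      have h1 := hres F hF j₀ hj₀ w hw
      have h2 : ∏ i, coord z (insert j₀ F) (F.orderEmbOfFin hF'.1 i) w =
          ∏ i ∈ F, coord z (insert j₀ F) i w := by
        rw [← Finset.prod_coe_sort F, ← (F.orderIsoOfFin hF'.1).toEquiv.prod_comp]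
        rfl
      dsimp only
      rw [h2]
      rw [← h1] at hne ⊢
      have h3 := left_ne_zero_of_mul hne
      have h4 := right_ne_zero_of_mul hne
      field_simp

/-- The first `m` columns followed by any later column are in increasing order, so the corresponding
minors are all positive and the remaining columns lie on one side. -/
lemma IsTotallyPositive.facets_nonempty {m n : ℕ} {Z : Matrix (Fin (m + 1)) (Fin n) ℝ}
    (hZ : IsTotallyPositive Z) (hmn : m < n) : (facets Z.col).Nonempty := by
  classical
  set e : Fin m ↪o Fin n := Fin.castLEOrderEmb hmn.le with he
  set F : Finset (Fin n) := Finset.univ.map e.toEmbedding with hFdef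
  have hF : F.card = m := by simp [hFdef]
  have hmem : ∀ i : Fin n, i ∈ F ↔ (i : ℕ) < m := by
    intro i
    simp only [hFdef, Finset.mem_map, Finset.mem_univ, true_and, he]
    constructor
    · rintro ⟨j, rfl⟩; exact j.2
    · intro hi; exact ⟨⟨i, hi⟩, rfl⟩
  have hez : Z.col ∘ F.orderEmbOfFin hF = Z.col ∘ e := by
    congr 1
    refine (Finset.orderEmbOfFin_unique hF (fun x => by simp [hFdef]) e.strictMono).symm
  -- The sign comes from moving the column `i` from the first place, where `consForm` puts it, to
  -- the last.
  have hsign : ∀ i ∉ F, 0 < (-1) ^ m * consForm (detForm m) (Z.col ∘ e) (Z.col i) := by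
    intro i hi
    rw [hmem] at hi
    have hmono : StrictMono (Fin.snoc (α := fun _ => Fin n) e i) := by
      intro a b hab
      induction b using Fin.lastCases with
      | last =>
        obtain ⟨a, rfl⟩ := Fin.exists_castSucc_eq.mpr hab.ne
        rw [Fin.snoc_castSucc, Fin.snoc_last, Fin.lt_def]
        exact lt_of_lt_of_le a.2 (not_lt.mp hi)
      | cast b =>
        obtain ⟨a, rfl⟩ := Fin.exists_castSucc_eq.mpr (hab.trans (Fin.castSucc_lt_last b)).ne
        rw [Fin.snoc_castSucc, Fin.snoc_castSucc]
        exact e.strictMono (by simpa using hab)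
    have h := hZ (OrderEmbedding.ofStrictMono _ hmono)
    have hdet : (Z.submatrix id (OrderEmbedding.ofStrictMono _ hmono)).det =
        detForm m (Z.col ∘ (Fin.snoc (α := fun _ => Fin n) e i)) := by
      rw [detForm, Pi.basisFun_det_apply, ← Matrix.det_transpose]
      rfl
    have hcons : (Matrix.vecCons (Z.col i) (Z.col ∘ e) : Fin (m + 1) → Fin (m + 1) → ℝ) =
        (Z.col ∘ (Fin.snoc (α := fun _ => Fin n) e i)) ∘ (Fin.last m).cycleRange.symm := by
      funext k
      refine Fin.cases ?_ (fun k => ?_) k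
      · simp only [Matrix.cons_val_zero, Function.comp_apply, Fin.cycleRange_symm_zero,
          Fin.snoc_last]
      · simp only [Matrix.cons_val_succ, Function.comp_apply, Fin.cycleRange_symm_succ,
          Fin.succAbove_last, Fin.snoc_castSucc]
    rw [consForm_apply, AlternatingMap.curryLeft_apply_apply, hcons, AlternatingMap.map_perm,
      Equiv.Perm.sign_symm, Fin.sign_cycleRange, ← hdet]
    rw [Units.smul_def, Fin.val_last]
    simp only [Units.val_pow_eq_pow_val, Units.val_neg, Units.val_one, zsmul_eq_mul, Int.cast_pow,
      Int.cast_neg, Int.cast_one]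
    rw [← mul_assoc, ← mul_pow]
    simpa using h
  refine ⟨F, mem_facets.mpr ⟨hF, ?_⟩⟩
  by_contra hcon
  obtain ⟨⟨a, ha⟩, b, hb⟩ := exists_pos_neg_of_not_isFacet hcon
  have haF : a ∉ F := fun h => by rw [wall_eq_zero _ h] at ha; exact lt_irrefl _ ha
  have hbF : b ∉ F := fun h => by rw [wall_eq_zero _ h] at hb; exact lt_irrefl _ hb
  have h1 := hsign a haF
  have h2 := hsign b hbF
  have key : ∃ t : ℝ, ∀ u, wall Z.col F u = t * consForm (detForm m) (Z.col ∘ e) u := by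
    rw [wall, dif_pos hF, hez]
    split_ifs
    · exact ⟨-1, fun u => by simp⟩
    · exact ⟨1, fun u => by simp⟩
  obtain ⟨t, ht⟩ := key
  rw [ht] at ha hb
  have hs : ((-1 : ℝ) ^ m) * (-1) ^ m = 1 := by rw [← mul_pow]; norm_num
  have := mul_neg_of_pos_of_neg ha hb
  have h3 := mul_pos h1 h2
  nlinarith [sq_nonneg t]

end canonical

/-! ### Regular triangulations -/

section triangulation

variable {m n : ℕ} {z : Fin n → Fin (m + 1) → ℝ} {h : Fin n → ℝ} {J : Finset (Fin n)}

/-- Evaluate both interpolations at a common point `x`. Expanding `x` over `J`, where `interp z J h`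
equals the heights and `interp z J' h` is at most them, gives one inequality; symmetry gives the
other. Equality and strictness off `J'` kill the weights on `J \ J'`. -/
lemma posCone_inter (hz : InGeneralPosition z) (hh : IsSimplicialHeight z h)
    {J' : Finset (Fin n)} (hJ : J ∈ lowerSimplices z h) (hJ' : J' ∈ lowerSimplices z h) :
    posCone z J ∩ posCone z J' = posCone z (J ∩ J') := by
  apply Set.Subset.antisymm
  · rintro x ⟨hx, hx'⟩
    have key : ∀ {J J' : Finset (Fin n)}, J ∈ lowerSimplices z h → J' ∈ lowerSimplices z h →
        ∀ a : Fin n → ℝ, (∀ i, 0 ≤ a i) → x = ∑ i ∈ J, a i • z i →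
        interp z J' h x ≤ interp z J h x ∧
        (interp z J' h x = interp z J h x → ∀ i ∈ J, i ∉ J' → a i = 0) := by
      intro J J' hJ hJ' a ha hx
      have hd : interp z J h x - interp z J' h x =
          ∑ i ∈ J, a i * (h i - interp z J' h (z i)) := by
        rw [hx]
        simp only [map_sum, map_smul, smul_eq_mul]
        rw [← Finset.sum_sub_distrib]
        refine Finset.sum_congr rfl fun i hi => ?_
        rw [interp_apply hz (mem_lowerSimplices.mp hJ).1 h hi]; ring
      have hnn : ∀ i ∈ J, 0 ≤ a i * (h i - interp z J' h (z i)) := fun i _ =>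
        mul_nonneg (ha i) (sub_nonneg.mpr ((mem_lowerSimplices.mp hJ').2 i))
      refine ⟨by linarith [Finset.sum_nonneg hnn], fun e i hi hi' => ?_⟩
      rw [e, sub_self, eq_comm, Finset.sum_eq_zero_iff_of_nonneg hnn] at hd
      exact (mul_eq_zero.mp (hd i hi)).resolve_right (sub_pos.mpr (hh J' hJ' i hi')).ne'
    obtain ⟨a, ha, hxa⟩ := hx
    obtain ⟨b, hb, hxb⟩ := hx'
    have h1 := key hJ hJ' a ha hxa
    have h2 := key hJ' hJ b hb hxb
    have e := le_antisymm h1.1 h2.1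
    refine ⟨a, ha, ?_⟩
    rw [hxa]
    symm
    refine Finset.sum_subset Finset.inter_subset_left fun i hi hi' => ?_
    rw [h1.2 e i hi (fun hJ' => hi' (Finset.mem_inter.mpr ⟨hi, hJ'⟩)), zero_smul]
  · exact Set.subset_inter (posCone_mono z Finset.inter_subset_left)
      (posCone_mono z Finset.inter_subset_right)

/-- The signed count of lower simplices at a facet is `1`, so the count is not empty. -/
lemma lowerSimplices_nonempty (hz : InGeneralPosition z) (hmn : m < n)
    (hfac : (facets z).Nonempty) (hh : IsSimplicialHeight z h) : (lowerSimplices z h).Nonempty := by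
  classical
  obtain ⟨F, hF⟩ := hfac
  rw [mem_facets] at hF
  obtain ⟨j₀, -, hj₀⟩ := Finset.exists_mem_notMem_of_card_lt_card
    (s := F) (t := Finset.univ) (by simpa [hF.1] using hmn)
  have := sum_sign_wall hz hh hF.1 hj₀
  rw [if_pos hF.2] at this
  obtain ⟨j, hj, -⟩ := Finset.exists_ne_zero_of_sum_ne_zero (this.trans_ne one_ne_zero)
  exact ⟨_, (Finset.mem_filter.mp hj).2⟩

/-- The linear relation between `z i` and the basis `z j`, `j ∈ J`. -/
def basisRelation (z : Fin n → Fin (m + 1) → ℝ) (J : Finset (Fin n)) (i l : Fin n) : ℝ :=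
  if l = i then 1 else if l ∈ J then - coord z J l (z i) else 0

lemma sum_basisRelation_smul {V : Type*} [AddCommGroup V] [Module ℝ V] {i : Fin n} (hi : i ∉ J)
    (g : Fin n → V) :
    ∑ l, basisRelation z J i l • g l = g i - ∑ j ∈ J, coord z J j (z i) • g j := by
  have h1 : ∀ l, basisRelation z J i l • g l =
      (if l = i then g l else 0) - (if l ∈ J then coord z J l (z i) • g l else 0) := by
    intro l
    rw [basisRelation]
    by_cases h1 : l = i
    · subst h1; simp [hi]
    · by_cases h2 : l ∈ J <;> simp [h1, h2]
  simp only [h1, Finset.sum_sub_distrib, Finset.sum_ite_eq', Finset.mem_univ, if_true,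
    Finset.sum_ite_mem, Finset.univ_inter]

lemma sum_basisRelation_smul_self (hz : InGeneralPosition z) (hJ : J.card = m + 1) {i : Fin n}
    (hi : i ∉ J) : ∑ l, basisRelation z J i l • z l = 0 := by
  rw [sum_basisRelation_smul hi, ← eq_sum_coord hz hJ, sub_self]

lemma sum_basisRelation_mul {i : Fin n} (hi : i ∉ J) :
    ∑ l, basisRelation z J i l * h l = h i - interp z J h (z i) := by
  have := sum_basisRelation_smul (z := z) hi h
  simp only [smul_eq_mul] at this
  rw [this, interp, LinearMap.sum_apply]
  simp [mul_comm]

/-- Moving a nonnegative vector until a coordinate vanishes. -/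
lemma exists_ratio {ι : Type*} [Fintype ι] {C k : ι → ℝ} (hC : ∀ i, 0 ≤ C i)
    (hk : ∃ i, k i < 0) :
    ∃ ε : ℝ, 0 ≤ ε ∧ (∀ i, 0 ≤ C i + ε * k i) ∧ ∃ i, k i < 0 ∧ C i + ε * k i = 0 := by
  obtain ⟨i₀, hi₀⟩ := hk
  obtain ⟨l, hl, hmin⟩ := Finset.exists_min_image (Finset.univ.filter fun i => k i < 0)
    (fun i => C i / (- k i)) ⟨i₀, by simpa using hi₀⟩
  have hl' : k l < 0 := by simpa using hl
  have hε : 0 ≤ C l / (- k l) := div_nonneg (hC l) (by linarith)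
  refine ⟨C l / (- k l), hε, fun i => ?_, l, hl', ?_⟩
  · rcases lt_or_ge (k i) 0 with h | h
    · have := hmin i (by simpa using h)
      rw [le_div_iff₀ (by linarith)] at this
      linarith
    · exact add_nonneg (hC i) (mul_nonneg hε h)
  · have := hl'.ne
    field_simp
    ring

lemma mem_posCone_of_support {C : Fin n → ℝ} (hC : ∀ i, 0 ≤ C i) {S : Finset (Fin n)}
    (hS : ∀ i, i ∉ S → C i = 0) : ∑ i, C i • z i ∈ posCone z S :=
  ⟨C, hC, (Finset.sum_subset (Finset.subset_univ S) fun i _ hi => by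
    rw [hS i hi, zero_smul]).symm⟩

/-- Carathéodory's theorem for cones over configurations in general position. -/
lemma exists_mem_posCone_of_mem (hz : InGeneralPosition z) (hmn : m < n) {Y : Fin (m + 1) → ℝ}
    (hY : Y ∈ posCone z Finset.univ) : ∃ J : Finset (Fin n), J.card = m + 1 ∧ Y ∈ posCone z J := by
  classical
  have hex : ∃ q, ∃ C : Fin n → ℝ, (∀ i, 0 ≤ C i) ∧ Y = ∑ i, C i • z i ∧
      (Finset.univ.filter fun i => C i ≠ 0).card = q := by
    obtain ⟨C, hC, hY⟩ := hY
    exact ⟨_, C, hC, hY, rfl⟩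
  obtain ⟨C, hC, hYC, hq⟩ := Nat.find_spec hex
  set S := Finset.univ.filter fun i => C i ≠ 0 with hS
  have hCS : ∀ i, i ∉ S → C i = 0 := fun i hi => by simpa [hS] using hi
  have hle : S.card ≤ m + 1 := by
    by_contra hcon
    obtain ⟨J, hJS, hJ⟩ := Finset.exists_subset_card_eq (n := m + 1) (s := S) (by omega)
    obtain ⟨i, hiS, hiJ⟩ := Finset.exists_mem_notMem_of_card_lt_card (s := J) (t := S) (by omega)
    -- The relation is negated so that its entry at `i` is negative. Moving along it removes a label
    -- from a support that was chosen minimal.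
    obtain ⟨ε, -, hnn, l, hl, hl0⟩ := exists_ratio (k := fun l => - basisRelation z J i l) hC
      ⟨i, by simp [basisRelation]⟩
    have hlS : l ∈ S := by
      rcases eq_or_ne l i with rfl | hli
      · exact hiS
      · by_cases hlJ : l ∈ J
        · exact hJS hlJ
        · simp [basisRelation, hli, hlJ] at hl
    have hsub : (Finset.univ.filter fun i' => C i' + ε * - basisRelation z J i i' ≠ 0) ⊆
        S.erase l := by
      intro a ha
      rw [Finset.mem_filter] at ha
      refine Finset.mem_erase.mpr ⟨fun e => ha.2 (e ▸ hl0), ?_⟩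
      by_contra haS
      refine ha.2 ?_
      have h1 : a ≠ i := fun e => haS (e ▸ hiS)
      have h2 : a ∉ J := fun h => haS (hJS h)
      rw [hCS a haS]
      simp [basisRelation, h1, h2]
    refine Nat.find_min hex (m := _) ?_ ⟨fun i' => C i' + ε * - basisRelation z J i i', hnn, ?_, rfl⟩
    · rw [← hq]
      calc _ ≤ (S.erase l).card := Finset.card_le_card hsub
        _ < S.card := Finset.card_erase_lt_of_mem hlS
    · rw [hYC]
      simp only [add_smul, mul_smul, neg_smul, Finset.sum_add_distrib, ← Finset.smul_sum,
        Finset.sum_neg_distrib]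
      rw [sum_basisRelation_smul_self hz hJ hiJ]
      simp
  obtain ⟨J, hSJ, -, hJ⟩ := Finset.exists_subsuperset_card_eq (n := m + 1)
    (Finset.subset_univ S) hle (by simpa using hmn)
  refine ⟨J, hJ, posCone_mono z hSJ ?_⟩
  rw [hYC]
  exact mem_posCone_of_support hC hCS

/-- A point off the walls lies in the simplex of least cost, which is a lower simplex. -/
lemma exists_mem_lowerSimplices_of_ne_zero (hz : InGeneralPosition z) (hmn : m < n)
    (hT : (lowerSimplices z h).Nonempty) {Y : Fin (m + 1) → ℝ} (hY : Y ∈ posCone z Finset.univ)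
    (hYF : ∀ F : Finset (Fin n), F.card = m → wall z F Y ≠ 0) :
    ∃ J ∈ lowerSimplices z h, Y ∈ posCone z J := by
  classical
  obtain ⟨J₁, hJ₁, hYJ₁⟩ := exists_mem_posCone_of_mem hz hmn hY
  obtain ⟨J, hJ, hmin⟩ := Finset.exists_min_image
    (Finset.univ.filter fun J : Finset (Fin n) => J.card = m + 1 ∧ Y ∈ posCone z J)
    (fun J => interp z J h Y) ⟨J₁, by simp [hJ₁, hYJ₁]⟩
  simp only [Finset.mem_filter, Finset.mem_univ, true_and] at hJ hmin
  -- A step of the simplex method: a label `i` below the interpolation could be exchanged for some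
  -- `l ∈ J`, which keeps `Y` in the cone and lowers the cost.
  refine ⟨J, mem_lowerSimplices.mpr ⟨hJ.1, fun i => ?_⟩, hJ.2⟩
  by_contra! hcon
  have hiJ : i ∉ J := fun hi => by
    rw [interp_apply hz hJ.1 h hi] at hcon; exact lt_irrefl _ hcon
  have hcost := sum_basisRelation_mul (z := z) (h := h) hiJ
  have hrel := sum_basisRelation_smul_self hz hJ.1 hiJ
  set C : Fin n → ℝ := fun j => if j ∈ J then coord z J j Y else 0 with hCdef
  have hCpos : ∀ j ∈ J, 0 < C j := fun j hj => by
    rw [hCdef]; dsimp only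
    rw [if_pos hj]
    refine lt_of_le_of_ne ((mem_posCone_iff_coord hz hJ.1).mp hJ.2 j hj) (Ne.symm ?_)
    have hc : (J.erase j).card = m := by rw [Finset.card_erase_of_mem hj, hJ.1]; rfl
    rw [coord, LinearMap.smul_apply, smul_eq_mul]
    exact mul_ne_zero (inv_ne_zero (wall_ne_zero hz hc (Finset.notMem_erase j J))) (hYF _ hc)
  have hC0 : ∀ j ∉ J, C j = 0 := fun j hj => by simp [hCdef, hj]
  have hC : ∀ j, 0 ≤ C j := fun j => by
    by_cases hj : j ∈ J
    · exact (hCpos j hj).le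
    · rw [hC0 j hj]
  have hYC : Y = ∑ j, C j • z j := by
    conv_lhs => rw [eq_sum_coord hz hJ.1 Y]
    simp [hCdef, ite_smul, Finset.sum_ite_mem]
  -- The program is bounded: if the relation had no negative entry, pairing it with the form of any
  -- lower simplex, which lies below `h`, would make its cost nonnegative.
  obtain ⟨ε, hε, hnn, l, hl, hl0⟩ := exists_ratio (k := basisRelation z J i) hC (by
    by_contra! hk
    obtain ⟨J₀, hJ₀⟩ := hT
    rw [mem_lowerSimplices] at hJ₀
    have h1 : ∑ l, basisRelation z J i l * interp z J₀ h (z l) = 0 := by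
      have := congrArg (interp z J₀ h) hrel
      simpa using this
    have h2 : ∑ l, basisRelation z J i l * interp z J₀ h (z l) ≤
        ∑ l, basisRelation z J i l * h l :=
      Finset.sum_le_sum fun l _ => mul_le_mul_of_nonneg_left (hJ₀.2 l) (hk l)
    linarith)
  have hli : l ≠ i := fun e => by rw [e] at hl; simp [basisRelation] at hl; linarith
  have hlJ : l ∈ J := by
    by_contra hlJ
    simp [basisRelation, hli, hlJ] at hl
  -- Nondegeneracy: `Y` is off the walls, so all its coordinates on `J` are positive and the step
  -- has positive length.
  have hε' : 0 < ε := lt_of_le_of_ne hε fun e => by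
    rw [← e, zero_mul, add_zero] at hl0; exact (hCpos l hlJ).ne' hl0
  have hJ' : (insert i (J.erase l)).card = m + 1 := by
    rw [Finset.card_insert_of_notMem (fun h => hiJ (Finset.mem_of_mem_erase h)),
      Finset.card_erase_of_mem hlJ, hJ.1]; rfl
  have hsupp : ∀ a, a ∉ insert i (J.erase l) → C a + ε * basisRelation z J i a = 0 := by
    intro a ha
    rw [Finset.mem_insert, Finset.mem_erase] at ha
    push Not at ha
    rcases eq_or_ne a l with rfl | hal
    · exact hl0
    · have haJ' : a ∉ J := ha.2 hal
      rw [hC0 a haJ']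
      simp [basisRelation, ha.1, haJ']
  have hYC' : Y = ∑ a, (C a + ε * basisRelation z J i a) • z a := by
    simp only [add_smul, mul_smul, Finset.sum_add_distrib, ← Finset.smul_sum]
    rw [hrel, smul_zero, add_zero, ← hYC]
  have hmem : Y ∈ posCone z (insert i (J.erase l)) := by
    rw [hYC']; exact mem_posCone_of_support hnn hsupp
  have hlt := hmin _ ⟨hJ', hmem⟩
  have hval : ∀ (J : Finset (Fin n)) (D : Fin n → ℝ), J.card = m + 1 →
      (∀ a, a ∉ J → D a = 0) → interp z J h (∑ a, D a • z a) = ∑ a, D a * h a := by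
    intro J D hJ hD
    simp only [map_sum, map_smul, smul_eq_mul]
    refine Finset.sum_congr rfl fun a _ => ?_
    by_cases ha : a ∈ J
    · rw [interp_apply hz hJ h ha]
    · rw [hD a ha, zero_mul, zero_mul]
  have e1 : interp z J h Y = ∑ a, C a * h a := by rw [hYC]; exact hval J C hJ.1 hC0
  have e2 : interp z (insert i (J.erase l)) h Y =
      ∑ a, (C a + ε * basisRelation z J i a) * h a := by
    conv_lhs => rw [hYC']
    exact hval _ _ hJ' hsupp
  have e3 : ∑ a, (C a + ε * basisRelation z J i a) * h a =
      ∑ a, C a * h a + ε * (h i - interp z J h (z i)) := by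
    rw [← hcost, Finset.mul_sum, ← Finset.sum_add_distrib]
    exact Finset.sum_congr rfl fun a _ => by ring
  have := mul_pos hε' (sub_pos.mpr hcon)
  linarith

lemma eventually_wall_ne_zero {y₀ : Fin (m + 1) → ℝ}
    (hy₀ : ∀ F : Finset (Fin n), F.card = m → wall z F y₀ ≠ 0) (Y : Fin (m + 1) → ℝ) :
    ∀ᶠ t : ℝ in 𝓝[>] 0, ∀ F : Finset (Fin n), F.card = m → wall z F (Y + t • y₀) ≠ 0 := by
  rw [Filter.eventually_all]
  intro F
  by_cases hF : F.card = m
  · have hne := hy₀ F hF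
    have : ∀ᶠ t : ℝ in 𝓝[≠] 0, t ≠ - (wall z F Y / wall z F y₀) := by
      rcases eq_or_ne (- (wall z F Y / wall z F y₀)) 0 with e | e
      · rw [e]; exact eventually_mem_nhdsWithin
      · exact eventually_nhdsWithin_of_eventually_nhds (eventually_ne_nhds e.symm)
    filter_upwards [nhdsWithin_mono 0 (fun t ht => ne_of_gt ht) this] with t ht _ h0
    refine ht ?_
    simp only [map_add, map_smul, smul_eq_mul] at h0
    field_simp
    linarith
  · exact Filter.Eventually.of_forall fun t h => absurd h hF

lemma isClosed_posCone (hz : InGeneralPosition z) (hJ : J.card = m + 1) :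
    IsClosed (posCone z J) := by
  have : posCone z J = ⋂ j ∈ J, {Y | 0 ≤ coord z J j Y} := by
    ext Y; simp [mem_posCone_iff_coord hz hJ]
  rw [this]
  exact isClosed_biInter fun j _ =>
    isClosed_le continuous_const (coord z J j).continuous_of_finiteDimensional

lemma posCone_add {ι κ : Type*} {v : ι → κ → ℝ} {I : Finset ι} {x y : κ → ℝ}
    (hx : x ∈ posCone v I) (hy : y ∈ posCone v I) {t : ℝ} (ht : 0 ≤ t) :
    x + t • y ∈ posCone v I := by
  obtain ⟨a, ha, rfl⟩ := hx
  obtain ⟨b, hb, rfl⟩ := hy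
  refine ⟨fun i => a i + t * b i, fun i => add_nonneg (ha i) (mul_nonneg ht (hb i)), ?_⟩
  simp [add_smul, mul_smul, Finset.sum_add_distrib, Finset.smul_sum]

/-- Perturb `∑ z i`, whose weights are all `1`, slightly in a direction on which no wall vanishes.
-/
lemma exists_mem_posCone_wall_ne_zero (hz : InGeneralPosition z) (hmn : m < n) :
    ∃ y₀ ∈ posCone z Finset.univ, ∀ F : Finset (Fin n), F.card = m → wall z F y₀ ≠ 0 := by
  obtain ⟨y, hy⟩ := Module.Dual.exists_forall_ne_zero_of_forall_exists
    (fun F : {F : Finset (Fin n) // F.card = m} => (wall z F.1 : Module.Dual ℝ _)) (by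
      rintro ⟨F, hF⟩
      by_contra! hcon
      exact wall_form_ne_zero hz hmn hF (LinearMap.ext hcon))
  obtain ⟨J, -, hJ⟩ := Finset.exists_subset_card_eq (n := m + 1)
    (s := (Finset.univ : Finset (Fin n))) (by simpa using hmn)
  set c : Fin n → ℝ := fun i => if i ∈ J then coord z J i y else 0 with hc
  have hyc : y = ∑ i, c i • z i := by
    conv_lhs => rw [eq_sum_coord hz hJ y]
    simp [hc, ite_smul, Finset.sum_ite_mem]
  have h1 : ∀ᶠ t : ℝ in 𝓝[>] 0, ∀ i, 0 ≤ 1 + t * c i := by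
    rw [Filter.eventually_all]
    intro i
    apply eventually_nhdsWithin_of_eventually_nhds
    have : ContinuousAt (fun t : ℝ => 1 + t * c i) 0 := by fun_prop
    exact (this.eventually (lt_mem_nhds (by norm_num : (0 : ℝ) < 1 + 0 * c i))).mono
      fun t ht => ht.le
  obtain ⟨t, ht1, ht2⟩ := (h1.and (eventually_wall_ne_zero (fun F hF => hy ⟨F, hF⟩)
    (∑ i, z i))).exists
  refine ⟨_, ⟨fun i => 1 + t * c i, ht1, ?_⟩, ht2⟩
  rw [hyc]
  simp [add_smul, mul_smul, Finset.sum_add_distrib, Finset.smul_sum]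

/-- The simplices cover the points off the walls; their union is closed, and every `Y` in the cone
is the limit of such points `Y + t • y₀`. -/
lemma iUnion_posCone (hz : InGeneralPosition z) (hmn : m < n)
    (hT : (lowerSimplices z h).Nonempty) :
    ⋃ J ∈ lowerSimplices z h, posCone z J = posCone z Finset.univ := by
  apply Set.Subset.antisymm
  · exact Set.iUnion₂_subset fun J _ => posCone_mono z (Finset.subset_univ J)
  · intro Y hY
    obtain ⟨y₀, hy₀, hy₀F⟩ := exists_mem_posCone_wall_ne_zero hz hmn
    have hcl : IsClosed (⋃ J ∈ lowerSimplices z h, posCone z J) :=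
      Set.Finite.isClosed_biUnion (Finset.finite_toSet _) fun J hJ =>
        isClosed_posCone hz (mem_lowerSimplices.mp hJ).1
    have htend : Tendsto (fun t : ℝ => Y + t • y₀) (𝓝[>] 0) (𝓝 Y) := by
      have : ContinuousAt (fun t : ℝ => Y + t • y₀) 0 := by fun_prop
      have h2 := this.tendsto
      rw [zero_smul, add_zero] at h2
      exact h2.mono_left nhdsWithin_le_nhds
    refine hcl.mem_of_tendsto htend ?_
    filter_upwards [eventually_wall_ne_zero hy₀F Y, eventually_mem_nhdsWithin] with t ht ht0
    obtain ⟨J, hJ, hYJ⟩ := exists_mem_lowerSimplices_of_ne_zero hz hmn hT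
      (posCone_add hY hy₀ (le_of_lt ht0)) ht
    exact Set.mem_iUnion₂.mpr ⟨J, hJ, hYJ⟩

end triangulation

/-! ### Fiber volume forms -/

section wedge

variable {V : Type*} [AddCommGroup V] [Module ℝ V] {p q : ℕ}

lemma wedge_apply (α : V [⋀^Fin p]→ₗ[ℝ] ℝ) (β : V [⋀^Fin q]→ₗ[ℝ] ℝ) (v : Fin (p + q) → V) :
    wedge α β v = ∑ σ : Equiv.Perm.ModSumCongr (Fin p) (Fin q),
      LinearMap.mul' ℝ ℝ (AlternatingMap.domCoprod.summand α β σ (v ∘ finSumFinEquiv)) := by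
  rw [wedge, AlternatingMap.domDomCongr_apply, LinearMap.compAlternatingMap_apply]
  rw [AlternatingMap.domCoprod_apply, _root_.sum_apply, map_sum]

lemma mul'_summand_mk (α : V [⋀^Fin p]→ₗ[ℝ] ℝ) (β : V [⋀^Fin q]→ₗ[ℝ] ℝ)
    (σ : Equiv.Perm (Fin p ⊕ Fin q)) (u : Fin p ⊕ Fin q → V) :
    LinearMap.mul' ℝ ℝ (AlternatingMap.domCoprod.summand α β (Quotient.mk'' σ) u) =
      (Equiv.Perm.sign σ : ℤ) *
        (α (fun i => u (σ (Sum.inl i))) * β (fun i => u (σ (Sum.inr i)))) := by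
  rw [AlternatingMap.domCoprod.summand_mk'']
  rcases Int.units_eq_one_or (Equiv.Perm.sign σ) with h | h
  · rw [h, one_smul]; simp
  · rw [h, Units.neg_smul, one_smul, _root_.neg_apply]; simp

/-- A wedge product vanishes if one of the arguments is annihilated by both factors. -/
lemma wedge_eq_zero (α : V [⋀^Fin p]→ₗ[ℝ] ℝ) (β : V [⋀^Fin q]→ₗ[ℝ] ℝ) {c : V}
    (hα : ∀ x, (∃ j, x j = c) → α x = 0) (hβ : ∀ x, (∃ j, x j = c) → β x = 0)
    {v : Fin (p + q) → V} (hv : ∃ j, v j = c) : wedge α β v = 0 := by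
  rw [wedge_apply]
  refine Finset.sum_eq_zero fun σ _ => ?_
  induction σ using Quotient.inductionOn' with
  | h σ =>
    rw [mul'_summand_mk]
    obtain ⟨j, hj⟩ := hv
    have e : (v ∘ finSumFinEquiv) (σ (σ.symm (finSumFinEquiv.symm j))) = c := by simp [hj]
    rcases hs : σ.symm (finSumFinEquiv.symm j) with i | i
    · rw [hs] at e; rw [hα _ ⟨i, e⟩]; simp
    · rw [hs] at e; rw [hβ _ ⟨i, e⟩]; simp

/-- If the second factor annihilates the first `p` arguments, only the trivial shuffle contributes
to a wedge product. -/
lemma wedge_append (α : V [⋀^Fin p]→ₗ[ℝ] ℝ) (β : V [⋀^Fin q]→ₗ[ℝ] ℝ) (b : Fin p → V)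
    (w : Fin q → V) (hβ : ∀ x, (∃ j k, x j = b k) → β x = 0) :
    wedge α β (Fin.append b w) = α b * β w := by
  rw [wedge_apply]
  refine (Finset.sum_eq_single
    (Quotient.mk'' 1 : Equiv.Perm.ModSumCongr (Fin p) (Fin q)) ?_ ?_).trans ?_
  · intro σ _ hσ
    induction σ using Quotient.inductionOn' with
    | h σ =>
      rw [mul'_summand_mk]
      -- A permutation outside the trivial class does not preserve the two blocks, so it feeds some
      -- `b k` to the second factor.
      have : ∃ j k, σ (Sum.inr j) = Sum.inl k := by
        by_contra! hcon
        refine hσ (Quotient.sound' ?_)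
        rw [QuotientGroup.leftRel_apply]
        refine Subgroup.mul_mem _ (Subgroup.inv_mem _ ?_) (Subgroup.one_mem _)
        refine Equiv.Perm.mem_sumCongrHom_range_of_perm_mapsTo_inl
          ((Equiv.Perm.perm_mapsTo_inl_iff_mapsTo_inr σ).mpr ?_)
        rintro _ ⟨j, rfl⟩
        rcases hs : σ (Sum.inr j) with k | k
        · exact absurd hs (hcon j k)
        · exact ⟨k, rfl⟩
      obtain ⟨j, k, hjk⟩ := this
      rw [hβ (fun i => (Fin.append b w ∘ finSumFinEquiv) (σ (Sum.inr i))) ⟨j, k, by simp [hjk]⟩]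
      simp
  · simp
  · rw [mul'_summand_mk]
    simp

end wedge

section fixLeft

variable {V α β : Type*} [AddCommGroup V] [Module ℝ V] {N : ℕ}

/-- The alternating form obtained by fixing some of the arguments. -/
def fixLeft (f : V [⋀^Fin N]→ₗ[ℝ] ℝ) (e : Fin N ≃ α ⊕ β) (b : α → V) : V [⋀^β]→ₗ[ℝ] ℝ where
  toFun u := f (Sum.elim b u ∘ e)
  map_update_add' := by
    classical
    intro _ u i x y
    convert! f.map_update_add (Sum.elim b u ∘ e) (e.symm (Sum.inr i)) x y using 2 <;>
      rw [← Function.update_comp_equiv, Sum.update_elim_inr]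
  map_update_smul' := by
    classical
    intro _ u i t x
    convert! f.map_update_smul (Sum.elim b u ∘ e) (e.symm (Sum.inr i)) t x using 2 <;>
      rw [← Function.update_comp_equiv, Sum.update_elim_inr]
  map_eq_zero_of_eq' := by
    intro u i j hij hne
    exact f.map_eq_zero_of_eq _ (i := e.symm (Sum.inr i)) (j := e.symm (Sum.inr j))
      (by simp [hij]) (by simpa using hne)

lemma fixLeft_apply (f : V [⋀^Fin N]→ₗ[ℝ] ℝ) (e : Fin N ≃ α ⊕ β) (b : α → V) (u : β → V) :
    fixLeft f e b u = f (Sum.elim b u ∘ e) := rfl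

lemma fixLeft_eq_zero (f : V [⋀^Fin N]→ₗ[ℝ] ℝ) (e : Fin N ≃ α ⊕ β) (b : α → V) [DecidableEq β]
    (u : β → V) (i : β) {x : V} (hx : x ∈ Submodule.span ℝ (Set.range b)) :
    fixLeft f e b (Function.update u i x) = 0 := by
  have hle : Submodule.span ℝ (Set.range b) ≤
      LinearMap.ker ((fixLeft f e b).toMultilinearMap.toLinearMap u i) := by
    rw [Submodule.span_le]
    rintro _ ⟨k, rfl⟩
    refine f.map_eq_zero_of_eq _ (i := e.symm (Sum.inr i)) (j := e.symm (Sum.inl k))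
      (by simp) (by simp)
  exact hle hx

/-- A multilinear form vanishing as soon as one argument is in a submodule does not change if the
arguments are changed by elements of the submodule. -/
lemma map_eq_of_sub_mem {β : Type*} [Fintype β] [DecidableEq β] (f : V [⋀^β]→ₗ[ℝ] ℝ)
    (K : Submodule ℝ V) (hf : ∀ u i, ∀ x ∈ K, f (Function.update u i x) = 0) {u u' : β → V}
    (h : ∀ i, u' i - u i ∈ K) : f u' = f u := by
  have key : ∀ S : Finset β, f (S.piecewise u' u) = f u := by
    intro S
    induction S using Finset.induction_on with
    | empty => simp
    | insert i S hi ih =>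
      rw [Finset.piecewise_insert, ← ih]
      have e : u' i = u i + (u' i - u i) := by abel
      rw [e, AlternatingMap.map_update_add, hf _ i _ (h i), add_zero]
      congr 1
      rw [Function.update_eq_self_iff]
      simp [hi]
  simpa using key Finset.univ

end fixLeft

/-! ### Gale duality -/

section gale

variable {m r : ℕ} {Z : Matrix (Fin (m + 1)) (Fin (r + m + 1)) ℝ}
  {B : Matrix (Fin (r + m + 1)) (Fin r) ℝ} {J : Finset (Fin (r + m + 1))}

lemma mulVec_eq_sum_col {k n : ℕ} (Z : Matrix (Fin k) (Fin n) ℝ) (C : Fin n → ℝ) :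
    Z.mulVec C = ∑ i, C i • Z.col i := by
  ext k
  simp [Matrix.mulVec, dotProduct, Matrix.col_apply, mul_comm]

lemma amplituhedronCone_eq {n : ℕ} (Z : Matrix (Fin (m + 1)) (Fin n) ℝ) :
    amplituhedronCone Z = posCone Z.col Finset.univ := by
  ext Y
  simp only [amplituhedronCone, posCone, mulVec_eq_sum_col, Set.mem_ofPred_eq, eq_comm]

lemma IsGaleDual.mulVec_eq_zero (hB : IsGaleDual Z B) (q : Fin r → ℝ) :
    Z.mulVec (B.mulVec q) = 0 := by
  have : B.mulVec q ∈ LinearMap.ker Z.mulVecLin := by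
    rw [← hB.2, mulVec_eq_sum_col]
    exact Submodule.sum_mem _ fun i _ => Submodule.smul_mem _ _ (Submodule.subset_span ⟨i, rfl⟩)
  simpa using this

lemma IsGaleDual.mulVec_col (hB : IsGaleDual Z B) (k : Fin r) : Z.mulVec (B.col k) = 0 := by
  have : B.col k ∈ LinearMap.ker Z.mulVecLin := by
    rw [← hB.2]; exact Submodule.subset_span ⟨k, rfl⟩
  simpa using this

lemma IsGaleDual.exists_mulVec_eq (hB : IsGaleDual Z B) {C : Fin (r + m + 1) → ℝ}
    (hC : Z.mulVec C = 0) : ∃ q, B.mulVec q = C := by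
  have : C ∈ LinearMap.ker Z.mulVecLin := by simpa using hC
  rw [← hB.2, Submodule.mem_span_range_iff_exists_fun] at this
  obtain ⟨q, hq⟩ := this
  exact ⟨q, by rw [mulVec_eq_sum_col, hq]⟩

lemma IsGaleDual.eq_zero_of_mulVec (hB : IsGaleDual Z B) {q : Fin r → ℝ}
    (hq : B.mulVec q = 0) : q = 0 := by
  rw [mulVec_eq_sum_col] at hq
  exact funext (Fintype.linearIndependent_iff.mp hB.1 q hq)

/-- The rows of the Gale dual indexed by the complement of a basis separate points. -/
lemma IsGaleDual.eq_zero_of_dotProduct (hZ : InGeneralPosition Z.col) (hB : IsGaleDual Z B)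
    (hJ : J.card = m + 1) {q : Fin r → ℝ} (hq : ∀ i ∈ Jᶜ, B i ⬝ᵥ q = 0) : q = 0 := by
  apply hB.eq_zero_of_mulVec
  have h0 : ∀ i ∉ J, B.mulVec q i = 0 := fun i hi => hq i (Finset.mem_compl.mpr hi)
  have hsum : ∑ j ∈ J, B.mulVec q j • Z.col j = 0 := by
    rw [← hB.mulVec_eq_zero q, mulVec_eq_sum_col Z]
    exact Finset.sum_subset (Finset.subset_univ J) fun i _ hi => by rw [h0 i hi, zero_smul]
  funext i
  by_cases hi : i ∈ J
  · rw [← coord_sum hZ hJ (B.mulVec q) hi, hsum, map_zero]; rfl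
  · exact h0 i hi

lemma card_compl_eq (hJ : J.card = m + 1) : Jᶜ.card = r := by
  rw [Finset.card_compl, hJ, Fintype.card_fin]; omega

/-- The square matrix of the rows of the Gale dual indexed by the complement of `J`. -/
def complMinor (B : Matrix (Fin (r + m + 1)) (Fin r) ℝ) {I : Finset (Fin (r + m + 1))}
    (hI : I.card = r) : Matrix (Fin r) (Fin r) ℝ :=
  Matrix.of fun a => B (I.orderEmbOfFin hI a)

lemma IsGaleDual.isUnit_complMinor (hZ : InGeneralPosition Z.col) (hB : IsGaleDual Z B)
    (hJ : J.card = m + 1) : IsUnit (complMinor B (card_compl_eq hJ)) := by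
  rw [← Matrix.mulVec_injective_iff_isUnit]
  refine (injective_iff_map_eq_zero (complMinor B (card_compl_eq hJ)).mulVecLin).mpr fun q hq => ?_
  refine hB.eq_zero_of_dotProduct hZ hJ fun i hi => ?_
  obtain ⟨a, rfl⟩ : ∃ a, Jᶜ.orderEmbOfFin (card_compl_eq hJ) a = i := by
    have : i ∈ Set.range (Jᶜ.orderEmbOfFin (card_compl_eq hJ)) := by simpa using hi
    exact this
  exact congrFun hq a

lemma IsGaleDual.linearIndependent_rows (hZ : InGeneralPosition Z.col) (hB : IsGaleDual Z B)
    (hJ : J.card = m + 1) : LinearIndependent ℝ (fun i : (Jᶜ : Finset _) => B i) := by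
  have h := Matrix.linearIndependent_rows_iff_isUnit.mpr (hB.isUnit_complMinor hZ hJ)
  rw [← linearIndependent_equiv (Jᶜ.orderIsoOfFin (card_compl_eq hJ)).toEquiv]
  exact h

lemma IsGaleDual.vecMul_comp (hB : IsGaleDual Z B) (ψ : (Fin (m + 1) → ℝ) →ₗ[ℝ] ℝ) :
    B.vecMul (fun i => ψ (Z.col i)) = 0 := by
  funext k
  have h := congrArg ψ (hB.mulVec_col k)
  rw [mulVec_eq_sum_col, map_sum, map_zero] at h
  simp only [map_smul, smul_eq_mul] at h
  rw [Pi.zero_apply, ← h]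
  simp [Matrix.vecMul, dotProduct, Matrix.col_apply, mul_comm]

lemma vecMul_eq_sum_row {n : ℕ} (B : Matrix (Fin n) (Fin r) ℝ) (h : Fin n → ℝ) :
    B.vecMul h = ∑ i, h i • B i := by
  ext k
  simp [Matrix.vecMul, dotProduct]

/-- The restriction of the heights to the kernel, in terms of the gaps between the heights and
their interpolation on a basis. -/
lemma IsGaleDual.vecMul_eq_sum (hZ : InGeneralPosition Z.col) (hB : IsGaleDual Z B)
    (hJ : J.card = m + 1) (h : Fin (r + m + 1) → ℝ) :
    B.vecMul h = ∑ i ∈ Jᶜ, (h i - interp Z.col J h (Z.col i)) • B i := by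
  have e : h = (fun i => h i - interp Z.col J h (Z.col i)) +
      fun i => interp Z.col J h (Z.col i) := by funext i; simp
  conv_lhs => rw [e, Matrix.add_vecMul, hB.vecMul_comp, add_zero, vecMul_eq_sum_row]
  symm
  refine Finset.sum_subset (Finset.subset_univ _) fun i _ hi => ?_
  rw [interp_apply hZ hJ h (by simpa using hi), sub_self, zero_smul]

lemma IsGaleDual.eq_of_sum_eq (hZ : InGeneralPosition Z.col) (hB : IsGaleDual Z B)
    (hJ : J.card = m + 1) {a b : Fin (r + m + 1) → ℝ}
    (h : ∑ i ∈ Jᶜ, a i • B i = ∑ i ∈ Jᶜ, b i • B i) {i : Fin (r + m + 1)} (hi : i ∉ J) :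
    a i = b i := by
  have hli := hB.linearIndependent_rows hZ hJ
  have h0 : ∑ i : (Jᶜ : Finset _), (a i - b i) • B i = 0 := by
    rw [Finset.sum_coe_sort Jᶜ (fun i => (a i - b i) • B i)]
    simp only [sub_smul, Finset.sum_sub_distrib, h, sub_self]
  have := Fintype.linearIndependent_iff.mp hli (fun i => a i - b i) h0 ⟨i, Finset.mem_compl.mpr hi⟩
  linarith

/-- The rows outside `J` are independent, so the gaps in `IsGaleDual.vecMul_eq_sum` are the only
possible coefficients, and the cone condition is their nonnegativity. -/
lemma IsGaleDual.vecMul_mem_posCone_iff (hZ : InGeneralPosition Z.col) (hB : IsGaleDual Z B)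
    (hJ : J.card = m + 1) (h : Fin (r + m + 1) → ℝ) :
    B.vecMul h ∈ posCone B Jᶜ ↔ J ∈ lowerSimplices Z.col h := by
  classical
  rw [mem_lowerSimplices, and_iff_right hJ, hB.vecMul_eq_sum hZ hJ h]
  constructor
  · rintro ⟨a, ha, e⟩ i
    by_cases hi : i ∈ J
    · rw [interp_apply hZ hJ h hi]
    · have := hB.eq_of_sum_eq hZ hJ e hi
      linarith [ha i]
  · intro hle
    exact ⟨fun i => h i - interp Z.col J h (Z.col i), fun i => sub_nonneg.mpr (hle i), rfl⟩

/-- Interpolate the difference of the heights on a basis; the remaining gaps are coefficients of `0`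
in independent rows. Thus a regular subdivision depends only on `hB`. -/
lemma IsGaleDual.exists_eq_add (hZ : InGeneralPosition Z.col) (hB : IsGaleDual Z B)
    {h h' : Fin (r + m + 1) → ℝ} (e : B.vecMul h' = B.vecMul h) :
    ∃ ψ : (Fin (m + 1) → ℝ) →ₗ[ℝ] ℝ, h' = fun i => h i + ψ (Z.col i) := by
  obtain ⟨J, -, hJ⟩ := Finset.exists_subset_card_eq (n := m + 1)
    (s := (Finset.univ : Finset (Fin (r + m + 1)))) (by simp)
  have h0 : B.vecMul (h' - h) = 0 := by rw [Matrix.sub_vecMul, e, sub_self]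
  rw [hB.vecMul_eq_sum hZ hJ] at h0
  refine ⟨interp Z.col J (h' - h), funext fun i => ?_⟩
  by_cases hi : i ∈ J
  · rw [interp_apply hZ hJ _ hi]; simp
  · have := hB.eq_of_sum_eq hZ hJ (b := 0) (by rw [h0]; simp) hi
    simp only [Pi.sub_apply, Pi.zero_apply] at this
    linarith

/-- The position of the fixed arguments among the arguments of the volume form of `ℝ^{r+m+1}`. -/
def fiberEquiv (r m : ℕ) : Fin (r + m + 1) ≃ Fin r ⊕ Fin (m + 1) :=
  -- Place `0` is for the Euler vector, the next `r` for the kernel, the last `m` for the base: the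
  -- order of arguments in `stdForm` and `wedge`.
  (Equiv.ofBijective (Sum.elim (fun i => (Fin.castAdd m i).succ)
    (Fin.cases 0 fun j => (Fin.natAdd r j).succ) : Fin r ⊕ Fin (m + 1) → Fin (r + m + 1)) (by
    rw [Fintype.bijective_iff_injective_and_card]
    refine ⟨?_, by simp; omega⟩
    rintro (i | i) (j | j) h
    · simpa [Fin.ext_iff] using h
    · induction j using Fin.cases with
      | zero => simp at h
      | succ j => simp [Fin.ext_iff] at h; omega
    · induction i using Fin.cases with
      | zero => simp [eq_comm] at h
      | succ i => simp [Fin.ext_iff] at h; omega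
    · induction i using Fin.cases with
      | zero =>
        induction j using Fin.cases with
        | zero => rfl
        | succ j => simp [eq_comm] at h
      | succ i =>
        induction j using Fin.cases with
        | zero => simp at h
        | succ j => simpa [Fin.ext_iff] using h)).symm

lemma elim_comp_fiberEquiv {V : Type*} (b : Fin r → V) (u : Fin (m + 1) → V) :
    Sum.elim b u ∘ fiberEquiv r m = Matrix.vecCons (u 0) (Fin.append b (Fin.tail u)) := by
  have key : Sum.elim b u = Matrix.vecCons (u 0) (Fin.append b (Fin.tail u)) ∘
      (fiberEquiv r m).symm := by
    funext s
    rcases s with i | j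
    · simp [fiberEquiv]
    · induction j using Fin.cases with
      | zero => simp [fiberEquiv]
      | succ j => simp [fiberEquiv, Fin.tail]
  rw [key, Function.comp_assoc, Equiv.symm_comp_self, Function.comp_id]

/-- The volume form of `ℝ^{r+m+1}` with the columns of `B` inserted. -/
def kernelDet (B : Matrix (Fin (r + m + 1)) (Fin r) ℝ) :
    (Fin (r + m + 1) → ℝ) [⋀^Fin (m + 1)]→ₗ[ℝ] ℝ :=
  fixLeft (detForm (r + m)) (fiberEquiv r m) B.col

lemma kernelDet_vecCons (B : Matrix (Fin (r + m + 1)) (Fin r) ℝ) (C : Fin (r + m + 1) → ℝ)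
    (w : Fin m → Fin (r + m + 1) → ℝ) :
    kernelDet B (Matrix.vecCons C w) =
      detForm (r + m) (Matrix.vecCons C (Fin.append B.col w)) := by
  rw [kernelDet, fixLeft_apply, elim_comp_fiberEquiv]
  rfl

/-- A linear section of `Z`. -/
lemma exists_section (hZ : InGeneralPosition Z.col) :
    ∃ s : (Fin (m + 1) → ℝ) →ₗ[ℝ] (Fin (r + m + 1) → ℝ), ∀ y, Z.mulVec (s y) = y := by
  classical
  obtain ⟨J, -, hJ⟩ := Finset.exists_subset_card_eq (n := m + 1)
    (s := (Finset.univ : Finset (Fin (r + m + 1)))) (by simp)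
  refine ⟨LinearMap.pi fun j => if j ∈ J then coord Z.col J j else 0, fun y => ?_⟩
  rw [mulVec_eq_sum_col]
  conv_rhs => rw [eq_sum_coord hZ hJ y]
  symm
  have : ∀ i, (LinearMap.pi fun j => if j ∈ J then coord Z.col J j else 0) y i • Z.col i =
      if i ∈ J then coord Z.col J i y • Z.col i else 0 := by
    intro i
    by_cases hi : i ∈ J <;> simp [hi]
  simp only [this, Finset.sum_ite_mem, Finset.univ_inter]

/-- With a basis of `ker Z` inserted, the volume form vanishes as soon as another argument is in
`ker Z`. It descends along `Z` to a form of top degree on `ℝ^{m+1}`, a multiple of the determinant.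
-/
lemma IsGaleDual.kernelDet_eq (hZ : InGeneralPosition Z.col) (hB : IsGaleDual Z B) :
    ∃ κ : ℝ, ∀ u, kernelDet B u = κ * detForm m fun i => Z.mulVec (u i) := by
  obtain ⟨s, hs⟩ := exists_section hZ
  refine ⟨(kernelDet B).compLinearMap s (Pi.basisFun ℝ (Fin (m + 1))), fun u => ?_⟩
  have h1 : kernelDet B (fun i => s (Z.mulVec (u i))) = kernelDet B u := by
    refine map_eq_of_sub_mem (kernelDet B) (LinearMap.ker Z.mulVecLin) ?_ fun i => ?_
    · intro u i x hx
      rw [← hB.2] at hx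
      exact fixLeft_eq_zero _ _ _ u i hx
    · simp [Matrix.mulVec_sub, hs]
  rw [← h1]
  have h2 := AlternatingMap.eq_smul_basis_det (Pi.basisFun ℝ (Fin (m + 1)))
    ((kernelDet B).compLinearMap s)
  have h3 := congrArg (fun f => f fun i => Z.mulVec (u i)) h2
  exact h3

/-- Listing the coordinates outside `J` before those in `J` makes the matrix block triangular, with
an identity block for `J`. -/
lemma abs_kernelDet_single (hJ : J.card = m + 1) :
    |kernelDet B fun a => Pi.single (J.orderEmbOfFin hJ a) 1| =
      |(complMinor B (card_compl_eq hJ)).det| := by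
  let c : Fin r ⊕ Fin (m + 1) ≃ Fin (r + m + 1) := Equiv.ofBijective
    (Sum.elim (Jᶜ.orderEmbOfFin (card_compl_eq hJ)) (J.orderEmbOfFin hJ)) (by
      rw [Fintype.bijective_iff_injective_and_card]
      refine ⟨Function.Injective.sumElim (RelEmbedding.injective _) (RelEmbedding.injective _) ?_,
        by simp; omega⟩
      intro a b e
      have h1 := Jᶜ.orderEmbOfFin_mem (card_compl_eq hJ) a
      rw [e, Finset.mem_compl] at h1
      exact h1 (J.orderEmbOfFin_mem hJ b))
  rw [kernelDet, fixLeft_apply, detForm, Pi.basisFun_det_apply]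
  rw [← Matrix.abs_det_submatrix_equiv_equiv (fiberEquiv r m).symm c]
  have : (Matrix.of (Sum.elim B.col (fun a => Pi.single (J.orderEmbOfFin hJ a) 1) ∘
      fiberEquiv r m)).submatrix (fiberEquiv r m).symm c = Matrix.fromBlocks
      (complMinor B (card_compl_eq hJ)).transpose
      (Matrix.of fun k a => B (J.orderEmbOfFin hJ a) k) 0 1 := by
    ext a b
    rcases a with a | a <;> rcases b with b | b
    · simp [c, complMinor]
    · simp [c]
    · have : J.orderEmbOfFin hJ a ≠ Jᶜ.orderEmbOfFin (card_compl_eq hJ) b := by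
        intro e
        have h1 := Jᶜ.orderEmbOfFin_mem (card_compl_eq hJ) b
        rw [← e, Finset.mem_compl] at h1
        exact h1 (J.orderEmbOfFin_mem hJ a)
      simp [c, this.symm]
    · simp [c, Pi.single_apply, Matrix.one_apply, eq_comm]
  rw [this, Matrix.det_fromBlocks_zero₂₁, Matrix.det_one, mul_one, Matrix.det_transpose]

/-- Complementary maximal minors of `Z` and `B` are proportional: evaluate the equation defining `κ`
at the unit vectors of `J`, which `Z` maps to its columns. -/
lemma abs_kappa_mul_absDet {κ : ℝ} (hκ : ∀ u, kernelDet B u = κ * detForm m fun i => Z.mulVec (u i))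
    (hJ : J.card = m + 1) :
    |κ| * absDet Z.col J = |(complMinor B (card_compl_eq hJ)).det| := by
  rw [← abs_kernelDet_single hJ, hκ, abs_mul]
  congr 1
  rw [← abs_detForm_comp Z.col (J.orderEmbOfFin hJ).injective
    (fun i => J.orderEmbOfFin_mem hJ i) hJ]
  congr 2
  funext i
  simp

end gale

/-! ### Values and existence of fiber volume forms -/

section fiberForm

variable {m r : ℕ} {Z : Matrix (Fin (m + 1)) (Fin (r + m + 1)) ℝ}
  {B : Matrix (Fin (r + m + 1)) (Fin r) ℝ}

/-- A nonzero vector can be completed to a basis. -/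
lemma exists_detForm_vecCons_ne_zero {y : Fin (m + 1) → ℝ} (hy : y ≠ 0) :
    ∃ v, detForm m (Matrix.vecCons y v) ≠ 0 := by
  obtain ⟨k, hk⟩ := Function.ne_iff.mp hy
  have h := curryLeft_succAbove_of_dual (detForm m) (v := Pi.basisFun ℝ (Fin (m + 1)))
    (c := fun i => LinearMap.proj i) (fun i j => by simp [Pi.single_apply]) (u := y)
    (by rw [(Pi.basisFun ℝ (Fin (m + 1))).span_eq]; trivial) k
  refine ⟨Pi.basisFun ℝ (Fin (m + 1)) ∘ k.succAbove, fun e => ?_⟩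
  rw [AlternatingMap.curryLeft_apply_apply, e, abs_zero, detForm, Module.Basis.det_self, abs_one,
    mul_one, eq_comm, abs_eq_zero] at h
  exact hk h

lemma exists_detForm_mulVec_ne_zero (hZ : InGeneralPosition Z.col) {C : Fin (r + m + 1) → ℝ}
    (hC : Z.mulVec C ≠ 0) :
    ∃ w : Fin m → Fin (r + m + 1) → ℝ,
      detForm m (Matrix.vecCons (Z.mulVec C) fun i => Z.mulVec (w i)) ≠ 0 := by
  obtain ⟨s, hs⟩ := exists_section hZ
  obtain ⟨v, hv⟩ := exists_detForm_vecCons_ne_zero hC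
  exact ⟨fun i => s (v i), by simpa only [hs] using hv⟩

lemma mulVec_vecCons (C : Fin (r + m + 1) → ℝ) (w : Fin m → Fin (r + m + 1) → ℝ) :
    (fun i => Z.mulVec ((Matrix.vecCons C w : Fin (m + 1) → Fin (r + m + 1) → ℝ) i)) =
      Matrix.vecCons (Z.mulVec C) fun i => Z.mulVec (w i) := by
  funext i
  induction i using Fin.cases <;> simp

lemma stdForm_mulVec_eq_zero {Y : Fin (m + 1) → ℝ} {x : Fin m → Fin (r + m + 1) → ℝ} {j : Fin m}
    (hj : Z.mulVec (x j) = 0) :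
    ((stdForm Y).compLinearMap Z.mulVecLin) x = 0 := by
  rw [AlternatingMap.compLinearMap_apply]
  exact AlternatingMap.map_coord_zero _ j (by simpa using hj)

lemma grassmannForm_append {κ : ℝ} (hκ : ∀ u, kernelDet B u = κ * detForm m fun i => Z.mulVec (u i))
    (C : Fin (r + m + 1) → ℝ) (w : Fin m → Fin (r + m + 1) → ℝ) :
    grassmannForm C (Fin.append B.col w) =
      κ * (∏ i, C i)⁻¹ * detForm m (Matrix.vecCons (Z.mulVec C) fun i => Z.mulVec (w i)) := by
  rw [grassmannForm, AlternatingMap.smul_apply, stdForm, AlternatingMap.curryLeft_apply_apply,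
    ← kernelDet_vecCons, hκ, mulVec_vecCons, smul_eq_mul]
  ring

/-- The value of a fiber volume form on the fiber. -/
lemma IsFiberForm.apply_col (hZ : InGeneralPosition Z.col) (hB : IsGaleDual Z B) {κ : ℝ}
    (hκ : ∀ u, kernelDet B u = κ * detForm m fun i => Z.mulVec (u i))
    {ω : (Fin (r + m + 1) → ℝ) → (Fin (r + m + 1) → ℝ) [⋀^Fin r]→ₗ[ℝ] ℝ} (hω : IsFiberForm Z ω)
    {C : Fin (r + m + 1) → ℝ} (hC : ∀ i, C i ≠ 0) (hZC : Z.mulVec C ≠ 0) :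
    ω C B.col = κ * (∏ i, C i)⁻¹ := by
  -- On the arguments `B.col` and `w` the wedge is a single product, whose second factor is nonzero
  -- by the choice of `w`.
  obtain ⟨w, hw⟩ := exists_detForm_mulVec_ne_zero hZ hZC
  have h1 := congrArg (fun f => f (Fin.append B.col w)) (hω C hC hZC).1
  rw [grassmannForm_append hκ, wedge_append _ _ _ _ (by
    rintro x ⟨j, k, hjk⟩
    exact stdForm_mulVec_eq_zero (j := j) (by rw [hjk, hB.mulVec_col]))] at h1
  exact (mul_right_cancel₀ hw h1).symm

/-- A projection to the fiber directions that kills `C` makes the pulled back volume form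
horizontal. It is indexed by the line `L` so that `C` and `t • C` get the same projection, as
homogeneity requires. -/
lemma exists_projection (hB : IsGaleDual Z B) (L : Submodule ℝ (Fin (r + m + 1) → ℝ)) :
    ∃ P : (Fin (r + m + 1) → ℝ) →ₗ[ℝ] (Fin r → ℝ), (∀ k, P (B.col k) = Pi.single k 1) ∧
      ∀ C, Z.mulVec C ≠ 0 → L = Submodule.span ℝ {C} → P C = 0 := by
  obtain ⟨q, hq⟩ := B.mulVecLin.exists_leftInverse_of_injective
    (LinearMap.ker_eq_bot'.mpr fun x hx => hB.eq_zero_of_mulVec hx)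
  have hqB : ∀ k, q (B.col k) = Pi.single k 1 := fun k => by
    have := LinearMap.congr_fun hq (Pi.single k 1)
    simpa using this
  by_cases h : ∃ C, Z.mulVec C ≠ 0 ∧ L = Submodule.span ℝ {C}
  · obtain ⟨C₀, hC₀, hL⟩ := h
    obtain ⟨j, hj⟩ := Function.ne_iff.mp hC₀
    let ψ : (Fin (r + m + 1) → ℝ) →ₗ[ℝ] ℝ :=
      (Z.mulVec C₀ j)⁻¹ • (LinearMap.proj j ∘ₗ Z.mulVecLin)
    have hψ0 : ψ C₀ = 1 := by simp [ψ]; exact inv_mul_cancel₀ hj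
    refine ⟨q - ψ.smulRight (q C₀), fun k => ?_, fun C _ hC => ?_⟩
    · have : ψ (B.col k) = 0 := by simp [ψ, hB.mulVec_col k]
      simp [this, hqB k]
    · have hmem : C ∈ Submodule.span ℝ {C₀} := by
        rw [← hL, hC]; exact Submodule.mem_span_singleton_self C
      obtain ⟨t, rfl⟩ := Submodule.mem_span_singleton.mp hmem
      simp [hψ0]
  · exact ⟨q, hqB, fun C hC hL => absurd ⟨C, hC, hL⟩ h⟩

/-- Take `κ / ∏ C i` times the determinant of the projection. Scaling contributes `r` from the
arguments and `-(r + m + 1)` from the product, in total `-(m + 1)`. -/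
theorem exists_isFiberForm (hZ : InGeneralPosition Z.col) (hB : IsGaleDual Z B) :
    ∃ ω, IsFiberForm Z ω := by
  obtain ⟨κ, hκ⟩ := hB.kernelDet_eq hZ
  obtain ⟨J, -, hJ⟩ := Finset.exists_subset_card_eq (n := m + 1)
    (s := (Finset.univ : Finset (Fin (r + m + 1)))) (by simp)
  have hκ0 : κ ≠ 0 := by
    rintro rfl
    have h := abs_kappa_mul_absDet hκ hJ
    rw [abs_zero, zero_mul, eq_comm, abs_eq_zero] at h
    have hu := hB.isUnit_complMinor hZ hJ
    rw [Matrix.isUnit_iff_isUnit_det, h] at hu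
    exact not_isUnit_zero hu
  choose P hPB hPC using exists_projection (Z := Z) (B := B) hB
  let δ : (Fin r → ℝ) [⋀^Fin r]→ₗ[ℝ] ℝ := (Pi.basisFun ℝ (Fin r)).det
  refine ⟨fun C => (κ * (∏ i, C i)⁻¹) • δ.compLinearMap (P (Submodule.span ℝ {C})),
    fun C hC hZC => ⟨?_, ?_, ?_⟩⟩
  · obtain ⟨w, hw⟩ := exists_detForm_mulVec_ne_zero hZ hZC
    set ω : (Fin (r + m + 1) → ℝ) [⋀^Fin r]→ₗ[ℝ] ℝ :=
      (κ * (∏ i, C i)⁻¹) • δ.compLinearMap (P (Submodule.span ℝ {C})) with hω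
    have hωB : ω B.col = κ * (∏ i, C i)⁻¹ := by
      have : (fun i => P (Submodule.span ℝ {C}) (B.col i)) = Pi.basisFun ℝ (Fin r) := by
        funext i; rw [hPB]; simp
      rw [hω, AlternatingMap.smul_apply, AlternatingMap.compLinearMap_apply, smul_eq_mul]
      have h2 : δ (fun i => P (Submodule.span ℝ {C}) (B.col i)) = 1 := by
        rw [this]; exact Module.Basis.det_self _
      rw [h2, mul_one]
    have hdet : detForm (r + m) (Matrix.vecCons C (Fin.append B.col w)) ≠ 0 := by
      rw [← kernelDet_vecCons, hκ, mulVec_vecCons]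
      exact mul_ne_zero hκ0 hw
    have hbas := (Module.Basis.is_basis_iff_det (Pi.basisFun ℝ (Fin (r + m + 1)))
      (v := Matrix.vecCons C (Fin.append B.col w))).mpr (isUnit_iff_ne_zero.mpr hdet)
    let b := Module.Basis.mk hbas.1 hbas.2.ge
    have hb : ∀ i, b i = Matrix.vecCons C (Fin.append B.col w) i := fun i => by
      simp [b]
    -- In the basis `C`, `B.col`, `w`, both sides vanish on tuples containing `C`; all other tuples
    -- of distinct basis vectors are permutations of `B.col`, `w`.
    refine b.ext_alternating fun f hf => ?_
    by_cases h0 : ∃ j, f j = 0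
    · obtain ⟨j, hj⟩ := h0
      have hCj : b (f j) = C := by rw [hj, hb]; rfl
      rw [wedge_eq_zero _ _ (c := C) ?_ ?_ ⟨j, hCj⟩]
      · rw [grassmannForm, AlternatingMap.smul_apply, stdForm,
          AlternatingMap.curryLeft_apply_apply]
        rw [AlternatingMap.map_eq_zero_of_eq _ _ (i := 0) (j := j.succ) (by simp [hCj])
          (Fin.succ_ne_zero j).symm, smul_zero]
      · rintro x ⟨k, hk⟩
        change ω x = 0
        rw [hω, AlternatingMap.smul_apply, AlternatingMap.compLinearMap_apply,
          AlternatingMap.map_coord_zero _ k (by rw [hk]; exact hPC _ C hZC rfl), smul_zero]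
      · rintro x ⟨k, hk⟩
        rw [AlternatingMap.compLinearMap_apply, stdForm, AlternatingMap.curryLeft_apply_apply]
        exact AlternatingMap.map_eq_zero_of_eq _ _ (i := 0) (j := k.succ) (by simp [hk])
          (Fin.succ_ne_zero k).symm
    · push Not at h0
      choose g hg using fun j => Fin.exists_succ_eq.mpr (h0 j)
      have hginj : Function.Injective g := fun i j e => hf (by rw [← hg i, ← hg j, e])
      let τ : Equiv.Perm (Fin (r + m)) :=
        Equiv.ofBijective g (Finite.injective_iff_bijective.mp hginj)
      have e : (fun j => b (f j)) = Fin.append B.col w ∘ τ := by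
        funext j
        rw [hb, ← hg j]
        rfl
      rw [e, AlternatingMap.map_perm, AlternatingMap.map_perm, grassmannForm_append hκ,
        wedge_append, hωB]
      · rfl
      · rintro x ⟨j, k, hjk⟩
        exact stdForm_mulVec_eq_zero (j := j) (by rw [hjk, hB.mulVec_col])
  · rintro v ⟨j, hj⟩
    rw [AlternatingMap.smul_apply, AlternatingMap.compLinearMap_apply,
      AlternatingMap.map_coord_zero _ j (by rw [hj]; exact hPC _ C hZC rfl), smul_zero]
  · intro t ht v
    have hspan : Submodule.span ℝ {t • C} = Submodule.span ℝ {C} :=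
      Submodule.span_singleton_smul_eq (isUnit_iff_ne_zero.mpr ht) C
    have hδ := δ.toMultilinearMap.map_smul_univ (fun _ => t)
      (fun i => P (Submodule.span ℝ {C}) (v i))
    simp only [AlternatingMap.coe_multilinearMap, Finset.prod_const, Finset.card_univ,
      Fintype.card_fin, smul_eq_mul] at hδ
    dsimp only
    rw [hspan]
    simp only [AlternatingMap.smul_apply, AlternatingMap.compLinearMap_apply, map_smul, smul_eq_mul,
      Pi.smul_apply, Finset.prod_mul_distrib, Finset.prod_const, Finset.card_univ,
      Fintype.card_fin, hδ]
    have hp : (∏ i, C i) ≠ 0 := Finset.prod_ne_zero_iff.mpr fun i _ => hC i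
    field_simp
    ring

lemma exists_isGaleDual (hZ : InGeneralPosition Z.col) :
    ∃ B : Matrix (Fin (r + m + 1)) (Fin r) ℝ, IsGaleDual Z B := by
  obtain ⟨s, hs⟩ := exists_section hZ
  have hr : Module.finrank ℝ (LinearMap.ker Z.mulVecLin) = r := by
    have h := Z.mulVecLin.finrank_range_add_finrank_ker
    rw [LinearMap.range_eq_top.mpr fun y => ⟨s y, hs y⟩, finrank_top] at h
    simp at h
    omega
  let b := Module.finBasisOfFinrankEq ℝ (LinearMap.ker Z.mulVecLin) hr
  refine ⟨Matrix.of fun i k => (b k : Fin (r + m + 1) → ℝ) i, ?_, ?_⟩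
  · exact b.linearIndependent.map' (LinearMap.ker Z.mulVecLin).subtype (Submodule.ker_subtype _)
  · have : Set.range (Matrix.of fun i k => (b k : Fin (r + m + 1) → ℝ) i).col =
        (LinearMap.ker Z.mulVecLin).subtype '' Set.range b := by
      rw [← Set.range_comp]; rfl
    rw [this, Submodule.span_image, b.span_eq, Submodule.map_top, Submodule.range_subtype]

end fiberForm

/-! ### Regular subdivisions and cones of the secondary fan -/

section regularSubdivision

variable {m r : ℕ} {Z : Matrix (Fin (m + 1)) (Fin (r + m + 1)) ℝ}
  {B : Matrix (Fin (r + m + 1)) (Fin r) ℝ} {h h' : Fin (r + m + 1) → ℝ}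
  {J : Finset (Fin (r + m + 1))}

lemma mem_regularCells : J ∈ regularCells Z h ↔ ∃ ψ : (Fin (m + 1) → ℝ) →ₗ[ℝ] ℝ,
    (∀ i, ψ (Z.col i) ≤ h i) ∧ ∀ i, i ∈ J ↔ ψ (Z.col i) = h i := by
  constructor
  · rintro ⟨φ, hφ⟩
    exact ⟨dotProductEquiv ℝ _ φ, hφ⟩
  · rintro ⟨ψ, hψ⟩
    obtain ⟨φ, rfl⟩ := (dotProductEquiv ℝ (Fin (m + 1))).surjective ψ
    exact ⟨φ, hψ⟩

lemma regularCells_subset_add (h : Fin (r + m + 1) → ℝ) (ψ : (Fin (m + 1) → ℝ) →ₗ[ℝ] ℝ) :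
    regularCells Z h ⊆ regularCells Z fun i => h i + ψ (Z.col i) := by
  intro J hJ
  obtain ⟨φ, h1, h2⟩ := mem_regularCells.mp hJ
  refine mem_regularCells.mpr ⟨φ + ψ, fun i => ?_, fun i => ?_⟩
  · simpa using h1 i
  · rw [h2, LinearMap.add_apply, add_left_inj]

lemma regularCells_add (h : Fin (r + m + 1) → ℝ) (ψ : (Fin (m + 1) → ℝ) →ₗ[ℝ] ℝ) :
    (regularCells Z fun i => h i + ψ (Z.col i)) = regularCells Z h := by
  refine Set.Subset.antisymm ?_ (regularCells_subset_add h ψ)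
  simpa using regularCells_subset_add (Z := Z) (fun i => h i + ψ (Z.col i)) (-ψ)

lemma IsGaleDual.regularCells_eq (hZ : InGeneralPosition Z.col) (hB : IsGaleDual Z B)
    (e : B.vecMul h' = B.vecMul h) : regularCells Z h' = regularCells Z h := by
  obtain ⟨ψ, rfl⟩ := hB.exists_eq_add hZ e
  exact regularCells_add h ψ

lemma mem_lowerSimplices_of_mem_regularCells (hZ : InGeneralPosition Z.col) (hJ : J.card = m + 1)
    (h0 : J ∈ regularCells Z h) : J ∈ lowerSimplices Z.col h := by
  obtain ⟨φ, h1, h2⟩ := mem_regularCells.mp h0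
  have : interp Z.col J h = φ :=
    ext_of_eq hZ hJ fun j hj => by rw [interp_apply hZ hJ h hj, (h2 j).mp hj]
  exact mem_lowerSimplices.mpr ⟨hJ, fun i => by rw [this]; exact h1 i⟩

lemma IsSimplicialHeight.mem_regularCells (hZ : InGeneralPosition Z.col)
    (hh : IsSimplicialHeight Z.col h) (hJ : J ∈ lowerSimplices Z.col h) :
    J ∈ regularCells Z h := by
  obtain ⟨hc, hle⟩ := mem_lowerSimplices.mp hJ
  exact JKPolytope.mem_regularCells.mpr ⟨interp Z.col J h, hle, fun i =>
    ⟨fun hi => interp_apply hZ hc h hi, fun e => by_contra fun hi => (hh J hJ i hi).ne e⟩⟩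

/-- A spanning cell contains `m + 1` labels on which its linear form is the interpolation, so they
form a lower simplex; by strictness the cell has no further label. -/
lemma IsSimplicialHeight.maximal_regularCells (hZ : InGeneralPosition Z.col)
    (hh : IsSimplicialHeight Z.col h) :
    {J ∈ regularCells Z h | Submodule.span ℝ (Z.col '' J) = ⊤} = ↑(lowerSimplices Z.col h) := by
  ext J
  constructor
  · rintro ⟨hJ, hspan⟩
    have hcard : m + 1 ≤ J.card := by
      classical
      have h1 := finrank_span_finset_le_card (R := ℝ) (J.image Z.col)
      rw [Finset.coe_image, Set.finrank, hspan, finrank_top, Module.finrank_fin_fun] at h1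
      exact h1.trans Finset.card_image_le
    obtain ⟨K, hKJ, hK⟩ := Finset.exists_subset_card_eq hcard
    obtain ⟨φ, h1, h2⟩ := JKPolytope.mem_regularCells.mp hJ
    have hφ : interp Z.col K h = φ :=
      ext_of_eq hZ hK fun j hj => by rw [interp_apply hZ hK h hj, (h2 j).mp (hKJ hj)]
    have hKl : K ∈ lowerSimplices Z.col h :=
      mem_lowerSimplices.mpr ⟨hK, fun i => by rw [hφ]; exact h1 i⟩
    have : J = K := Finset.Subset.antisymm (fun i hi => by_contra fun hiK =>
      (hh K hKl i hiK).ne (by rw [hφ, (h2 i).mp hi])) hKJ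
    rwa [this]
  · exact fun hJ => ⟨hh.mem_regularCells hZ hJ, span_eq_top hZ (mem_lowerSimplices.mp hJ).1⟩

/-- Heights are simplicial if the regular subdivision does not change under some perturbation of
every single height. -/
lemma isSimplicialHeight_of_regularCells (hZ : InGeneralPosition Z.col)
    (H : ∀ i, ∃ ε : ℝ, ε ≠ 0 ∧ regularCells Z (h + Pi.single i ε) = regularCells Z h) :
    IsSimplicialHeight Z.col h := by
  intro J hJ i hi
  obtain ⟨hc, hle⟩ := mem_lowerSimplices.mp hJ
  refine lt_of_le_of_ne (hle i) fun e => ?_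
  obtain ⟨ε, hε, hcells⟩ := H i
  set φ := interp Z.col J h with hφ
  -- The cell of `φ` contains `J` and `i`. As a cell of the perturbed heights it has a form that
  -- still agrees with `φ` on `J`, hence equals `φ`, and so misses the new height at `i`.
  have hK : (Finset.univ.filter fun l => φ (Z.col l) = h l) ∈ regularCells Z h :=
    mem_regularCells.mpr ⟨φ, hle, fun l => by simp⟩
  rw [← hcells] at hK
  obtain ⟨φ', -, h2⟩ := mem_regularCells.mp hK
  simp only [Finset.mem_filter, Finset.mem_univ, true_and] at h2
  have hφφ' : φ' = φ := ext_of_eq hZ hc fun j hj => by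
    have hj' := interp_apply hZ hc h hj
    have hji : j ≠ i := fun e => hi (e ▸ hj)
    rw [(h2 j).mp hj', Pi.add_apply, Pi.single_eq_of_ne hji, add_zero, hj']
  have := (h2 i).mp e
  rw [hφφ', e, Pi.add_apply, Pi.single_eq_same, left_eq_add] at this
  exact hε this

section fan

variable {σ : Set (Fin r → ℝ)}

lemma regularCells_eq_of_mem_secondaryFan (hZ : InGeneralPosition Z.col) (hB : IsGaleDual Z B)
    (hσ : σ ∈ secondaryFan Z B) (h1 : B.vecMul h ∈ σ) (h2 : B.vecMul h' ∈ σ) :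
    regularCells Z h' = regularCells Z h := by
  obtain ⟨h₀, rfl⟩ := hσ
  obtain ⟨k, hk, hk'⟩ := h1
  obtain ⟨l, hl, hl'⟩ := h2
  rw [hB.regularCells_eq hZ hk.symm, hB.regularCells_eq hZ hl.symm, hk', hl']

/-- Changing the height at `i` moves `hB` along the row `B i`; small moves stay in `σ` and so keep
the subdivision. -/
lemma isSimplicialHeight_of_mem_interior (hZ : InGeneralPosition Z.col) (hB : IsGaleDual Z B)
    (hσ : σ ∈ secondaryFan Z B) (hh : B.vecMul h ∈ interior σ) : IsSimplicialHeight Z.col h := by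
  refine isSimplicialHeight_of_regularCells hZ fun i => ?_
  have hc : Continuous fun ε : ℝ => B.vecMul h + ε • B i := by fun_prop
  have h1 : ∀ᶠ ε : ℝ in 𝓝 0, B.vecMul h + ε • B i ∈ σ :=
    hc.continuousAt.eventually (by simpa using mem_interior_iff_mem_nhds.mp hh)
  obtain ⟨ε, hε, hε0⟩ := ((h1.filter_mono nhdsWithin_le_nhds).and
    (eventually_mem_nhdsWithin (a := (0 : ℝ)) (s := {0}ᶜ))).exists
  refine ⟨ε, hε0, regularCells_eq_of_mem_secondaryFan hZ hB hσ (interior_subset hh) ?_⟩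
  rw [Matrix.add_vecMul, Matrix.single_vecMul]
  exact hε

/-- All points of `σ` have the same cells, and lower simplices are cells at an interior point, so
one interior point decides for the whole of `σ`. -/
lemma subset_posCone_compl_iff (hZ : InGeneralPosition Z.col) (hB : IsGaleDual Z B)
    (hσ : σ ∈ secondaryFan Z B) (hh : B.vecMul h ∈ interior σ) (hJ : J.card = m + 1) :
    σ ⊆ posCone B Jᶜ ↔ J ∈ lowerSimplices Z.col h := by
  constructor
  · intro hs
    exact (hB.vecMul_mem_posCone_iff hZ hJ h).mp (hs (interior_subset hh))
  · intro hJl ξ hξ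
    obtain ⟨h', hh'⟩ : ∃ h', B.vecMul h' = ξ := by
      obtain ⟨h₀, rfl⟩ := hσ
      obtain ⟨h', h1, -⟩ := hξ
      exact ⟨h', h1⟩
    subst hh'
    rw [hB.vecMul_mem_posCone_iff hZ hJ]
    refine mem_lowerSimplices_of_mem_regularCells hZ hJ ?_
    rw [regularCells_eq_of_mem_secondaryFan hZ hB hσ (interior_subset hh) hξ]
    exact (isSimplicialHeight_of_mem_interior hZ hB hσ hh).mem_regularCells hZ hJl

lemma card_compl_eq_iff : Jᶜ.card = r ↔ J.card = m + 1 := by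
  refine ⟨fun hJ => ?_, card_compl_eq⟩
  have := J.card_add_card_compl
  rw [hJ, Fintype.card_fin] at this
  omega

lemma setOf_subset_posCone (hZ : InGeneralPosition Z.col) (hB : IsGaleDual Z B)
    (hσ : σ ∈ secondaryFan Z B) (hh : B.vecMul h ∈ interior σ) :
    {J | Jᶜ.card = r ∧ σ ⊆ posCone B Jᶜ} = ↑(lowerSimplices Z.col h) := by
  ext J
  rw [Set.mem_ofPred_eq, card_compl_eq_iff, Finset.mem_coe]
  exact ⟨fun hJ => (subset_posCone_compl_iff hZ hB hσ hh hJ.1).mp hJ.2, fun hJ =>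
    ⟨(mem_lowerSimplices.mp hJ).1,
      (subset_posCone_compl_iff hZ hB hσ hh (mem_lowerSimplices.mp hJ).1).mpr hJ⟩⟩

lemma IsSimplicialHeight.isRegularTriangulation (hZ : IsTotallyPositive Z)
    (hh : IsSimplicialHeight Z.col h) :
    IsRegularTriangulation Z h ↑(lowerSimplices Z.col h) := by
  have hz := hZ.inGeneralPosition
  have hmn : m < r + m + 1 := by omega
  refine ⟨(hh.maximal_regularCells hz).symm, fun J hJ => hz J (mem_lowerSimplices.mp hJ).1,
    fun J hJ J' hJ' => posCone_inter hz hh hJ hJ', ?_⟩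
  rw [amplituhedronCone_eq, ← iUnion_posCone hz hmn
    (lowerSimplices_nonempty hz hmn (hZ.facets_nonempty hmn) hh)]
  rfl

lemma sum_lowerSimplices (hZ : InGeneralPosition Z.col) (hB : IsGaleDual Z B)
    (h : Fin (r + m + 1) → ℝ) (g : Finset (Fin (r + m + 1)) → ℝ)
    [DecidablePred fun I => B.vecMul h ∈ posCone B I] :
    ∑ J ∈ lowerSimplices Z.col h, g J =
      ∑ I : Finset (Fin (r + m + 1)) with I.card = r ∧ B.vecMul h ∈ posCone B I, g Iᶜ := by
  refine Finset.sum_nbij' compl compl ?_ ?_ (fun J _ => compl_compl J) (fun J _ => compl_compl J)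
    fun J _ => by rw [compl_compl]
  · intro J hJ
    have hc := (mem_lowerSimplices.mp hJ).1
    simpa [hB.vecMul_mem_posCone_iff hZ hc, hJ] using card_compl_eq hc
  · intro I hI
    simp only [Finset.mem_filter, Finset.mem_univ, true_and] at hI
    have hc : Iᶜ.card = m + 1 := card_compl_eq_iff.mp (by rw [compl_compl]; exact hI.1)
    rw [← hB.vecMul_mem_posCone_iff hZ hc, compl_compl]
    exact hI.2

end fan

end regularSubdivision

/-! ### Canonical functions as sums over a triangulation -/

section canonicalFunction

variable {m n : ℕ} {z : Fin n → Fin (m + 1) → ℝ} {h : Fin n → ℝ}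

lemma wall_ne_zero_of_notMem_span (hz : InGeneralPosition z) (hmn : m < n) {F : Finset (Fin n)}
    (hF : F.card = m) {Y : Fin (m + 1) → ℝ} (hY : Y ∉ Submodule.span ℝ (z '' F)) :
    wall z F Y ≠ 0 := by
  classical
  intro e
  obtain ⟨j, -, hj⟩ := Finset.exists_mem_notMem_of_card_lt_card
    (s := F) (t := Finset.univ) (by simpa [hF] using hmn)
  have hc : (insert j F).card = m + 1 := by rw [Finset.card_insert_of_notMem hj, hF]
  refine hY ?_
  rw [eq_sum_coord hz hc Y, Finset.sum_insert hj]
  have h0 : coord z (insert j F) j Y = 0 := by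
    rw [coord, Finset.erase_insert hj, LinearMap.smul_apply, e, smul_zero]
  rw [h0, zero_smul, zero_add]
  exact Submodule.sum_mem _ fun i hi => Submodule.smul_mem _ _ (Submodule.subset_span ⟨i, hi, rfl⟩)

lemma coord_ne_zero (hz : InGeneralPosition z) {J : Finset (Fin n)} (hJ : J.card = m + 1)
    {Y : Fin (m + 1) → ℝ} (hY : ∀ F : Finset (Fin n), F.card = m → wall z F Y ≠ 0)
    {j : Fin n} (hj : j ∈ J) : coord z J j Y ≠ 0 := by
  have hc : (J.erase j).card = m := by rw [Finset.card_erase_of_mem hj, hJ]; rfl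
  exact mul_ne_zero (inv_ne_zero (wall_ne_zero hz hc (Finset.notMem_erase j J))) (hY _ hc)

/-- A pointed cone in the line is a ray. -/
lemma posCone_eq_posCone_univ {z : Fin n → Fin 1 → ℝ} (hz : InGeneralPosition z)
    (hfac : (facets z).Nonempty) {J : Finset (Fin n)} (hJ : J.card = 1) :
    posCone z J = posCone z Finset.univ := by
  refine Set.Subset.antisymm (posCone_mono z (Finset.subset_univ J)) fun Y hY => ?_
  obtain ⟨F, hF⟩ := hfac
  rw [mem_facets] at hF
  refine (mem_posCone_iff_coord hz hJ).mpr fun j hj => nonneg_of_mem_posCone (fun i _ => ?_) hY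
  have : J.erase j = F := by
    rw [Finset.card_eq_zero.mp hF.1, ← Finset.card_eq_zero, Finset.card_erase_of_mem hj, hJ]
  rw [coord, this, LinearMap.smul_apply]
  exact mul_nonneg (inv_nonneg.mpr (hF.2 j)) (hF.2 i)

/-- The canonical function of a polytope with vertices in general position is the sum of the
canonical functions of the simplices of a regular triangulation. -/
theorem exists_isCanonicalFunction (hz : InGeneralPosition z) (hmn : m < n)
    (hfac : (facets z).Nonempty) (hh : IsSimplicialHeight z h) :
    ∃ f, IsCanonicalFunction m (posCone z Finset.univ) (detForm m) f ∧
      ∀ Y, (∀ F : Finset (Fin n), F.card = m → wall z F Y ≠ 0) →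
        f Y = ∑ J ∈ lowerSimplices z h, simplexFunction z J Y := by
  rcases m with _ | m
  · obtain ⟨J, hJ⟩ := lowerSimplices_nonempty hz hmn hfac hh
    have hc := (mem_lowerSimplices.mp hJ).1
    refine ⟨simplexFunction z J, ?_, fun Y _ => ?_⟩
    · rw [← posCone_eq_posCone_univ hz hfac hc]
      exact isCanonicalFunction_simplexFunction hz hc
    -- For `m = 0` every simplex is the whole ray; two different ones would meet only in `0`.
    · have huniq : lowerSimplices z h = {J} := by
        refine Finset.eq_singleton_iff_unique_mem.mpr ⟨hJ, fun J' hJ' => ?_⟩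
        have hc' := (mem_lowerSimplices.mp hJ').1
        by_contra hne
        have h1 := posCone_inter hz hh hJ hJ'
        have h2 : J ∩ J' = ∅ := by
          obtain ⟨j, rfl⟩ := Finset.card_eq_one.mp hc
          obtain ⟨j', rfl⟩ := Finset.card_eq_one.mp hc'
          rw [Finset.singleton_inter_of_notMem]
          simpa [eq_comm] using hne
        rw [posCone_eq_posCone_univ hz hfac hc, posCone_eq_posCone_univ hz hfac hc',
          Set.inter_self, h2] at h1
        have h3 := span_eq_top hz hc
        rw [← span_posCone, posCone_eq_posCone_univ hz hfac hc, h1, span_posCone] at h3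
        simp at h3
      rw [huniq, Finset.sum_singleton]
  · exact exists_isCanonicalFunction_polytope hz hmn hfac hh

lemma canonicalFunction_posCone (hz : InGeneralPosition z) {J : Finset (Fin n)}
    (hJ : J.card = m + 1) : canonicalFunction (posCone z J) = simplexFunction z J :=
  canonicalFunction_eq (by rw [span_posCone]; exact span_eq_top hz hJ)
    (isCanonicalFunction_simplexFunction hz hJ)

lemma canonicalFunction_posCone_univ (hz : InGeneralPosition z) (hmn : m < n)
    (hfac : (facets z).Nonempty) (hh : IsSimplicialHeight z h) {Y : Fin (m + 1) → ℝ}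
    (hY : ∀ F : Finset (Fin n), F.card = m → wall z F Y ≠ 0) :
    canonicalFunction (posCone z Finset.univ) Y =
      ∑ J ∈ lowerSimplices z h, simplexFunction z J Y := by
  obtain ⟨f, hf, hfY⟩ := exists_isCanonicalFunction hz hmn hfac hh
  rw [canonicalFunction_eq (span_posCone_univ_eq_top hz hmn) hf, hfY Y hY]

end canonicalFunction

/-! ### The residue on the fibers -/

section jeffreyKirwan

variable {m r : ℕ} {Z : Matrix (Fin (m + 1)) (Fin (r + m + 1)) ℝ}
  {B : Matrix (Fin (r + m + 1)) (Fin r) ℝ} {κ : ℝ} {Y : Fin (m + 1) → ℝ}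

lemma ne_zero_of_wall_ne_zero {n : ℕ} {z : Fin n → Fin (m + 1) → ℝ} (hmn : m < n)
    (hY : ∀ F : Finset (Fin n), F.card = m → wall z F Y ≠ 0) : Y ≠ 0 := by
  rintro rfl
  obtain ⟨F, -, hF⟩ := Finset.exists_subset_card_eq (n := m)
    (s := (Finset.univ : Finset (Fin n))) (by simpa using hmn.le)
  exact hY F hF (map_zero _)

/-- There are positive vectors outside the kernel. -/
lemma exists_pos_mulVec_ne_zero (hZ : InGeneralPosition Z.col) :
    ∃ C : Fin (r + m + 1) → ℝ, (∀ i, 0 < C i) ∧ Z.mulVec C ≠ 0 := by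
  by_cases h1 : Z.mulVec 1 = 0
  · refine ⟨1 + Pi.single 0 1, fun i => ?_, ?_⟩
    · have : (0 : ℝ) ≤ (Pi.single 0 1 : Fin (r + m + 1) → ℝ) i := by
        rw [Pi.single_apply]; split_ifs <;> norm_num
      simp only [Pi.add_apply, Pi.one_apply]
      linarith
    · rw [Matrix.mulVec_add, h1, zero_add, Matrix.mulVec_single_one]
      obtain ⟨J, h0, -, hJ⟩ := Finset.exists_subsuperset_card_eq (n := m + 1)
        (Finset.subset_univ ({0} : Finset (Fin (r + m + 1)))) (by simp) (by simp)
      exact (hZ J hJ).ne_zero (i := 0) (h0 (Finset.mem_singleton_self 0))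
  · exact ⟨1, fun i => one_pos, h1⟩

lemma IsFiberForm.kappa_pos (hZ : InGeneralPosition Z.col) (hB : IsGaleDual Z B)
    (hκ : ∀ u, kernelDet B u = κ * detForm m fun i => Z.mulVec (u i))
    {ω : (Fin (r + m + 1) → ℝ) → (Fin (r + m + 1) → ℝ) [⋀^Fin r]→ₗ[ℝ] ℝ} (hω : IsFiberForm Z ω)
    (hpos : ∀ C : Fin (r + m + 1) → ℝ, (∀ i, 0 < C i) → 0 < ω C B.col) : 0 < κ := by
  obtain ⟨C, hC, hZC⟩ := exists_pos_mulVec_ne_zero hZ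
  have h1 := hpos C hC
  rw [hω.apply_col hZ hB hκ (fun i => (hC i).ne') hZC] at h1
  exact (mul_pos_iff_of_pos_right (inv_pos.mpr (Finset.prod_pos fun i _ => hC i))).mp h1

lemma affForm_eq (B : Matrix (Fin (r + m + 1)) (Fin r) ℝ) (c : Fin (r + m + 1) → ℝ)
    (i : Fin (r + m + 1)) (x : Fin r → ℝ) : affForm B c i x = (c + B.mulVec x) i :=
  add_comm _ _

lemma continuous_affForm (B : Matrix (Fin (r + m + 1)) (Fin r) ℝ) (c : Fin (r + m + 1) → ℝ)
    (i : Fin (r + m + 1)) : Continuous (affForm B c i) := by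
  unfold affForm
  fun_prop

/-- The vertex of the arrangement on the fiber at which the `D_i`, `i ∉ J`, vanish. -/
lemma exists_vertex (hZ : InGeneralPosition Z.col) (hB : IsGaleDual Z B)
    {J : Finset (Fin (r + m + 1))} (hJ : J.card = m + 1) {c : Fin (r + m + 1) → ℝ}
    (hc : Z.mulVec c = Y) :
    ∃ q, (∀ i ∉ J, affForm B c i q = 0) ∧ ∀ j ∈ J, affForm B c j q = coord Z.col J j Y := by
  classical
  set C : Fin (r + m + 1) → ℝ := fun j => if j ∈ J then coord Z.col J j Y else 0 with hC
  have hZC : Z.mulVec C = Y := by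
    conv_rhs => rw [eq_sum_coord hZ hJ Y]
    rw [mulVec_eq_sum_col]
    simp [hC, ite_smul]
  obtain ⟨q, hq⟩ := hB.exists_mulVec_eq (C := C - c) (by rw [Matrix.mulVec_sub, hZC, hc, sub_self])
  have h1 : ∀ i, affForm B c i q = C i := fun i => by rw [affForm_eq, hq]; simp
  exact ⟨q, fun i hi => by rw [h1, hC]; simp [hi], fun j hj => by rw [h1, hC]; simp [hj]⟩

/-- The extended Jeffrey-Kirwan residue of the fiber volume form. -/
theorem hasJKResidue_fiberForm (hZ : InGeneralPosition Z.col) (hB : IsGaleDual Z B)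
    (hκ : ∀ u, kernelDet B u = κ * detForm m fun i => Z.mulVec (u i)) (hκ0 : 0 < κ)
    {ω : (Fin (r + m + 1) → ℝ) → (Fin (r + m + 1) → ℝ) [⋀^Fin r]→ₗ[ℝ] ℝ} (hω : IsFiberForm Z ω)
    (hY : ∀ F : Finset (Fin (r + m + 1)), F.card = m → wall Z.col F Y ≠ 0)
    {c : Fin (r + m + 1) → ℝ} (hc : Z.mulVec c = Y) (h : Fin (r + m + 1) → ℝ) :
    HasJKResidue B c (pullbackCoeff ω B c) (B.vecMul h)
      (∑ J ∈ lowerSimplices Z.col h, simplexFunction Z.col J Y) := by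
  classical
  have hcard : ∀ I : {I : Finset (Fin (r + m + 1)) // I.card = r}, (I.1ᶜ).card = m + 1 :=
    fun I => card_compl_eq_iff.mp (by rw [compl_compl]; exact I.2)
  have hY0 : Y ≠ 0 := ne_zero_of_wall_ne_zero (by omega) hY
  -- Multiplying `κ / ∏ D_i` by the `D_i` with `i ∈ I` leaves the others, whose values at `q_I` are
  -- the coordinates of `Y`.
  refine ⟨fun I => κ * (∏ j ∈ I.1ᶜ, coord Z.col I.1ᶜ j Y)⁻¹, fun I => ?_, ?_⟩
  · obtain ⟨q, hq0, hq1⟩ := exists_vertex hZ hB (hcard I) hc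
    have hI : ∀ i, i ∈ I.1 ↔ i ∉ I.1ᶜ := by simp
    refine ⟨q, ⟨fun i hi => hq0 i ((hI i).mp hi), fun j hj => ?_, ?_, ?_⟩, fun q' hq' => ?_⟩
    · rw [hq1 j (by simpa using hj)]
      exact coord_ne_zero hZ (hcard I) hY (by simpa using hj)
    · have := hB.linearIndependent_rows hZ (hcard I)
      rwa [compl_compl] at this
    · have hlim : Tendsto (fun x => κ * (∏ j ∈ I.1ᶜ, affForm B c j x)⁻¹) (𝓝 q)
          (𝓝 (κ * (∏ j ∈ I.1ᶜ, coord Z.col I.1ᶜ j Y)⁻¹)) := by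
        refine Tendsto.const_mul κ (Tendsto.inv₀ (tendsto_finsetProd _ fun j hj => ?_)
          (Finset.prod_ne_zero_iff.mpr fun j hj => coord_ne_zero hZ (hcard I) hY hj))
        rw [← hq1 j hj]
        exact (continuous_affForm B c j).continuousAt
      refine (hlim.mono_left nhdsWithin_le_nhds).congr' ?_
      filter_upwards [eventually_mem_nhdsWithin] with x hx
      have hZC : Z.mulVec (c + B.mulVec x) = Y := by
        rw [Matrix.mulVec_add, hc, hB.mulVec_eq_zero, add_zero]
      rw [pullbackCoeff, hω.apply_col hZ hB hκ (fun i => by rw [← affForm_eq]; exact hx i)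
        (by rwa [hZC])]
      simp only [← affForm_eq]
      rw [← Finset.prod_mul_prod_compl I.1]
      have : ∏ i ∈ I.1, affForm B c i x ≠ 0 := Finset.prod_ne_zero_iff.mpr fun i _ => hx i
      field_simp
    · rw [← sub_eq_zero]
      refine hB.eq_zero_of_dotProduct hZ (hcard I) fun i hi => ?_
      rw [compl_compl] at hi
      have h1 := hq'.1 i hi
      have h2 := hq0 i ((hI i).mp hi)
      change B i ⬝ᵥ q' + c i = 0 at h1
      change B i ⬝ᵥ q + c i = 0 at h2
      rw [dotProduct_sub]
      linarith
  · rw [sum_lowerSimplices hZ hB, ← Finset.filter_filter, Finset.sum_filter,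
      Finset.sum_subtype (p := fun I => I.card = r) _ (by simp)]
    refine Finset.sum_congr rfl fun I _ => ?_
    unfold jkBasic
    split_ifs
    -- The classical residue divides by `|det B_I| = κ |det Z_J|`, which cancels `κ` and leaves the
    -- canonical function of the simplex.
    · have h1 := abs_kappa_mul_absDet hκ (hcard I)
      have h2 : |(complMinor B (card_compl_eq (hcard I))).det| =
          |(Matrix.of fun a => B (I.1.orderEmbOfFin I.2 a)).det| := by
        simp only [complMinor, compl_compl]
      rw [h2, abs_of_pos hκ0] at h1
      rw [← h1, simplexFunction]
      have := (absDet_pos hZ (hcard I)).ne'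
      have h3 := Finset.prod_ne_zero_iff.mpr fun j hj => coord_ne_zero hZ (hcard I) hY hj
      field_simp
    · rw [mul_zero]

end jeffreyKirwan

end JKPolytope

end

/-! ### The proposition -/

open Classical in
theorem mainTheorem7 (m r : ℕ) (Z : Matrix (Fin (m + 1)) (Fin (r + m + 1)) ℝ)
    (hZ : JKPolytope.IsTotallyPositive Z) :
    -- the canonical functions and the fiber volume form exist, the former uniquely
    (∃! f, JKPolytope.IsCanonicalFunction m (JKPolytope.amplituhedronCone Z)
      (JKPolytope.detForm m) f) ∧
    (∀ J : Finset (Fin (r + m + 1)), J.card = m + 1 →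
      ∃! f, JKPolytope.IsCanonicalFunction m (JKPolytope.simplexCone Z J)
        (JKPolytope.detForm m) f) ∧
    (∃ ω, JKPolytope.IsFiberForm Z ω) ∧
    ∀ ω, JKPolytope.IsFiberForm Z ω →
    ∀ B : Matrix (Fin (r + m + 1)) (Fin r) ℝ, JKPolytope.IsGaleDual Z B →
    -- the coordinates on the fibers are oriented so that `ω` is positive on the positive fibers
    (∀ C : Fin (r + m + 1) → ℝ, (∀ i, 0 < C i) → 0 < ω C B.col) →
    ∀ σ ∈ JKPolytope.secondaryFan Z B, ∀ ξ ∈ interior σ,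
      (∀ Y : Fin (m + 1) → ℝ,
        (∀ J : Finset (Fin (r + m + 1)), J.card = m → Y ∉ Submodule.span ℝ (Z.col '' J)) →
        (∀ c, Z.mulVec c = Y →
          JKPolytope.HasJKResidue B c (JKPolytope.pullbackCoeff ω B c) ξ
            (JKPolytope.canonicalFunction (JKPolytope.amplituhedronCone Z) Y)) ∧
        JKPolytope.canonicalFunction (JKPolytope.amplituhedronCone Z) Y =
          ∑ I : Finset (Fin (r + m + 1)) with I.card = r ∧ σ ⊆ JKPolytope.posCone B I,
            JKPolytope.canonicalFunction (JKPolytope.simplexCone Z Iᶜ) Y) ∧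
      ∀ h, B.vecMul h = ξ →
        JKPolytope.IsRegularTriangulation Z h
          {J | Jᶜ.card = r ∧ σ ⊆ JKPolytope.posCone B Jᶜ} := by
  have hz := hZ.inGeneralPosition
  have hmn : m < r + m + 1 := by omega
  have hfac := hZ.facets_nonempty hmn
  refine ⟨?_, fun J hJ => ?_, ?_, ?_⟩
  · obtain ⟨h, hh⟩ := JKPolytope.exists_isSimplicialHeight Z.col
    obtain ⟨f, hf, -⟩ := JKPolytope.exists_isCanonicalFunction hz hmn hfac hh
    rw [JKPolytope.amplituhedronCone_eq]
    exact JKPolytope.existsUnique_of_span_eq_top (JKPolytope.span_posCone_univ_eq_top hz hmn) hf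
  · exact JKPolytope.existsUnique_of_span_eq_top
      ((JKPolytope.span_posCone Z.col J).trans (JKPolytope.span_eq_top hz hJ))
      (JKPolytope.isCanonicalFunction_simplexFunction hz hJ)
  · obtain ⟨B, hB⟩ := JKPolytope.exists_isGaleDual hz
    exact JKPolytope.exists_isFiberForm hz hB
  · intro ω hω B hB hpos σ hσ ξ hξ
    have hlift : ∃ h, B.vecMul h = ξ := by
      obtain ⟨h₀, rfl⟩ := hσ
      obtain ⟨h, h1, -⟩ := interior_subset hξ
      exact ⟨h, h1⟩
    refine ⟨fun Y hY => ?_, ?_⟩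
    · obtain ⟨h, rfl⟩ := hlift
      have hh := JKPolytope.isSimplicialHeight_of_mem_interior hz hB hσ hξ
      have hYw : ∀ F : Finset (Fin (r + m + 1)), F.card = m → JKPolytope.wall Z.col F Y ≠ 0 :=
        fun F hF => JKPolytope.wall_ne_zero_of_notMem_span hz hmn hF (hY F hF)
      obtain ⟨κ, hκ⟩ := hB.kernelDet_eq hz
      rw [JKPolytope.amplituhedronCone_eq,
        JKPolytope.canonicalFunction_posCone_univ hz hmn hfac hh hYw]
      refine ⟨fun c hc => JKPolytope.hasJKResidue_fiberForm hz hB hκ (hω.kappa_pos hz hB hκ hpos)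
        hω hYw hc h, ?_⟩
      rw [JKPolytope.sum_lowerSimplices hz hB]
      have hc : ∀ I : Finset (Fin (r + m + 1)), I.card = r → Iᶜ.card = m + 1 := fun I hI =>
        JKPolytope.card_compl_eq_iff.mp (by rwa [compl_compl])
      -- The residue selects the `I` with `ξ` in `C_I`, the formula those with `σ` inside `C_I`;
      -- both mean that the complement of `I` is a lower simplex.
      refine Finset.sum_congr (Finset.filter_congr fun I _ => and_congr_right fun hI => ?_)
        fun I hI => ?_
      · have h1 := JKPolytope.subset_posCone_compl_iff hz hB hσ hξ (hc I hI)
        have h2 := hB.vecMul_mem_posCone_iff hz (hc I hI) h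
        rw [compl_compl] at h1 h2
        rw [h1, h2]
      · rw [JKPolytope.simplexCone,
          JKPolytope.canonicalFunction_posCone hz (hc I (Finset.mem_filter.mp hI).2.1)]
    · rintro h rfl
      rw [JKPolytope.setOf_subset_posCone hz hB hσ hξ]
      exact (JKPolytope.isSimplicialHeight_of_mem_interior hz hB hσ hξ).isRegularTriangulation hZ
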